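/- For $0<s<1$ let $K_s:\mathbb R\to\mathbb R$ be the kernel with Fourier transform $\int_{\mathbb R}K_s(x)e^{-ix\xi}\,dx=\left(\frac{\tanh\xi}{\xi}\right)^{s}$, and write $K=K_{1/2}$. For $\alpha>0$ let $\Psi_\alpha:\mathbb R\to[0,\infty)$ be the even function with $$\Psi_\alpha(t)=\alpha t^2-\tfrac13t^3\quad(0\le t<\alpha),\qquad \Psi_\alpha(t)=\tfrac23\alpha^3+\alpha^2(t-\alpha)+(t-\alpha)^3\quad(t\ge\alpha),$$ let $\mathcal L^{\Psi_\alpha}$ be the space of measurable $f:\mathbb R\to\mathbb R$ with $\int_{\mathbb R}\Psi_\alpha(cf)\,dx<\infty$ for some $c>0$, with gauge norm $N_{\Psi_\alpha}(f)=\inf\{\lambda>0:\int_{\mathbb R}\Psi_\alpha(f/\lambda)\,dx\le1\}$, and put $$J_\alpha=\sup\{\|K_{1/4}*f\|_{L^2(\mathbb R)}: f\in\mathcal L^{\Psi_\alpha},\ N_{\Psi_\alpha}(f)=1\}.$$ A *maximizer* $f_\alpha$ is a continuous function on $\mathbb R$ that is bell-shaped (even, nonnegative, and decreasing on the positive half-axis),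 satisfies $N_{\Psi_\alpha}(f_\alpha)=1$ and attains this supremum, $\|K_{1/4}*f_\alpha\|_{L^2}=J_\alpha$. Define the threshold $$\alpha_0=\inf\{\xi>0:\ \text{for every }\alpha\in(\xi,\infty)\text{ there exists a maximizer } f_\alpha\text{ with } f_\alpha(0)<\alpha\}.$$ Then $\alpha_0$ is strictly positive, $$1<\alpha_0J_{\alpha_0}^2<\tfrac32,$$ and $$\alpha_0<\left(\tfrac32\right)^{4/3}\left(\tfrac2\pi+1\right)^{2/3}\approx2.385.$$ Consequently solutions of intermediate size are obtained: for every $\alpha>\alpha_0$ (in particular for every $\alpha\ge(\frac32)^{4/3}(\frac2\pi+1)^{2/3}$) there is a maximizer $f_\alpha$ with $f_\alpha(0)<\alpha$ for which $$\varphi=\frac{J_\alpha^2f_\alpha}{2-\frac13\int_{\mathbb R}f_\alpha^3\,dx},\qquad \mu=\frac{2\alpha J_\alpha^2}{2-\frac13\int_{\mathbb R}f_\alpha^3\,dx}$$ is a solitary-wave solution of the steady Whitham equation with speed $\mu$: $\varphi\in L^p(\mathbb R)$ for some $p\in[1,\infty)$ and $-\mu\varphi+K*\varphi+\varphi^2=0$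 almost everywhere. -/

import Mathlib

open MeasureTheory Filter Topology

noncomputable section

namespace Whitham

/-- The symbol `(tanh ξ / ξ) ^ s`, equal to `1` at `ξ = 0`. -/
def symbol (s ξ : ℝ) : ℝ :=
  if ξ = 0 then 1 else (Real.tanh ξ / ξ) ^ s

/-- The kernel `K_s` with Fourier transform `∫ K_s(x) e^{-ixξ} dx = (tanh ξ / ξ) ^ s`, that is
`K_s(x) = (1 / 2π) ∫ (tanh ξ / ξ) ^ s e^{ixξ} dξ`. For `0 < s < 1` this oscillatory integral is
not absolutely convergent; it is the limit of the integrals regularised by `e^{-εξ²}`, `ε ↓ 0`,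
and this limit exists for every `x ≠ 0`. The symbol is even, so `e^{ixξ}` reduces to
`cos (x ξ)`. -/
def kernel (s x : ℝ) : ℝ :=
  limUnder (𝓝[>] (0 : ℝ)) fun ε : ℝ =>
    (2 * Real.pi)⁻¹ * ∫ ξ : ℝ, symbol s ξ * Real.cos (x * ξ) * Real.exp (-ε * ξ ^ 2)

/-- The convolution `K_s ∗ f` on the real line. -/
def conv (s : ℝ) (f : ℝ → ℝ) : ℝ → ℝ :=
  convolution (kernel s) f (ContinuousLinearMap.mul ℝ ℝ) volume

/-- The (even) Young function `Ψ` with parameter `α`. -/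
def young (α t : ℝ) : ℝ :=
  if |t| < α then α * |t| ^ 2 - |t| ^ 3 / 3
  else 2 / 3 * α ^ 3 + α ^ 2 * (|t| - α) + (|t| - α) ^ 3

/-- Membership in the Orlicz space of `Ψ`. -/
def MemOrlicz (α : ℝ) (f : ℝ → ℝ) : Prop :=
  AEMeasurable f volume ∧
    ∃ c : ℝ, 0 < c ∧ ∫⁻ x, ENNReal.ofReal (young α (c * f x)) < ⊤

/-- The gauge norm `N_Ψ(f) = inf {r > 0 : ∫ Ψ(f / r) ≤ 1}`. -/
def gaugeNorm (α : ℝ) (f : ℝ → ℝ) : ℝ :=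
  sInf {r : ℝ | 0 < r ∧ ∫⁻ x, ENNReal.ofReal (young α (f x / r)) ≤ 1}

/-- Admissible functions: elements of the Orlicz space with gauge norm one. -/
def Admissible (α : ℝ) (f : ℝ → ℝ) : Prop :=
  MemOrlicz α f ∧ gaugeNorm α f = 1

/-- The functional `‖K_{1/4} ∗ f‖_{L²}`. -/
def energy (f : ℝ → ℝ) : ℝ :=
  (eLpNorm (conv (1 / 4) f) 2 volume).toReal

/-- `J_α`, the supremum of the functional over all admissible functions. -/
def J (α : ℝ) : ℝ :=
  sSup {j : ℝ | ∃ f : ℝ → ℝ, Admissible α f ∧ j = energy f}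

/-- Even, nonnegative and decreasing on the positive half-axis. -/
def BellShaped (f : ℝ → ℝ) : Prop :=
  (∀ x, f (-x) = f x) ∧ (∀ x, 0 ≤ f x) ∧ AntitoneOn f (Set.Ioi 0)

/-- A bell-shaped maximizer `f_α`, given by its continuous representative, so that `f_α(0)` is
meaningful. -/
def IsMaximizer (α : ℝ) (f : ℝ → ℝ) : Prop :=
  Continuous f ∧ BellShaped f ∧ Admissible α f ∧ energy f = J α

/-- The threshold `α₀`. -/
def threshold : ℝ :=
  sInf {ξ : ℝ | 0 < ξ ∧ ∀ α : ℝ, ξ < α → ∃ f : ℝ → ℝ, IsMaximizer α f ∧ f 0 < α}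

/-- A solitary wave of speed `μ`: a solution of `-μ φ + K ∗ φ + φ² = 0` almost everywhere, with
`K = K_{1/2}`, that lies in `L^p` for some `1 ≤ p < ∞`. -/
def IsSolitaryWave (μ : ℝ) (φ : ℝ → ℝ) : Prop :=
  (∃ p : ENNReal, 1 ≤ p ∧ p ≠ ⊤ ∧ MemLp φ p volume) ∧
    ∀ᵐ x : ℝ, -μ * φ x + conv (1 / 2) φ x + φ x ^ 2 = 0

end Whitham

end

/-! Everything rests on one fact about the kernel: in `z = ξ²`, the symbol `(tanh ξ / ξ)^s` is the
Laplace transform of a probability measure. By Euler's cotangent expansion, `ξ coth ξ` is a limit of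
functions `m - L(z)` with `L` a sum of Laplace transforms, and `(m - L)^(-s)` expands in powers of
`L / m` with nonnegative coefficients (`exists_mixing`). So `K_s` is a mixture of heat kernels, i.e.
a probability density, even and decreasing in `|x|`. With `K_{1/4} ∗ K_{1/4} = K_{1/2}`, the squared
functional becomes the form `quad f = ∬ f(x) f(x + u) dx dκ(u)`, `κ = kap (1 / 2)`.

Bounds for `α J²`. Wide low indicator functions give `α J² > 1` for every `α` (`one_lt_mul_J_sq`),
and indicators of height `3α/2` give `α J² > 3/2` for small `α`. A maximizer with `f(0) < α` has
`Ψ(f) ≥ (2/3) α f²`, which forces `α J² ≤ 3/2`; hence `α₀ > 0`.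

Existence. Discretisation and polarization provide a bell-shaped maximizing sequence, and Helly's
theorem a limit `f`. Since `nsq - quad` is an integral of squares and `α f² - Ψ(f)` has an
integrable majorant, two uses of Fatou's lemma give `α J² ≤ 1 - M + α quad f`, `M` being the modular
of `f`. Dilation gives `quad f ≤ J² M`. Together these yield `(α J² - 1)(1 - M) ≤ 0`, so no mass is
lost (`exists_bell_maximizer`).

Upper bound for `α₀`. The Euler–Lagrange equation is `K ∗ f = (J² / L) Ψ'(f)`, where `L = ∫ f Ψ'(f)`
and `L ≤ 2` by dilation. Using it twice reduces the supremum of `K ∗ f` to the `L²` norms of `K_1`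
and of `f`. For `α³ ≥ 12` this keeps `Ψ'(f)` below `α²`, that is `f < α` (`exists_avg_bound`), so
`α₀ ≤ 12^(1/3)`. Below `α` one has `Ψ'(f) = 2αf - f²`, and the rescaled equation is the Whitham
equation.

Strictness at `α₀`. For `α > α₀`, the equation at the origin, together with the mass of `κ` far out
where `f ≤ f(0) / 2`, improves `α J² ≤ 3/2` by a uniform amount (`exists_mul_J_sq_le`). One-sided
continuity of `J` carries this to `α₀`. -/

noncomputable section

namespace Whitham

open Set

/-! ### Laplace transforms of measures on the half-line -/

section

/-- `F` is, on `[0, ∞)`, the Laplace transform of a measure carried by `[0, ∞)`. -/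
def IsLaplace (F : ℝ → ℝ) : Prop :=
  ∃ μ : Measure ℝ, μ (Iio 0) = 0 ∧
    ∀ z, 0 ≤ z → ∫⁻ t, ENNReal.ofReal (Real.exp (-(z * t))) ∂μ = ENNReal.ofReal (F z)

lemma measurable_laplaceIntegrand (z : ℝ) :
    Measurable fun t : ℝ => ENNReal.ofReal (Real.exp (-(z * t))) := by fun_prop

lemma measure_univ_of_laplace {μ : Measure ℝ} {F : ℝ → ℝ}
    (h : ∀ z, 0 ≤ z → ∫⁻ t, ENNReal.ofReal (Real.exp (-(z * t))) ∂μ = ENNReal.ofReal (F z)) :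
    μ univ = ENNReal.ofReal (F 0) := by
  simpa using h 0 le_rfl

lemma isLaplace_one : IsLaplace fun _ => 1 :=
  ⟨Measure.dirac 0, by simp, fun z _ => by
    rw [lintegral_dirac' _ (measurable_laplaceIntegrand z)]; simp⟩

lemma IsLaplace.congr {F G : ℝ → ℝ} (hF : IsLaplace F) (h : ∀ z, 0 ≤ z → F z = G z) :
    IsLaplace G := by
  obtain ⟨μ, h0, hμ⟩ := hF
  exact ⟨μ, h0, fun z hz => by rw [hμ z hz, h z hz]⟩

lemma IsLaplace.const_mul {F : ℝ → ℝ} (hF : IsLaplace F) {c : ℝ} (hc : 0 ≤ c) :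
    IsLaplace fun z => c * F z := by
  obtain ⟨μ, h0, hμ⟩ := hF
  refine ⟨ENNReal.ofReal c • μ, by simp [h0], fun z hz => ?_⟩
  rw [lintegral_smul_measure, hμ z hz, ENNReal.ofReal_mul hc, smul_eq_mul]

lemma IsLaplace.mul {F G : ℝ → ℝ} (hF : IsLaplace F) (hG : IsLaplace G)
    (hF0 : ∀ z, 0 ≤ z → 0 ≤ F z) : IsLaplace fun z => F z * G z := by
  obtain ⟨μ, h0, hμ⟩ := hF
  obtain ⟨ν, h1, hν⟩ := hG
  have : IsFiniteMeasure μ := ⟨by rw [measure_univ_of_laplace hμ]; exact ENNReal.ofReal_lt_top⟩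
  have : IsFiniteMeasure ν := ⟨by rw [measure_univ_of_laplace hν]; exact ENNReal.ofReal_lt_top⟩
  refine ⟨μ.conv ν, ?_, fun z hz => ?_⟩
  · rw [Measure.conv, Measure.map_apply (by fun_prop) measurableSet_Iio]
    refine measure_mono_null (t := Iio 0 ×ˢ univ ∪ univ ×ˢ Iio 0) ?_ ?_
    · rintro ⟨x, y⟩ h
      simp only [mem_preimage, mem_Iio, mem_union, mem_prod, mem_univ, and_true, true_and] at h ⊢
      by_contra hcon
      push Not at hcon
      linarith
    · refine measure_union_null ?_ ?_ <;> simp [Measure.prod_prod, h0, h1]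
  · rw [Measure.lintegral_conv (measurable_laplaceIntegrand z)]
    have : ∀ x y : ℝ, ENNReal.ofReal (Real.exp (-(z * (x + y)))) =
        ENNReal.ofReal (Real.exp (-(z * x))) * ENNReal.ofReal (Real.exp (-(z * y))) := by
      intro x y
      rw [← ENNReal.ofReal_mul (Real.exp_pos _).le, ← Real.exp_add]
      ring_nf
    simp_rw [this]
    simp_rw [lintegral_const_mul _ (measurable_laplaceIntegrand z), hν z hz]
    rw [lintegral_mul_const _ (measurable_laplaceIntegrand z), hμ z hz,
      ENNReal.ofReal_mul (hF0 z hz)]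

lemma IsLaplace.pow {F : ℝ → ℝ} (hF : IsLaplace F) (hF0 : ∀ z, 0 ≤ z → 0 ≤ F z) (n : ℕ) :
    IsLaplace fun z => F z ^ n := by
  induction n with
  | zero => simpa using isLaplace_one
  | succ n ih =>
    simp_rw [pow_succ']
    exact hF.mul ih hF0

lemma IsLaplace.hasSum {F : ℕ → ℝ → ℝ} {G : ℝ → ℝ} (hF : ∀ n, IsLaplace (F n))
    (hF0 : ∀ n z, 0 ≤ z → 0 ≤ F n z) (hG : ∀ z, 0 ≤ z → HasSum (fun n => F n z) (G z)) :
    IsLaplace G := by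
  choose μ h0 hμ using hF
  refine ⟨Measure.sum μ, by simp [h0], fun z hz => ?_⟩
  rw [lintegral_sum_measure]
  simp_rw [fun n => hμ n z hz]
  rw [← ENNReal.ofReal_tsum_of_nonneg (fun n => hF0 n z hz) (hG z hz).summable, (hG z hz).tsum_eq]

lemma isLaplace_exponential {c : ℝ} (hc : 0 < c) : IsLaplace fun z => c / (z + c) := by
  refine ⟨(volume.restrict (Ioi 0)).withDensity fun t => ENNReal.ofReal (c * Real.exp (-(c * t))),
    ?_, fun z hz => ?_⟩
  · rw [withDensity_apply _ measurableSet_Iio, Measure.restrict_restrict measurableSet_Iio]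
    have : Iio (0 : ℝ) ∩ Ioi 0 = ∅ := by ext x; simp; intro h; linarith
    simp [this]
  · rw [lintegral_withDensity_eq_lintegral_mul _ (by fun_prop) (by fun_prop)]
    have hneg : -(z + c) < 0 := by linarith
    have hint : IntegrableOn (fun t => c * Real.exp (-(z + c) * t)) (Ioi 0) :=
      (integrableOn_exp_mul_Ioi hneg 0).const_mul c
    have hval : ∫ t in Ioi (0 : ℝ), c * Real.exp (-(z + c) * t) = c / (z + c) := by
      rw [integral_const_mul, integral_exp_mul_Ioi hneg]
      have : z + c ≠ 0 := by linarith
      simp only [mul_zero, Real.exp_zero]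
      field_simp
    change _ = ENNReal.ofReal (c / (z + c))
    rw [← hval, ofReal_integral_eq_lintegral_ofReal hint
      (Eventually.of_forall fun t => by positivity)]
    refine lintegral_congr fun t => ?_
    rw [Pi.mul_apply, ← ENNReal.ofReal_mul (by positivity), mul_assoc, ← Real.exp_add]
    ring_nf

/-- The binomial coefficients of exponent `-s` are rising factorials of `s` over `n!`, hence
nonnegative. The series is taken from the complex binomial theorem. -/
lemma hasSum_one_sub_rpow_neg {s : ℝ} (hs : 0 < s) :
    ∃ c : ℕ → ℝ, (∀ n, 0 ≤ c n) ∧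
      ∀ q : ℝ, 0 ≤ q → q < 1 → HasSum (fun n => c n * q ^ n) ((1 - q) ^ (-s)) := by
  refine ⟨fun n => Ring.choose (s + n - 1) n, fun n => ?_, fun q hq0 hq1 => ?_⟩
  · have h := Ring.factorial_nsmul_multichoose_eq_ascPochhammer s n
    rw [Polynomial.ascPochhammer_smeval_eq_eval] at h
    have hp := ascPochhammer_pos n s hs
    rw [← h, nsmul_eq_mul] at hp
    have : Ring.choose (s + n - 1) n = Ring.multichoose s n := by
      rw [Ring.choose]; congr 1; ring
    change 0 ≤ Ring.choose (s + n - 1) n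
    rw [this]
    exact (pos_of_mul_pos_right hp (by positivity)).le
  · have h := (Complex.one_div_one_sub_cpow_hasFPowerSeriesOnBall_zero (s : ℂ)).hasSum
      (y := (q : ℂ)) (by
        rw [Metric.mem_eball, edist_zero_right, ← ofReal_norm, Complex.norm_real,
          Real.norm_of_nonneg hq0]
        exact ENNReal.ofReal_lt_one.2 hq1)
    have h1 : (1 : ℂ) / (1 - (0 + (q : ℂ))) ^ (s : ℂ) = (((1 - q) ^ (-s) : ℝ) : ℂ) := by
      rw [Real.rpow_neg (by linarith), Complex.ofReal_inv, Complex.ofReal_cpow (by linarith)]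
      simp
    rw [h1] at h
    rw [← Complex.hasSum_ofReal]
    have e : (fun n : ℕ => ((Ring.choose (s + n - 1) n * q ^ n : ℝ) : ℂ)) = fun n =>
        (FormalMultilinearSeries.ofScalars ℂ (fun n => Ring.choose ((s : ℂ) + n - 1) n) n)
          fun _ => (q : ℂ) := by
      funext n
      simp [Complex.ofReal_choose, mul_comm]
    rw [← e] at h
    exact h

/-- Factor out `m ^ (-s)` and expand in powers of `L / m < 1`. The coefficients are nonnegative, and
products and sums of transforms are transforms. -/
lemma IsLaplace.rpow_neg_one_add {L : ℝ → ℝ} (hL : IsLaplace L) {m s : ℝ} (hs : 0 < s)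
    (hL0 : ∀ z, 0 ≤ z → 0 ≤ L z) (hm : ∀ z, 0 ≤ z → L z < m) :
    IsLaplace fun z => (m - L z) ^ (-s) := by
  have hm0 : 0 < m := lt_of_le_of_lt (hL0 0 le_rfl) (hm 0 le_rfl)
  obtain ⟨c, hc, hsum⟩ := hasSum_one_sub_rpow_neg hs
  have hq : IsLaplace fun z => m⁻¹ * L z := hL.const_mul (by positivity)
  have hq0 : ∀ z, 0 ≤ z → 0 ≤ m⁻¹ * L z := fun z hz => mul_nonneg (by positivity) (hL0 z hz)
  have hq1 : ∀ z, 0 ≤ z → m⁻¹ * L z < 1 := fun z hz => by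
    rw [inv_mul_lt_one₀ hm0]; exact hm z hz
  have h : IsLaplace fun z => (1 - m⁻¹ * L z) ^ (-s) :=
    IsLaplace.hasSum (F := fun n z => c n * (m⁻¹ * L z) ^ n)
      (fun n => (hq.pow hq0 n).const_mul (hc n))
      (fun n z hz => mul_nonneg (hc n) (pow_nonneg (hq0 z hz) n))
      fun z hz => hsum _ (hq0 z hz) (hq1 z hz)
  refine (h.const_mul (c := m ^ (-s)) (by positivity)).congr fun z hz => ?_
  rw [← Real.mul_rpow hm0.le (by linarith [hq1 z hz])]
  congr 1
  field_simp

end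

/-! ### Partial fractions of `ξ coth ξ`: the symbol as a mixture of Gaussians -/

section

/-- The partial sums of the partial fraction expansion of `ξ coth ξ`, as functions of `z = ξ²`. -/
def cothPartial (N : ℕ) (z : ℝ) : ℝ :=
  1 + ∑ n ∈ Finset.range N, 2 * z / (z + ((n + 1) * Real.pi) ^ 2)

/-- This exhibits the shape `m - L(z)` that `IsLaplace.rpow_neg_one_add` requires. -/
lemma cothPartial_eq (N : ℕ) {z : ℝ} (hz : 0 ≤ z) :
    cothPartial N z =
      (1 + 2 * N) - ∑ n ∈ Finset.range N,
        2 * (((n + 1) * Real.pi) ^ 2 / (z + ((n + 1) * Real.pi) ^ 2)) := by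
  have h : ∀ n ∈ Finset.range N, 2 * z / (z + ((n + 1) * Real.pi) ^ 2) =
      2 - 2 * (((n + 1) * Real.pi) ^ 2 / (z + ((n + 1) * Real.pi) ^ 2)) := by
    intro n _
    have : 0 < z + ((n + 1) * Real.pi) ^ 2 := by positivity
    field_simp
    ring
  rw [cothPartial, Finset.sum_congr rfl h, Finset.sum_sub_distrib]
  simp
  ring

lemma one_le_cothPartial (N : ℕ) {z : ℝ} (hz : 0 ≤ z) : 1 ≤ cothPartial N z := by
  rw [cothPartial]
  have : 0 ≤ ∑ n ∈ Finset.range N, 2 * z / (z + ((n + 1) * Real.pi) ^ 2) :=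
    Finset.sum_nonneg fun n _ => by positivity
  linarith

lemma isLaplace_cothPartial (N : ℕ) {s : ℝ} (hs : 0 < s) :
    IsLaplace fun z => cothPartial N z ^ (-s) := by
  have hterm : ∀ n : ℕ, IsLaplace fun z =>
      2 * (((n + 1) * Real.pi) ^ 2 / (z + ((n + 1) * Real.pi) ^ 2)) := fun n =>
    (isLaplace_exponential (c := ((n + 1) * Real.pi) ^ 2) (by positivity)).const_mul two_pos.le
  have hsum : IsLaplace fun z => ∑ n ∈ Finset.range N,
      2 * (((n + 1) * Real.pi) ^ 2 / (z + ((n + 1) * Real.pi) ^ 2)) := by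
    refine IsLaplace.hasSum (F := fun n z => if n ∈ Finset.range N then
      2 * (((n + 1) * Real.pi) ^ 2 / (z + ((n + 1) * Real.pi) ^ 2)) else 0) (fun n => ?_)
      (fun n z hz => ?_) (fun z _ => ?_)
    · by_cases h : n ∈ Finset.range N
      · simpa only [h, if_true] using hterm n
      · simp only [h, if_false]
        exact ⟨0, by simp, by simp⟩
    · split_ifs <;> positivity
    · rw [← Finset.sum_congr rfl (fun n hn => if_pos hn)]
      exact hasSum_sum_of_ne_finset_zero (fun n hn => if_neg hn)
  refine (hsum.rpow_neg_one_add (m := 1 + 2 * N) hs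
    (fun z hz => Finset.sum_nonneg fun n _ => by positivity) fun z hz => ?_).congr
    fun z hz => by rw [cothPartial_eq N hz]
  have := one_le_cothPartial N hz
  rw [cothPartial_eq N hz] at this
  linarith

/-- Uniformity in `N` is the point: it gives tightness of the representing measures, and later the
quadratic behaviour of the symbol at `0`. -/
lemma cothPartial_le (N : ℕ) {z : ℝ} (hz : 0 ≤ z) : cothPartial N z ≤ 1 + z := by
  -- Telescoping bound; at `N = 0` the term `1 / N` is `0` by convention.
  have hs : ∀ N : ℕ, ∑ n ∈ Finset.range N, 1 / ((n : ℝ) + 1) ^ 2 ≤ 2 - 1 / (N : ℝ) := by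
    intro N
    induction N with
    | zero => norm_num
    | succ N ih =>
      rw [Finset.sum_range_succ]
      push_cast
      rcases Nat.eq_zero_or_pos N with rfl | hN
      · norm_num
      · have hN' : (0 : ℝ) < N := by exact_mod_cast hN
        have : 1 / (N : ℝ) - 1 / (N + 1) - 1 / ((N : ℝ) + 1) ^ 2 = 1 / (N * ((N : ℝ) + 1) ^ 2) := by
          field_simp
          ring
        have h2 : 0 < 1 / (N * ((N : ℝ) + 1) ^ 2) := by positivity
        linarith
  have hterm : ∀ n ∈ Finset.range N, 2 * z / (z + ((n + 1) * Real.pi) ^ 2) ≤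
      (z / 2) * (1 / ((n : ℝ) + 1) ^ 2) := by
    intro n _
    rw [div_mul_div_comm, mul_one, div_le_div_iff₀ (by positivity) (by positivity)]
    have hpi : 4 ≤ Real.pi ^ 2 := by nlinarith [Real.pi_gt_three]
    have : z * (2 * (2 * ((n : ℝ) + 1) ^ 2)) ≤ z * (z + ((n + 1) * Real.pi) ^ 2) := by
      apply mul_le_mul_of_nonneg_left _ hz
      rw [mul_pow]
      nlinarith [mul_le_mul_of_nonneg_left hpi (sq_nonneg ((n : ℝ) + 1))]
    linarith
  have h1 := Finset.sum_le_sum hterm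
  rw [← Finset.mul_sum] at h1
  have h2 := hs N
  have h3 : (0 : ℝ) ≤ 1 / N := by positivity
  have h4 := mul_le_mul_of_nonneg_left h2 (by linarith : 0 ≤ z / 2)
  rw [cothPartial]
  nlinarith

/-- Euler's expansion of the cotangent, evaluated at the imaginary point `iξ/π`. -/
lemma tendsto_cothPartial {ξ : ℝ} (hξ : ξ ≠ 0) :
    Tendsto (fun N => cothPartial N (ξ ^ 2)) atTop (𝓝 (Real.tanh ξ / ξ)⁻¹) := by
  have hpi := Real.pi_ne_zero
  have hsh : Real.sinh ξ ≠ 0 := by simpa using hξ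
  set x : ℂ := ξ / Real.pi * Complex.I with hx
  have hxmem : x ∈ Complex.integerComplement := by
    rintro ⟨n, hn⟩
    have := congrArg Complex.im hn
    rw [hx, ← Complex.ofReal_div] at this
    simp at this
    rcases div_eq_zero_iff.1 this.symm with h | h
    · exact hξ h
    · exact hpi h
  have h := tendsto_logDeriv_euler_cot_sub hxmem
  have hterm : ∀ n : ℕ, cotTerm x n = -(Real.pi / ξ * Complex.I) *
      ((2 * ξ ^ 2 / (ξ ^ 2 + ((n + 1) * Real.pi) ^ 2) : ℝ) : ℂ) := by
    intro n
    have h1 : (x + (n + 1)) * (x - (n + 1)) = 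
        -(((ξ ^ 2 + ((n + 1) * Real.pi) ^ 2) / Real.pi ^ 2 : ℝ) : ℂ) := by
      have : (x + (n + 1)) * (x - (n + 1)) = x ^ 2 - (n + 1) ^ 2 := by ring
      rw [this, hx, mul_pow, Complex.I_sq]
      push_cast
      field_simp
      ring
    have h2 : (0 : ℝ) < ξ ^ 2 + ((n + 1) * Real.pi) ^ 2 := by positivity
    have h3 : ((ξ : ℂ) ^ 2 + ((n + 1) * Real.pi) ^ 2) ≠ 0 := by exact_mod_cast h2.ne'
    have h4 : (ξ : ℂ) ≠ 0 := by exact_mod_cast hξ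
    rw [cotTerm_identity hxmem, h1, hx]
    push_cast
    field_simp
  have hval : Real.pi * Complex.cot (Real.pi * x) - 1 / x =
      -(Real.pi / ξ * Complex.I) * (((Real.tanh ξ / ξ)⁻¹ - 1 : ℝ) : ℂ) := by
    have h4 : (ξ : ℂ) ≠ 0 := by exact_mod_cast hξ
    have h5 : (Complex.sinh ξ) ≠ 0 := by
      rw [← Complex.ofReal_sinh]; exact_mod_cast hsh
    have h6 : (Complex.cosh ξ) ≠ 0 := by
      rw [← Complex.ofReal_cosh]; exact_mod_cast (Real.cosh_pos ξ).ne'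
    have : (Real.pi : ℂ) * x = ξ * Complex.I := by rw [hx]; field_simp
    rw [this, Complex.cot, Complex.cos_mul_I, Complex.sin_mul_I, hx, Real.tanh_eq_sinh_div_cosh]
    push_cast
    field_simp
    simp [Complex.I_sq]
    try ring
  rw [hval] at h
  simp_rw [hterm, ← Finset.mul_sum, ← Complex.ofReal_sum] at h
  have hc : -((Real.pi : ℂ) / ξ * Complex.I) ≠ 0 := by
    simp [hξ]
  have h' := (h.const_mul (-((Real.pi : ℂ) / ξ * Complex.I))⁻¹)
  simp only [inv_mul_cancel_left₀ hc] at h'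
  have h'' := (Complex.continuous_re.tendsto _).comp h'
  simp only [Function.comp_def, Complex.ofReal_re] at h''
  simpa [cothPartial] using h''.const_add 1

lemma tanh_div_self_pos {ξ : ℝ} (hξ : ξ ≠ 0) : 0 < Real.tanh ξ / ξ := by
  rw [Real.tanh_eq_sinh_div_cosh]
  rcases lt_or_gt_of_ne hξ with h | h
  · exact div_pos_of_neg_of_neg
      (div_neg_of_neg_of_pos (Real.sinh_neg_iff.2 h) (Real.cosh_pos ξ)) h
  · exact div_pos (div_pos (Real.sinh_pos_iff.2 h) (Real.cosh_pos ξ)) h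

lemma tendsto_cothPartial_rpow (s ξ : ℝ) :
    Tendsto (fun N => cothPartial N (ξ ^ 2) ^ (-s)) atTop (𝓝 (symbol s ξ)) := by
  by_cases hξ : ξ = 0
  · subst hξ
    simp [cothPartial, symbol]
  · have hpos := tanh_div_self_pos hξ
    have := (tendsto_cothPartial hξ).rpow_const (p := -s) (Or.inl (by positivity))
    rw [symbol, if_neg hξ]
    convert this using 2
    rw [Real.inv_rpow hpos.le, Real.rpow_neg hpos.le, inv_inv]

lemma abs_tanh_le_one (ξ : ℝ) : |Real.tanh ξ| ≤ 1 := by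
  exact (Real.abs_tanh_lt_one ξ).le

lemma symbol_nonneg (s ξ : ℝ) : 0 ≤ symbol s ξ := by
  rw [symbol]
  split_ifs with h
  · exact zero_le_one
  · exact Real.rpow_nonneg (tanh_div_self_pos h).le _

/-- The symbol is a mixture of Gaussians. -/
theorem exists_mixing {s : ℝ} (hs : 0 < s) :
    ∃ ν : ProbabilityMeasure ℝ, (ν : Measure ℝ) (Iio 0) = 0 ∧
      ∀ ξ : ℝ, ∫ t, Real.exp (-(ξ ^ 2 * max t 0)) ∂(ν : Measure ℝ) = symbol s ξ := by
  choose μ h0 hμ using fun N => isLaplace_cothPartial N hs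
  have hprob : ∀ N, IsProbabilityMeasure (μ N) := fun N => ⟨by
    rw [measure_univ_of_laplace (hμ N)]; simp [cothPartial]⟩
  let ν : ℕ → ProbabilityMeasure ℝ := fun N => ⟨μ N, hprob N⟩
  have hae : ∀ N, ∀ᵐ t ∂μ N, 0 ≤ t := fun N => by
    rw [ae_iff]; simp only [not_le]; exact h0 N
  have hint : ∀ N z, 0 ≤ z → ∫ t, Real.exp (-(z * max t 0)) ∂μ N = cothPartial N z ^ (-s) := by
    intro N z hz
    rw [integral_eq_lintegral_of_nonneg_ae (Eventually.of_forall fun t => (Real.exp_pos _).le)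
      (by fun_prop)]
    rw [lintegral_congr_ae (g := fun t => ENNReal.ofReal (Real.exp (-(z * t)))), hμ N z hz,
      ENNReal.toReal_ofReal]
    · exact Real.rpow_nonneg (zero_le_one.trans (one_le_cothPartial N hz)) _
    · filter_upwards [hae N] with t ht
      rw [max_eq_left ht]
  -- Chebyshev's inequality with `z = 1 / T`: for `t > T` the function `1 - exp(-t / T)` is at least
  -- `1 - 1/e > 1/2`, and its mean is controlled uniformly in `N`.
  have htail : ∀ N T, 0 < T → μ N (Metric.closedBall 0 T)ᶜ ≤
      ENNReal.ofReal (2 * (1 - (1 + T⁻¹) ^ (-s))) := by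
    intro N T hT
    have hz : 0 ≤ T⁻¹ := by positivity
    have hintg : Integrable (fun t => Real.exp (-(T⁻¹ * max t 0))) (μ N) := by
      refine Integrable.of_bound (by fun_prop) 1 (Eventually.of_forall fun t => ?_)
      rw [Real.norm_of_nonneg (Real.exp_pos _).le, Real.exp_le_one_iff]
      have : 0 ≤ T⁻¹ * max t 0 := by positivity
      linarith
    have h1 : ∫ t, (1 - Real.exp (-(T⁻¹ * max t 0))) ∂μ N = 1 - cothPartial N T⁻¹ ^ (-s) := by
      rw [integral_sub (integrable_const _) hintg, hint N _ hz]
      simp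
    have h2 := mul_meas_ge_le_integral_of_nonneg (μ := μ N) (ε := 1 / 2)
      (f := fun t => 1 - Real.exp (-(T⁻¹ * max t 0)))
      (Eventually.of_forall fun t => by
        have : 0 ≤ T⁻¹ * max t 0 := by positivity
        simpa using this) ((integrable_const _).sub hintg)
    rw [h1] at h2
    have h3 : (1 + T⁻¹) ^ (-s) ≤ cothPartial N T⁻¹ ^ (-s) :=
      Real.rpow_le_rpow_of_nonpos (zero_lt_one.trans_le (one_le_cothPartial N hz))
        (cothPartial_le N hz) (by linarith)
    have h4 : (Metric.closedBall (0 : ℝ) T)ᶜ ⊆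
        Iio 0 ∪ {t | (1 : ℝ) / 2 ≤ 1 - Real.exp (-(T⁻¹ * max t 0))} := by
      intro t ht
      simp only [mem_compl_iff, Metric.mem_closedBall, dist_zero_right, Real.norm_eq_abs,
        not_le] at ht
      rcases lt_or_ge t 0 with h | h
      · exact Or.inl h
      · right
        rw [abs_of_nonneg h] at ht
        have h5 : 1 ≤ T⁻¹ * max t 0 := by
          rw [max_eq_left h, inv_mul_eq_div, one_le_div hT]; exact ht.le
        have h6 : Real.exp (-(T⁻¹ * max t 0)) ≤ Real.exp (-1) := Real.exp_le_exp.2 (by linarith)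
        have h7 : Real.exp (-1) < 1 / 2 := by
          have := Real.exp_neg_one_lt_d9
          linarith
        change (1 : ℝ) / 2 ≤ 1 - _
        linarith
    calc μ N (Metric.closedBall 0 T)ᶜ
        ≤ μ N (Iio 0) + μ N {t | (1 : ℝ) / 2 ≤ 1 - Real.exp (-(T⁻¹ * max t 0))} :=
          (measure_mono h4).trans (measure_union_le _ _)
      _ = ENNReal.ofReal ((μ N).real {t | (1 : ℝ) / 2 ≤ 1 - Real.exp (-(T⁻¹ * max t 0))}) := by
          rw [h0 N, zero_add, Measure.real, ENNReal.ofReal_toReal (measure_ne_top _ _)]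
      _ ≤ _ := ENNReal.ofReal_le_ofReal (by linarith)
  have htight : IsTightMeasureSet {((μ : ProbabilityMeasure ℝ) : Measure ℝ) | μ ∈ range ν} := by
    rw [isTightMeasureSet_iff_exists_isCompact_measure_compl_le]
    intro ε hε
    have hlim : Tendsto (fun T : ℝ => ENNReal.ofReal (2 * (1 - (1 + T⁻¹) ^ (-s)))) atTop (𝓝 0) := by
      have h1 : Tendsto (fun T : ℝ => (1 + T⁻¹) ^ (-s)) atTop (𝓝 ((1 + 0) ^ (-s))) :=
        (tendsto_inv_atTop_zero.const_add 1).rpow_const (Or.inl (by norm_num))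
      have h2 := ENNReal.tendsto_ofReal ((h1.const_sub 1).const_mul 2)
      simpa using h2
    obtain ⟨T, hT, hT0⟩ := ((hlim.eventually_le_const hε).and (eventually_gt_atTop 0)).exists
    refine ⟨Metric.closedBall 0 T, isCompact_closedBall 0 T, ?_⟩
    rintro _ ⟨_, ⟨N, rfl⟩, rfl⟩
    exact (htail N T hT0).trans hT
  have hcomp := isCompact_closure_of_isTightMeasureSet htight
  -- A limit along an ultrafilter suffices, because the transforms themselves converge.
  obtain ⟨ρ, -, hρ⟩ := hcomp.ultrafilter_le_nhds ((hyperfilter ℕ : Ultrafilter ℕ).map ν)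
    (by
      rw [le_principal_iff]
      exact Eventually.of_forall (f := (hyperfilter ℕ : Filter ℕ)) fun N =>
        subset_closure (mem_range_self N))
  have hρ' : Tendsto ν (hyperfilter ℕ : Filter ℕ) (𝓝 ρ) := hρ
  rw [ProbabilityMeasure.tendsto_iff_forall_integral_tendsto] at hρ'
  refine ⟨ρ, ?_, fun ξ => ?_⟩
  -- A test function that is positive exactly on the negative half-line shows that the limit has no
  -- mass there.
  · let g : BoundedContinuousFunction ℝ ℝ := BoundedContinuousFunction.ofNormedAddCommGroup
      (fun t => min 1 (max (-t) 0)) (by fun_prop) 1 (fun t => by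
        rw [Real.norm_of_nonneg (by positivity)]; exact min_le_left _ _)
    have h1 := hρ' g
    have h2 : ∀ N, ∫ t, g t ∂(ν N : Measure ℝ) = 0 := fun N => by
      apply integral_eq_zero_of_ae
      filter_upwards [hae N] with t ht
      change min 1 (max (-t) 0) = 0
      rw [max_eq_right (by linarith)]
      simp
    simp only [h2] at h1
    have h3 := tendsto_nhds_unique h1 tendsto_const_nhds
    have h4 : ∀ t, 0 ≤ g t := fun t => by
      change 0 ≤ min 1 (max (-t) 0)
      positivity
    rw [integral_eq_zero_iff_of_nonneg h4 (g.integrable _)] at h3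
    have h5 : ∀ᵐ t ∂(ρ : Measure ℝ), ¬ t ∈ Iio (0 : ℝ) := by
      filter_upwards [h3] with t ht hlt
      have : min 1 (max (-t) 0) = 0 := ht
      have hlt' : t < 0 := hlt
      rw [max_eq_left (by linarith)] at this
      have : 0 < min 1 (-t) := lt_min one_pos (by linarith)
      linarith
    rw [ae_iff] at h5
    simp only [not_not] at h5
    exact h5
  -- The cut-off `max t 0` makes the exponential bounded on the whole line, hence admissible for
  -- weak convergence.
  · let g : BoundedContinuousFunction ℝ ℝ := BoundedContinuousFunction.ofNormedAddCommGroup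
      (fun t => Real.exp (-(ξ ^ 2 * max t 0))) (by fun_prop) 1 (fun t => by
        rw [Real.norm_of_nonneg (Real.exp_pos _).le, Real.exp_le_one_iff]
        have : 0 ≤ ξ ^ 2 * max t 0 := by positivity
        linarith)
    have h1 := hρ' g
    have h2 : ∀ N, ∫ t, g t ∂(ν N : Measure ℝ) = cothPartial N (ξ ^ 2) ^ (-s) :=
      fun N => hint N _ (sq_nonneg ξ)
    simp only [h2] at h1
    exact tendsto_nhds_unique h1
      ((tendsto_cothPartial_rpow s ξ).mono_left Nat.hyperfilter_le_atTop)

end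

/-! ### The mixing measure and the heat kernel -/

section

/-- The probability measure on `(0, ∞)` that represents the symbol as a mixture of Gaussians. -/
def mixing (s : ℝ) : Measure ℝ :=
  if hs : 0 < s then (exists_mixing hs).choose.toMeasure else Measure.dirac 1

instance (s : ℝ) : IsProbabilityMeasure (mixing s) := by
  rw [mixing]
  split_ifs <;> infer_instance

lemma integral_mixing_max {s : ℝ} (hs : 0 < s) (ξ : ℝ) :
    ∫ t, Real.exp (-(ξ ^ 2 * max t 0)) ∂mixing s = symbol s ξ := by
  rw [mixing, dif_pos hs]
  exact (exists_mixing hs).choose_spec.2 ξ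

lemma symbol_le_rpow {s ξ : ℝ} (hs : 0 < s) (hξ : 0 < ξ) : symbol s ξ ≤ (1 / ξ) ^ s := by
  rw [symbol, if_neg hξ.ne']
  refine Real.rpow_le_rpow (tanh_div_self_pos hξ.ne').le ?_ hs.le
  have := (abs_le.1 (abs_tanh_le_one ξ)).2
  gcongr

lemma symbol_neg (s ξ : ℝ) : symbol s (-ξ) = symbol s ξ := by
  simp [symbol, Real.tanh_neg]

/-- Mass on `(-∞, 0]` would keep the symbol away from `0`, while the symbol is at most `ξ ^ (-s)`.
-/
lemma mixing_ae_pos {s : ℝ} (hs : 0 < s) : ∀ᵐ t ∂mixing s, 0 < t := by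
  have h : ∀ ξ : ℝ, 0 < ξ → (mixing s).real (Iic 0) ≤ (1 / ξ) ^ s := by
    intro ξ hξ
    refine le_trans ?_ (symbol_le_rpow hs hξ)
    rw [← integral_mixing_max hs, ← integral_indicator_one measurableSet_Iic]
    refine integral_mono_of_nonneg (Eventually.of_forall fun t => ?_) ?_
      (Eventually.of_forall fun t => ?_)
    · exact indicator_nonneg (fun _ _ => zero_le_one) _
    · refine Integrable.of_bound (by fun_prop) 1 (Eventually.of_forall fun t => ?_)
      rw [Real.norm_of_nonneg (Real.exp_pos _).le, Real.exp_le_one_iff]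
      have : 0 ≤ ξ ^ 2 * max t 0 := by positivity
      linarith
    · by_cases ht : t ∈ Iic (0 : ℝ)
      · have : max t 0 = 0 := max_eq_right ht
        simp [indicator_of_mem ht, this]
      · simp [indicator_of_notMem ht, Real.exp_nonneg]
  have hlim : Tendsto (fun ξ : ℝ => (1 / ξ) ^ s) atTop (𝓝 0) := by
    have := (tendsto_rpow_neg_atTop hs)
    refine this.congr' ?_
    filter_upwards [eventually_gt_atTop 0] with ξ hξ
    rw [one_div, Real.inv_rpow hξ.le, Real.rpow_neg hξ.le]
  have h0 : (mixing s).real (Iic 0) ≤ 0 :=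
    ge_of_tendsto hlim ((eventually_gt_atTop 0).mono h)
  have h1 : mixing s (Iic 0) = 0 :=
    (measureReal_eq_zero_iff).1 (le_antisymm h0 measureReal_nonneg)
  rw [ae_iff]
  simp only [not_lt]
  exact h1

lemma integral_mixing {s : ℝ} (hs : 0 < s) (ξ : ℝ) :
    ∫ t, Real.exp (-(t * ξ ^ 2)) ∂mixing s = symbol s ξ := by
  rw [← integral_mixing_max hs]
  refine integral_congr_ae ?_
  filter_upwards [mixing_ae_pos hs] with t ht
  rw [max_eq_left ht.le, mul_comm]

/-- The heat kernel. -/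
def gauss (t x : ℝ) : ℝ := (√(4 * Real.pi * t))⁻¹ * Real.exp (-x ^ 2 / (4 * t))

lemma gauss_nonneg (t x : ℝ) : 0 ≤ gauss t x := by
  unfold gauss; positivity

lemma gauss_pos {t : ℝ} (ht : 0 < t) (x : ℝ) : 0 < gauss t x := by
  unfold gauss; positivity

lemma gauss_neg (t x : ℝ) : gauss t (-x) = gauss t x := by simp [gauss]

lemma measurable_gauss : Measurable (Function.uncurry gauss) := by
  unfold gauss Function.uncurry
  fun_prop

/-- The bound does not depend on `t`, so it dominates every mixture away from the origin. It comes
from `1 + y ≤ exp y` and a completed square. -/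
lemma gauss_le {t x : ℝ} (ht : 0 < t) (hx : x ≠ 0) : gauss t x ≤ |x|⁻¹ := by
  have hx' : 0 < |x| := abs_pos.2 hx
  have h1 : 0 < √(4 * Real.pi * t) := Real.sqrt_pos.2 (by positivity)
  rw [gauss, neg_div, Real.exp_neg, ← mul_inv]
  apply inv_anti₀ hx'
  have h2 : 1 + x ^ 2 / (4 * t) ≤ Real.exp (x ^ 2 / (4 * t)) := by
    have := Real.add_one_le_exp (x ^ 2 / (4 * t)); linarith
  have h3 : 2 * √t ≤ √(4 * Real.pi * t) := by
    rw [show (2 : ℝ) * √t = √(4 * t) by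
      rw [Real.sqrt_mul (by norm_num), show (4 : ℝ) = 2 ^ 2 by norm_num, Real.sqrt_sq (by norm_num)]]
    apply Real.sqrt_le_sqrt
    nlinarith [Real.pi_gt_three]
  have hst : 0 < √t := Real.sqrt_pos.2 ht
  have h4 : |x| ≤ 2 * √t * (1 + x ^ 2 / (4 * t)) := by
    have h5 : √t ^ 2 = t := Real.sq_sqrt ht.le
    have : 2 * √t * (1 + x ^ 2 / (4 * t)) - |x| =
        ((2 * √t - |x|) ^ 2 + 2 * √t * |x|) / (2 * √t) := by
      rw [← sq_abs x]
      nth_rewrite 2 [← h5]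
      field_simp
      ring
    have : 0 ≤ ((2 * √t - |x|) ^ 2 + 2 * √t * |x|) / (2 * √t) := by positivity
    linarith
  calc |x| ≤ 2 * √t * (1 + x ^ 2 / (4 * t)) := h4
    _ ≤ _ := mul_le_mul h3 h2 (by positivity) h1.le

lemma gauss_anti {t x y : ℝ} (ht : 0 < t) (hxy : |x| ≤ |y|) : gauss t y ≤ gauss t x := by
  unfold gauss
  have := sq_le_sq.2 hxy
  gcongr

lemma integrable_gauss {t : ℝ} (ht : 0 < t) : Integrable (gauss t) := by
  have := (integrable_exp_neg_mul_sq (b := (4 * t)⁻¹) (by positivity)).const_mul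
    (√(4 * Real.pi * t))⁻¹
  refine this.congr (Eventually.of_forall fun x => ?_)
  simp only [gauss]
  ring_nf

lemma integral_gauss {t : ℝ} (ht : 0 < t) : ∫ x, gauss t x = 1 := by
  have h : ∀ x, gauss t x = (√(4 * Real.pi * t))⁻¹ * Real.exp (-(4 * t)⁻¹ * x ^ 2) := fun x => by
    simp only [gauss]
    ring_nf
  simp_rw [h]
  rw [integral_const_mul, integral_gaussian]
  have : Real.pi / (4 * t)⁻¹ = 4 * Real.pi * t := by field_simp
  rw [this]
  exact inv_mul_cancel₀ (Real.sqrt_pos.2 (by positivity)).ne'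

lemma integral_cexp_gauss {t : ℝ} (ht : 0 < t) (ξ : ℝ) :
    ∫ x : ℝ, Complex.exp (ξ * x * Complex.I) * (gauss t x : ℂ) = (Real.exp (-(t * ξ ^ 2)) : ℂ) := by
  have hb : 0 < (((4 * t)⁻¹ : ℝ) : ℂ).re := by rw [Complex.ofReal_re]; positivity
  have h := fourierIntegral_gaussian hb ξ
  have h2 : ((Real.pi : ℂ) / ((4 * t)⁻¹ : ℝ)) ^ (1 / 2 : ℂ) = (√(4 * Real.pi * t) : ℝ) := by
    rw [Real.sqrt_eq_rpow, Complex.ofReal_cpow (by positivity)]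
    push_cast
    congr 1
    field_simp
  have h3 : -(ξ : ℂ) ^ 2 / (4 * ((4 * t)⁻¹ : ℝ)) = ((-(t * ξ ^ 2) : ℝ) : ℂ) := by
    have : (t : ℂ) ≠ 0 := by exact_mod_cast ht.ne'
    push_cast
    field_simp
  have h4 : ∀ x : ℝ, Complex.exp (ξ * x * Complex.I) * (gauss t x : ℂ) =
      ((√(4 * Real.pi * t))⁻¹ : ℝ) * (Complex.exp (Complex.I * ξ * x) *
        Complex.exp (-((4 * t)⁻¹ : ℝ) * (x : ℂ) ^ 2)) := by
    intro x
    rw [gauss]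
    push_cast
    ring_nf
  simp_rw [h4]
  rw [integral_const_mul, h, h2, h3, ← Complex.ofReal_exp, ← mul_assoc, ← Complex.ofReal_mul,
    inv_mul_cancel₀ (Real.sqrt_pos.2 (by positivity)).ne', Complex.ofReal_one, one_mul]

lemma integral_cos_gaussian {t : ℝ} (ht : 0 < t) (x : ℝ) :
    ∫ ξ : ℝ, Real.cos (x * ξ) * Real.exp (-(t * ξ ^ 2)) = 2 * Real.pi * gauss t x := by
  have hb : 0 < (t : ℂ).re := by simpa using ht
  have h := fourierIntegral_gaussian hb x
  have h2 : ((Real.pi : ℂ) / t) ^ (1 / 2 : ℂ) = (√(Real.pi / t) : ℝ) := by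
    rw [Real.sqrt_eq_rpow, Complex.ofReal_cpow (by positivity)]
    push_cast
    rfl
  have h3 : -(x : ℂ) ^ 2 / (4 * t) = ((-x ^ 2 / (4 * t) : ℝ) : ℂ) := by push_cast; rfl
  rw [h2, h3, ← Complex.ofReal_exp, ← Complex.ofReal_mul] at h
  have hint : Integrable fun ξ : ℝ => Complex.exp (Complex.I * x * ξ) *
      Complex.exp (-(t : ℂ) * (ξ : ℂ) ^ 2) := by
    refine (integrable_exp_neg_mul_sq ht).mono' (by fun_prop) (Eventually.of_forall fun ξ => ?_)
    rw [norm_mul, Complex.norm_exp, Complex.norm_exp]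
    apply le_of_eq
    have : (-(t : ℂ) * (ξ : ℂ) ^ 2).re = -t * ξ ^ 2 := by
      rw [← Complex.ofReal_pow, ← Complex.ofReal_neg, ← Complex.ofReal_mul, Complex.ofReal_re]
    rw [this]
    simp
  have h5 := congrArg Complex.re h
  rw [Complex.ofReal_re, ← Complex.reCLM_apply, ← ContinuousLinearMap.integral_comp_comm _ hint] at h5
  have h6 : ∀ ξ : ℝ, Complex.reCLM (Complex.exp (Complex.I * x * ξ) *
      Complex.exp (-(t : ℂ) * (ξ : ℂ) ^ 2)) = Real.cos (x * ξ) * Real.exp (-(t * ξ ^ 2)) := by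
    intro ξ
    have e1 : Complex.exp (-(t : ℂ) * (ξ : ℂ) ^ 2) = ((Real.exp (-(t * ξ ^ 2)) : ℝ) : ℂ) := by
      push_cast; ring_nf
    have e2 : Complex.I * x * ξ = ((x * ξ : ℝ) : ℂ) * Complex.I := by push_cast; ring
    rw [e1, e2, Complex.reCLM_apply, Complex.re_mul_ofReal, Complex.exp_ofReal_mul_I_re]
  simp_rw [h6] at h5
  rw [h5, gauss, ← mul_assoc]
  congr 1
  rw [Real.sqrt_div Real.pi_pos.le, show 4 * Real.pi * t = 2 ^ 2 * Real.pi * t by ring,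
    Real.sqrt_mul (by positivity), Real.sqrt_mul (by positivity), Real.sqrt_sq (by norm_num)]
  have h7 : √Real.pi ^ 2 = Real.pi := Real.sq_sqrt Real.pi_pos.le
  have h8 : 0 < √Real.pi := Real.sqrt_pos.2 Real.pi_pos
  have h9 : 0 < √t := Real.sqrt_pos.2 ht
  nth_rewrite 2 [← h7]
  field_simp

end

/-! ### The kernel as a positive density, and the convolution semigroup `kap` -/

section

/-- The mixture of heat kernels that represents `kernel s` away from the origin. -/
def dens (s x : ℝ) : ℝ := ∫ t, gauss t x ∂mixing s

lemma measurable_gauss_left (x : ℝ) : Measurable fun t => gauss t x :=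
  measurable_gauss.comp (measurable_id.prodMk measurable_const)

lemma integrable_gauss_left {s x : ℝ} (hs : 0 < s) (hx : x ≠ 0) :
    Integrable (fun t => gauss t x) (mixing s) := by
  refine Integrable.of_bound (measurable_gauss_left x).aestronglyMeasurable |x|⁻¹ ?_
  filter_upwards [mixing_ae_pos hs] with t ht
  rw [Real.norm_of_nonneg (gauss_nonneg t x)]
  exact gauss_le ht hx

lemma dens_nonneg (s x : ℝ) : 0 ≤ dens s x := integral_nonneg fun t => gauss_nonneg t x

lemma dens_neg (s x : ℝ) : dens s (-x) = dens s x := by simp [dens, gauss_neg]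

lemma dens_anti {s x y : ℝ} (hs : 0 < s) (hx : x ≠ 0) (hxy : |x| ≤ |y|) :
    dens s y ≤ dens s x := by
  have hy : y ≠ 0 := by
    rintro rfl
    rw [abs_zero] at hxy
    exact hx (abs_eq_zero.1 (le_antisymm hxy (abs_nonneg x)))
  refine integral_mono_ae (integrable_gauss_left hs hy) (integrable_gauss_left hs hx) ?_
  filter_upwards [mixing_ae_pos hs] with t ht
  exact gauss_anti ht hxy

lemma dens_pos {s x : ℝ} (hs : 0 < s) (hx : x ≠ 0) : 0 < dens s x := by
  rw [dens, integral_pos_iff_support_of_nonneg (fun t => gauss_nonneg t x)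
    (integrable_gauss_left hs hx)]
  have h : ∀ᵐ t ∂mixing s, t ∈ Function.support fun t => gauss t x := by
    filter_upwards [mixing_ae_pos hs] with t ht
    exact (gauss_pos ht x).ne'
  rw [measure_eq_univ_of_ae h]
  simp
where
  measure_eq_univ_of_ae {μ : Measure ℝ} {A : Set ℝ} (h : ∀ᵐ t ∂μ, t ∈ A) : μ A = μ univ :=
    measure_congr (by filter_upwards [h] with t ht; exact propext ⟨fun _ => trivial, fun _ => ht⟩)

lemma measurable_dens (s : ℝ) : Measurable (dens s) := by
  have : StronglyMeasurable (Function.uncurry fun x t => gauss t x) :=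
    (measurable_gauss.comp measurable_swap).stronglyMeasurable
  exact this.integral_prod_right.measurable

lemma integrable_gauss_prod {s : ℝ} (hs : 0 < s) :
    Integrable (Function.uncurry gauss) ((mixing s).prod volume) := by
  rw [integrable_prod_iff measurable_gauss.aestronglyMeasurable]
  constructor
  · filter_upwards [mixing_ae_pos hs] with t ht
    exact integrable_gauss ht
  · refine (integrable_const (1 : ℝ)).congr ?_
    filter_upwards [mixing_ae_pos hs] with t ht
    simp_rw [Function.uncurry_apply_pair, Real.norm_of_nonneg (gauss_nonneg t _)]
    exact (integral_gauss ht).symm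

lemma integrable_dens {s : ℝ} (hs : 0 < s) : Integrable (dens s) :=
  (integrable_gauss_prod hs).integral_prod_right

lemma integral_cexp_dens {s : ℝ} (hs : 0 < s) (ξ : ℝ) :
    ∫ x : ℝ, Complex.exp (ξ * x * Complex.I) * (dens s x : ℂ) = symbol s ξ := by
  have h1 : ∀ x : ℝ, Complex.exp (ξ * x * Complex.I) * (dens s x : ℂ) =
      ∫ t, Complex.exp (ξ * x * Complex.I) * (gauss t x : ℂ) ∂mixing s := fun x => by
    rw [integral_const_mul, dens, integral_complex_ofReal]
  have hint : Integrable (Function.uncurry fun t x : ℝ =>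
      Complex.exp (ξ * x * Complex.I) * (gauss t x : ℂ)) ((mixing s).prod volume) := by
    refine (integrable_gauss_prod hs).norm.mono' ?_ (Eventually.of_forall fun p => ?_)
    · have hg : Measurable fun p : ℝ × ℝ => (gauss p.1 p.2 : ℂ) :=
        Complex.measurable_ofReal.comp measurable_gauss
      have he : Measurable fun p : ℝ × ℝ => Complex.exp (ξ * p.2 * Complex.I) := by fun_prop
      exact (he.mul hg).aestronglyMeasurable
    · apply le_of_eq
      have : (ξ : ℂ) * p.2 * Complex.I = ((ξ * p.2 : ℝ) : ℂ) * Complex.I := by push_cast; ring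
      simp only [Function.uncurry]
      rw [norm_mul, this, Complex.norm_exp_ofReal_mul_I, one_mul, Complex.norm_real]
  simp_rw [h1]
  rw [← integral_integral_swap hint, ← integral_mixing hs, ← integral_complex_ofReal]
  refine integral_congr_ae ?_
  filter_upwards [mixing_ae_pos hs] with t ht
  exact integral_cexp_gauss ht ξ

lemma symbol_zero (s : ℝ) : symbol s 0 = 1 := by simp [symbol]

lemma integral_dens {s : ℝ} (hs : 0 < s) : ∫ x, dens s x = 1 := by
  have h := integral_cexp_dens hs 0
  simp only [Complex.ofReal_zero, zero_mul, Complex.exp_zero, one_mul, symbol_zero] at h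
  rw [integral_complex_ofReal] at h
  exact_mod_cast h

/-- Regularised inversion of the symbol. -/
lemma integral_symbol_cos {s ε : ℝ} (hs : 0 < s) (hε : 0 < ε) (x : ℝ) :
    ∫ ξ : ℝ, symbol s ξ * Real.cos (x * ξ) * Real.exp (-ε * ξ ^ 2) =
      2 * Real.pi * ∫ t, gauss (t + ε) x ∂mixing s := by
  have h1 : ∀ ξ : ℝ, symbol s ξ * Real.cos (x * ξ) * Real.exp (-ε * ξ ^ 2) =
      ∫ t, Real.exp (-(max t 0 * ξ ^ 2)) * (Real.cos (x * ξ) * Real.exp (-ε * ξ ^ 2)) ∂mixing s := by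
    intro ξ
    rw [integral_mul_const, ← integral_mixing_max hs]
    simp_rw [mul_comm (ξ ^ 2), mul_assoc]
  have hint : Integrable (Function.uncurry fun ξ t : ℝ =>
      Real.exp (-(max t 0 * ξ ^ 2)) * (Real.cos (x * ξ) * Real.exp (-ε * ξ ^ 2)))
      (volume.prod (mixing s)) := by
    refine ((integrable_exp_neg_mul_sq hε).comp_fst (mixing s)).mono' ?_
      (Eventually.of_forall fun p => ?_)
    · unfold Function.uncurry
      fun_prop
    · simp only [Function.uncurry, norm_mul, Real.norm_eq_abs, Real.abs_exp]
      have e1 : Real.exp (-(max p.2 0 * p.1 ^ 2)) ≤ 1 := by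
        rw [Real.exp_le_one_iff]
        have : 0 ≤ max p.2 0 * p.1 ^ 2 := by positivity
        linarith
      calc _ ≤ 1 * (1 * Real.exp (-ε * p.1 ^ 2)) := by
            gcongr
            exact Real.abs_cos_le_one _
        _ = _ := by ring
  simp_rw [h1]
  rw [integral_integral_swap hint, ← integral_const_mul]
  refine integral_congr_ae ?_
  filter_upwards [mixing_ae_pos hs] with t ht
  rw [← integral_cos_gaussian (by linarith : 0 < t + ε)]
  refine integral_congr_ae (Eventually.of_forall fun ξ => ?_)
  simp only [max_eq_left ht.le]
  rw [← mul_assoc, mul_comm (Real.exp _), mul_assoc, ← Real.exp_add]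
  ring_nf

/-- The factor `exp(-εξ²)` only shifts the time of each heat kernel from `t` to `t + ε`, so the
limit follows by domination with `gauss_le`. -/
theorem kernel_eq_dens {s x : ℝ} (hs : 0 < s) (hx : x ≠ 0) : kernel s x = dens s x := by
  refine Tendsto.limUnder_eq ?_
  have h1 : Tendsto (fun ε : ℝ => ∫ t, gauss (t + ε) x ∂mixing s) (𝓝[>] 0) (𝓝 (dens s x)) := by
    refine tendsto_integral_filter_of_dominated_convergence (fun _ => |x|⁻¹) ?_ ?_
      (integrable_const _) ?_
    · exact Eventually.of_forall fun ε =>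
        ((measurable_gauss_left x).comp (measurable_add_const ε)).aestronglyMeasurable
    · filter_upwards [self_mem_nhdsWithin] with ε hε
      filter_upwards [mixing_ae_pos hs] with t ht
      rw [Real.norm_of_nonneg (gauss_nonneg _ x)]
      exact gauss_le (add_pos ht hε) hx
    · filter_upwards [mixing_ae_pos hs] with t ht
      have hc : ContinuousAt (fun ε : ℝ => gauss (t + ε) x) 0 := by
        unfold gauss
        have h2 : √(4 * Real.pi * (t + 0)) ≠ 0 := (Real.sqrt_pos.2 (by positivity)).ne'
        have h3 : 4 * (t + 0) ≠ 0 := by positivity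
        fun_prop (disch := assumption)
      have := hc.tendsto
      simp only [add_zero] at this
      exact this.mono_left nhdsWithin_le_nhds
  refine h1.congr' ?_
  filter_upwards [self_mem_nhdsWithin] with ε hε
  rw [integral_symbol_cos hs hε, ← mul_assoc, inv_mul_cancel₀ (by positivity), one_mul]

/-- The probability measure with density `kernel s`. -/
def kap (s : ℝ) : Measure ℝ := volume.withDensity fun x => ENNReal.ofReal (dens s x)

lemma integral_kap (s : ℝ) {E : Type*} [NormedAddCommGroup E] [NormedSpace ℝ E] (g : ℝ → E) :
    ∫ x, g x ∂kap s = ∫ x, dens s x • g x := by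
  rw [kap, integral_withDensity_eq_integral_toReal_smul (measurable_dens s).ennreal_ofReal
    (Eventually.of_forall fun _ => ENNReal.ofReal_lt_top)]
  simp_rw [ENNReal.toReal_ofReal (dens_nonneg s _)]

lemma lintegral_kap (s : ℝ) (g : ℝ → ENNReal) :
    ∫⁻ x, g x ∂kap s = ∫⁻ x, ENNReal.ofReal (dens s x) * g x := by
  rw [kap, lintegral_withDensity_eq_lintegral_mul_non_measurable _
    (measurable_dens s).ennreal_ofReal (Eventually.of_forall fun _ => ENNReal.ofReal_lt_top)]
  rfl

lemma isProbabilityMeasure_kap {s : ℝ} (hs : 0 < s) : IsProbabilityMeasure (kap s) := ⟨by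
  rw [kap, withDensity_apply _ MeasurableSet.univ, Measure.restrict_univ,
    ← ofReal_integral_eq_lintegral_ofReal (integrable_dens hs)
      (Eventually.of_forall (dens_nonneg s)), integral_dens hs, ENNReal.ofReal_one]⟩

lemma kap_absolutelyContinuous (s : ℝ) : kap s ≪ volume := withDensity_absolutelyContinuous _ _

lemma charFun_kap {s : ℝ} (hs : 0 < s) (ξ : ℝ) : charFun (kap s) ξ = symbol s ξ := by
  rw [charFun_apply_real, integral_kap, ← integral_cexp_dens hs]
  refine integral_congr_ae (Eventually.of_forall fun x => ?_)
  simp only [Complex.real_smul]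
  ring

lemma symbol_mul {a b : ℝ} (ξ : ℝ) : symbol a ξ * symbol b ξ = symbol (a + b) ξ := by
  unfold symbol
  split_ifs with h
  · simp
  · rw [Real.rpow_add (tanh_div_self_pos h)]

/-- Symbols multiply, and characteristic functions determine measures. Used with `1/4 + 1/4` for the
functional and with `1/2 + 1/2` for the pointwise bound. -/
lemma kap_conv_kap {a b : ℝ} (ha : 0 < a) (hb : 0 < b) :
    (kap a).conv (kap b) = kap (a + b) := by
  have := isProbabilityMeasure_kap ha
  have := isProbabilityMeasure_kap hb
  have := isProbabilityMeasure_kap (add_pos ha hb)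
  refine Measure.ext_of_charFun ?_
  ext ξ
  rw [charFun_conv, charFun_kap ha, charFun_kap hb, charFun_kap (add_pos ha hb), ← symbol_mul,
    Complex.ofReal_mul]

lemma kap_neg (s : ℝ) : (kap s).map (fun x => -x) = kap s := by
  have hm : Measurable fun x : ℝ => -x := measurable_neg
  ext A hA
  rw [Measure.map_apply hm hA, kap, withDensity_apply _ (hm hA), withDensity_apply _ hA,
    ← lintegral_indicator (hm hA), ← lintegral_indicator hA,
    ← lintegral_neg_eq_self (fun x => A.indicator (fun x => ENNReal.ofReal (dens s x)) x)]
  refine lintegral_congr fun x => ?_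
  by_cases h : -x ∈ A
  · rw [indicator_of_mem h, indicator_of_mem (show x ∈ (fun x => -x) ⁻¹' A from h), dens_neg]
  · rw [indicator_of_notMem h, indicator_of_notMem (show x ∉ (fun x => -x) ⁻¹' A from h)]

lemma measurePreserving_neg_kap (s : ℝ) : MeasurePreserving (fun x : ℝ => -x) (kap s) (kap s) :=
  ⟨measurable_neg, kap_neg s⟩

theorem conv_eq {s : ℝ} (hs : 0 < s) (f : ℝ → ℝ) (x : ℝ) :
    conv s f x = ∫ t, f (x - t) ∂kap s := by
  rw [conv, convolution_def, integral_kap]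
  refine integral_congr_ae ?_
  have : ∀ᵐ t : ℝ, t ≠ 0 := by simp [ae_iff]
  filter_upwards [this] with t ht
  simp [kernel_eq_dens hs ht]

end

/-! ### First moment of `kap` and the `L²` norm of `K_1` -/

section

lemma symbol_le_one {s : ℝ} (hs : 0 < s) (ξ : ℝ) : symbol s ξ ≤ 1 := by
  rw [← integral_mixing_max hs]
  have h := integral_mono_of_nonneg (μ := mixing s)
    (f := fun t => Real.exp (-(ξ ^ 2 * max t 0))) (g := fun _ => (1 : ℝ))
    (Eventually.of_forall fun t => (Real.exp_pos _).le) (integrable_const _)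
    (Eventually.of_forall fun t => by
      simp only [Real.exp_le_one_iff]
      have : 0 ≤ ξ ^ 2 * max t 0 := by positivity
      linarith)
  simpa using h

/-- Since `tanh ξ / ξ ≤ 1`, the worst exponent is `s = 1`, where `cothPartial_le` gives the lower
bound `1 / (1 + ξ²)` for the symbol. -/
lemma one_sub_symbol_le {s : ℝ} (hs1 : s ≤ 1) (ξ : ℝ) : 1 - symbol s ξ ≤ ξ ^ 2 := by
  have h1 : symbol 1 ξ ≤ symbol s ξ := by
    by_cases hξ : ξ = 0
    · simp [symbol, hξ]
    · have h2 := symbol_le_one one_pos ξ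
      rw [symbol, if_neg hξ, Real.rpow_one] at h2 ⊢
      rw [symbol, if_neg hξ]
      calc Real.tanh ξ / ξ = (Real.tanh ξ / ξ) ^ (1 : ℝ) := (Real.rpow_one _).symm
        _ ≤ _ := Real.rpow_le_rpow_of_exponent_ge (tanh_div_self_pos hξ) h2 hs1
  have h3 : (1 + ξ ^ 2) ^ (-1 : ℝ) ≤ symbol 1 ξ := by
    refine ge_of_tendsto (tendsto_cothPartial_rpow 1 ξ) (Eventually.of_forall fun N => ?_)
    exact Real.rpow_le_rpow_of_nonpos (zero_lt_one.trans_le (one_le_cothPartial N (sq_nonneg ξ)))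
        (cothPartial_le N (sq_nonneg ξ)) (by norm_num)
  rw [Real.rpow_neg_one] at h3
  have h4 : 1 - ξ ^ 2 ≤ (1 + ξ ^ 2)⁻¹ := by
    rw [← one_div, le_div_iff₀ (by positivity)]
    nlinarith [sq_nonneg (ξ ^ 2)]
  linarith

lemma integral_one_sub_cos_kap {s : ℝ} (hs : 0 < s) (ξ : ℝ) :
    ∫ u, (1 - Real.cos (ξ * u)) ∂kap s = 1 - symbol s ξ := by
  have := isProbabilityMeasure_kap hs
  have hc : Integrable (fun u => Real.cos (ξ * u)) (kap s) :=
    Integrable.of_bound (by fun_prop) 1 (Eventually.of_forall fun u => Real.abs_cos_le_one _)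
  have h1 : Integrable (fun u : ℝ => Complex.exp (ξ * u * Complex.I)) (kap s) := by
    refine Integrable.of_bound (by fun_prop) 1 (Eventually.of_forall fun u => ?_)
    have : (ξ : ℂ) * u * Complex.I = ((ξ * u : ℝ) : ℂ) * Complex.I := by push_cast; ring
    rw [this, Complex.norm_exp_ofReal_mul_I]
  have h := charFun_kap hs ξ
  rw [charFun_apply_real] at h
  have h2 := congrArg Complex.re h
  rw [Complex.ofReal_re, ← Complex.reCLM_apply, ← ContinuousLinearMap.integral_comp_comm _ h1] at h2
  have h3 : ∀ u : ℝ, Complex.reCLM (Complex.exp (ξ * u * Complex.I)) = Real.cos (ξ * u) := by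
    intro u
    have : (ξ : ℂ) * u * Complex.I = ((ξ * u : ℝ) : ℂ) * Complex.I := by push_cast; ring
    rw [this, Complex.reCLM_apply, Complex.exp_ofReal_mul_I_re]
  simp_rw [h3] at h2
  rw [integral_sub (integrable_const _) hc, h2]
  simp

/-- Even the second moment is finite: `n² (1 - cos(u/n))` has mean `n² (1 - symbol s (1/n)) ≤ 1`,
and Fatou's lemma applies because `1 - cos y ≥ 2y²/π²` for `|y| ≤ π`. -/
lemma integrable_abs_kap {s : ℝ} (hs : 0 < s) (hs1 : s ≤ 1) : Integrable (fun u => |u|) (kap s) := by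
  have := isProbabilityMeasure_kap hs
  have hn : ∀ n : ℕ, ∫⁻ u, ENNReal.ofReal ((n + 1) ^ 2 * (1 - Real.cos ((n + 1 : ℝ)⁻¹ * u))) ∂kap s
      ≤ 1 := by
    intro n
    rw [← ofReal_integral_eq_lintegral_ofReal, integral_const_mul, integral_one_sub_cos_kap hs,
      ← ENNReal.ofReal_one]
    · apply ENNReal.ofReal_le_ofReal
      have h := one_sub_symbol_le hs1 (n + 1 : ℝ)⁻¹
      calc _ ≤ ((n : ℝ) + 1) ^ 2 * ((n + 1 : ℝ)⁻¹) ^ 2 := by gcongr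
        _ = 1 := by field_simp
    · refine Integrable.const_mul ?_ _
      refine Integrable.of_bound (by fun_prop) 2 (Eventually.of_forall fun u => ?_)
      rw [Real.norm_of_nonneg (by linarith [Real.cos_le_one ((n + 1 : ℝ)⁻¹ * u)])]
      linarith [Real.neg_one_le_cos ((n + 1 : ℝ)⁻¹ * u)]
    · refine Eventually.of_forall fun u => ?_
      have := Real.cos_le_one ((n + 1 : ℝ)⁻¹ * u)
      exact mul_nonneg (by positivity) (by linarith)
  have hsq : ∫⁻ u, ENNReal.ofReal (2 / Real.pi ^ 2 * u ^ 2) ∂kap s ≤ 1 := by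
    refine le_trans (lintegral_mono fun u => ?_) ((lintegral_liminf_le (u := atTop)
      (f := fun (n : ℕ) u => ENNReal.ofReal ((n + 1) ^ 2 * (1 - Real.cos ((n + 1 : ℝ)⁻¹ * u))))
      (fun n => by fun_prop)).trans ?_)
    · refine le_liminf_of_le (by isBoundedDefault) ?_
      obtain ⟨N, hN⟩ := exists_nat_gt |u|
      filter_upwards [eventually_ge_atTop N] with n hnN
      apply ENNReal.ofReal_le_ofReal
      have hn1 : (N : ℝ) ≤ n := by exact_mod_cast hnN
      have h1 : |(n + 1 : ℝ)⁻¹ * u| ≤ Real.pi := by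
        rw [abs_mul, abs_of_pos (by positivity), inv_mul_le_iff₀ (by positivity)]
        nlinarith [Real.pi_gt_three]
      have h2 := Real.cos_le_one_sub_mul_cos_sq h1
      have h3 : ((n : ℝ) + 1) ^ 2 * (2 / Real.pi ^ 2 * ((n + 1 : ℝ)⁻¹ * u) ^ 2) =
          2 / Real.pi ^ 2 * u ^ 2 := by field_simp
      rw [← h3]
      gcongr
      linarith
    · refine liminf_le_of_le (by isBoundedDefault) fun b hb => ?_
      obtain ⟨n, h⟩ := hb.exists
      exact h.trans (hn n)
  have hfin : Integrable (fun u => 1 + Real.pi ^ 2 / 2 * (2 / Real.pi ^ 2 * u ^ 2)) (kap s) := by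
    refine (integrable_const _).add (Integrable.const_mul ⟨by fun_prop, ?_⟩ _)
    rw [hasFiniteIntegral_iff_ofReal (Eventually.of_forall fun u => by positivity)]
    exact hsq.trans_lt ENNReal.one_lt_top
  refine hfin.mono' (by fun_prop) (Eventually.of_forall fun u => ?_)
  have : Real.pi ^ 2 / 2 * (2 / Real.pi ^ 2 * u ^ 2) = u ^ 2 := by field_simp
  rw [this, Real.norm_eq_abs, abs_abs, ← sq_abs]
  nlinarith [sq_nonneg (|u| - 1)]

lemma kap_Ioi_pos {s : ℝ} (hs : 0 < s) (r : ℝ) (hr : 0 ≤ r) : 0 < kap s (Ioi r) := by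
  rw [kap, withDensity_apply _ measurableSet_Ioi, setLIntegral_pos_iff
    (measurable_dens s).ennreal_ofReal]
  have : Ioi r ⊆ Function.support (fun x => ENNReal.ofReal (dens s x)) ∩ Ioi r := fun x hx =>
    ⟨(ENNReal.ofReal_pos.2 (dens_pos hs (hr.trans_lt hx).ne')).ne', hx⟩
  exact (by simp : (0 : ENNReal) < volume (Ioi r)).trans_le (measure_mono this)

lemma integral_gauss_mul {t t' : ℝ} (ht : 0 < t) (ht' : 0 < t') :
    ∫ x, gauss t x * gauss t' x = (2 * Real.pi)⁻¹ * ∫ ξ : ℝ, Real.exp (-((t + t') * ξ ^ 2)) := by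
  have h : ∀ x, gauss t x * gauss t' x = (√(4 * Real.pi * t))⁻¹ * (√(4 * Real.pi * t'))⁻¹ *
      Real.exp (-((t + t') / (4 * t * t')) * x ^ 2) := fun x => by
    have : -((t + t') / (4 * t * t')) * x ^ 2 = -x ^ 2 / (4 * t) + -x ^ 2 / (4 * t') := by
      field_simp; ring
    rw [this, Real.exp_add, gauss, gauss]
    ring
  simp_rw [h, ← neg_mul]
  rw [integral_const_mul, integral_gaussian, integral_gaussian]
  have hpi := Real.pi_pos
  have e1 : √(4 * Real.pi * t) = 2 * √Real.pi * √t := by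
    rw [show 4 * Real.pi * t = 2 ^ 2 * Real.pi * t by ring,
      Real.sqrt_mul (by positivity), Real.sqrt_mul (by positivity), Real.sqrt_sq (by norm_num)]
  have e2 : √(4 * Real.pi * t') = 2 * √Real.pi * √t' := by
    rw [show 4 * Real.pi * t' = 2 ^ 2 * Real.pi * t' by ring,
      Real.sqrt_mul (by positivity), Real.sqrt_mul (by positivity), Real.sqrt_sq (by norm_num)]
  have e3 : √(Real.pi / ((t + t') / (4 * t * t'))) = 2 * √Real.pi * √t * √t' / √(t + t') := by
    rw [show Real.pi / ((t + t') / (4 * t * t')) = 2 ^ 2 * Real.pi * t * t' / (t + t') by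
      field_simp; ring, Real.sqrt_div (by positivity), Real.sqrt_mul (by positivity),
      Real.sqrt_mul (by positivity), Real.sqrt_mul (by positivity), Real.sqrt_sq (by norm_num)]
  have h7 : √Real.pi ^ 2 = Real.pi := Real.sq_sqrt hpi.le
  have h8 : 0 < √Real.pi := Real.sqrt_pos.2 hpi
  have h9 : 0 < √t := Real.sqrt_pos.2 ht
  have h10 : 0 < √t' := Real.sqrt_pos.2 ht'
  have h11 : 0 < √(t + t') := Real.sqrt_pos.2 (by linarith)
  rw [e1, e2, e3, Real.sqrt_div hpi.le]
  nth_rewrite 4 [← h7]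
  field_simp

/-- From `symbol 1 ξ ≤ min 1 (1 / |ξ|)`: the interval `[-1, 1]` contributes `2` and each tail `1`.
-/
lemma lintegral_symbol_sq_le : ∫⁻ ξ, ENNReal.ofReal (symbol 1 ξ) ^ 2 ≤ 4 := by
  have hI : ∫⁻ ξ in Ioi (1 : ℝ), ENNReal.ofReal (ξ ^ (-2 : ℝ)) = 1 := by
    rw [← ofReal_integral_eq_lintegral_ofReal
      (integrableOn_Ioi_rpow_of_lt (by norm_num) one_pos) ?_,
      integral_Ioi_rpow_of_lt (by norm_num) one_pos]
    · norm_num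
    · filter_upwards [ae_restrict_mem measurableSet_Ioi] with ξ hξ
      exact Real.rpow_nonneg (zero_lt_one.trans hξ).le _
  have hle : ∀ ξ : ℝ, ENNReal.ofReal (symbol 1 ξ) ^ 2 ≤ (Icc (-1 : ℝ) 1).indicator 1 ξ +
      ((Ioi (1 : ℝ)).indicator (fun ξ => ENNReal.ofReal (ξ ^ (-2 : ℝ))) ξ +
        (Ioi (1 : ℝ)).indicator (fun ξ => ENNReal.ofReal (ξ ^ (-2 : ℝ))) (-ξ)) := by
    have key : ∀ ξ : ℝ, 1 < ξ → ENNReal.ofReal (symbol 1 ξ) ^ 2 ≤ ENNReal.ofReal (ξ ^ (-2 : ℝ)) := by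
      intro ξ hξ
      have h0 : 0 < ξ := by linarith
      rw [← ENNReal.ofReal_pow (symbol_nonneg _ _)]
      apply ENNReal.ofReal_le_ofReal
      have := symbol_le_rpow one_pos h0
      rw [Real.rpow_one] at this
      calc symbol 1 ξ ^ 2 ≤ (1 / ξ) ^ 2 := pow_le_pow_left₀ (symbol_nonneg _ _) this 2
        _ = _ := by
          rw [show (-2 : ℝ) = -((2 : ℕ) : ℝ) by norm_num, Real.rpow_neg h0.le, Real.rpow_natCast]
          simp
    intro ξ
    rcases le_or_gt ξ 1 with h1 | h1
    · rcases le_or_gt (-1) ξ with h2 | h2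
      · refine le_add_right ?_
        rw [indicator_of_mem (show ξ ∈ Icc (-1 : ℝ) 1 from ⟨h2, h1⟩), Pi.one_apply]
        apply pow_le_one₀ (by positivity)
        exact ENNReal.ofReal_le_one.2 (symbol_le_one one_pos ξ)
      · refine le_add_left (le_add_left ?_)
        rw [indicator_of_mem (show -ξ ∈ Ioi (1 : ℝ) from by simp; linarith), ← symbol_neg]
        exact key _ (by linarith)
    · refine le_add_left (le_add_right ?_)
      rw [indicator_of_mem (show ξ ∈ Ioi (1 : ℝ) from h1)]
      exact key _ h1
  have hm : Measurable ((Ioi (1 : ℝ)).indicator fun ξ : ℝ => ENNReal.ofReal (ξ ^ (-2 : ℝ))) :=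
    Measurable.indicator (by fun_prop) measurableSet_Ioi
  calc _ ≤ _ := lintegral_mono hle
    _ = 2 + (1 + 1) := by
      rw [lintegral_add_left (measurable_one.indicator measurableSet_Icc), lintegral_add_left hm,
        lintegral_neg_eq_self
          (fun ξ => (Ioi (1 : ℝ)).indicator (fun ξ => ENNReal.ofReal (ξ ^ (-2 : ℝ))) ξ),
        lintegral_indicator measurableSet_Ioi, hI, lintegral_indicator_one measurableSet_Icc,
        Real.volume_Icc]
      norm_num
    _ = 4 := by norm_num

/-- Plancherel's identity, carried out on the mixture: the square is a double integral of products
of two heat kernels, for which both sides are Gaussian integrals. The factor is `4 / (2π)`. -/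
lemma lintegral_dens_sq_le : ∫⁻ x, ENNReal.ofReal (dens 1 x) ^ 2 ≤ ENNReal.ofReal (2 / Real.pi) := by
  have hmg : Measurable (Function.uncurry fun x t : ℝ => ENNReal.ofReal (gauss t x)) :=
    (measurable_gauss.comp measurable_swap).ennreal_ofReal
  have hmg' : ∀ x, Measurable fun t : ℝ => ENNReal.ofReal (gauss t x) := fun x =>
    (measurable_gauss_left x).ennreal_ofReal
  have hpos := mixing_ae_pos one_pos
  have h1 : ∀ᵐ x : ℝ, ENNReal.ofReal (dens 1 x) ^ 2 =
      ∫⁻ p : ℝ × ℝ, ENNReal.ofReal (gauss p.1 x) * ENNReal.ofReal (gauss p.2 x)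
        ∂(mixing 1).prod (mixing 1) := by
    have : ∀ᵐ x : ℝ, x ≠ 0 := by simp [ae_iff]
    filter_upwards [this] with x hx
    rw [lintegral_prod_mul (hmg' x).aemeasurable (hmg' x).aemeasurable, ← pow_two, dens,
      ofReal_integral_eq_lintegral_ofReal (integrable_gauss_left one_pos hx)
        (Eventually.of_forall fun t => gauss_nonneg t x)]
  have hpos2 : ∀ᵐ p : ℝ × ℝ ∂(mixing 1).prod (mixing 1), 0 < p.1 ∧ 0 < p.2 := by
    refine (Measure.ae_prod_iff_ae_ae ?_).2 ?_
    · exact (measurableSet_Ioi.preimage measurable_fst).inter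
        (measurableSet_Ioi.preimage measurable_snd)
    · filter_upwards [hpos] with t ht
      filter_upwards [hpos] with t' ht'
      exact ⟨ht, ht'⟩
  have h2 : ∀ᵐ p : ℝ × ℝ ∂(mixing 1).prod (mixing 1),
      ∫⁻ x, ENNReal.ofReal (gauss p.1 x) * ENNReal.ofReal (gauss p.2 x) =
      ENNReal.ofReal (2 * Real.pi)⁻¹ * ∫⁻ ξ : ℝ, ENNReal.ofReal (Real.exp (-(p.1 * ξ ^ 2))) *
        ENNReal.ofReal (Real.exp (-(p.2 * ξ ^ 2))) := by
    filter_upwards [hpos2] with p hp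
    have e1 : ∀ ξ : ℝ, ENNReal.ofReal (Real.exp (-(p.1 * ξ ^ 2))) *
        ENNReal.ofReal (Real.exp (-(p.2 * ξ ^ 2))) =
        ENNReal.ofReal (Real.exp (-((p.1 + p.2) * ξ ^ 2))) := fun ξ => by
      rw [← ENNReal.ofReal_mul (Real.exp_pos _).le, ← Real.exp_add]
      ring_nf
    simp_rw [e1, ← ENNReal.ofReal_mul (gauss_nonneg p.1 _)]
    rw [← ofReal_integral_eq_lintegral_ofReal, ← ofReal_integral_eq_lintegral_ofReal,
      ← ENNReal.ofReal_mul (by positivity), integral_gauss_mul hp.1 hp.2]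
    · simpa only [neg_mul] using integrable_exp_neg_mul_sq (add_pos hp.1 hp.2)
    · exact Eventually.of_forall fun ξ => (Real.exp_pos _).le
    · refine (integrable_gauss hp.1).mul_bdd (c := (√(4 * Real.pi * p.2))⁻¹)
        (integrable_gauss hp.2).aestronglyMeasurable (Eventually.of_forall fun x => ?_)
      rw [Real.norm_of_nonneg (gauss_nonneg _ _), gauss]
      apply mul_le_of_le_one_right (by positivity)
      rw [Real.exp_le_one_iff]
      have hp2 := hp.2
      rw [neg_div]
      have : 0 ≤ x ^ 2 / (4 * p.2) := by positivity
      linarith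
    · exact Eventually.of_forall fun x => mul_nonneg (gauss_nonneg _ _) (gauss_nonneg _ _)
  have hme : ∀ ξ : ℝ, Measurable fun t : ℝ => ENNReal.ofReal (Real.exp (-(t * ξ ^ 2))) :=
    fun ξ => by fun_prop
  have h3 : ∀ ξ : ℝ, ∫⁻ p : ℝ × ℝ, ENNReal.ofReal (Real.exp (-(p.1 * ξ ^ 2))) *
      ENNReal.ofReal (Real.exp (-(p.2 * ξ ^ 2))) ∂(mixing 1).prod (mixing 1) =
      ENNReal.ofReal (symbol 1 ξ) ^ 2 := by
    intro ξ
    rw [lintegral_prod_mul (hme ξ).aemeasurable (hme ξ).aemeasurable, ← pow_two,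
      ← integral_mixing one_pos, ofReal_integral_eq_lintegral_ofReal]
    · refine Integrable.of_bound (by fun_prop) 1 ?_
      filter_upwards [hpos] with t ht
      rw [Real.norm_of_nonneg (Real.exp_pos _).le, Real.exp_le_one_iff]
      have : 0 ≤ t * ξ ^ 2 := by positivity
      linarith
    · exact Eventually.of_forall fun t => (Real.exp_pos _).le
  rw [lintegral_congr_ae h1, lintegral_lintegral_swap, lintegral_congr_ae h2, lintegral_const_mul,
    lintegral_lintegral_swap, lintegral_congr h3]
  · calc _ ≤ ENNReal.ofReal (2 * Real.pi)⁻¹ * 4 := by gcongr; exact lintegral_symbol_sq_le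
      _ = _ := by
        rw [show (4 : ENNReal) = ENNReal.ofReal 4 by norm_num, ← ENNReal.ofReal_mul (by positivity)]
        congr 1
        have := Real.pi_ne_zero
        field_simp
        norm_num
  · exact Measurable.aemeasurable (by unfold Function.uncurry; fun_prop)
  · exact Measurable.lintegral_prod_right (by unfold Function.uncurry; fun_prop)
  · have m1 : Measurable fun p : ℝ × ℝ × ℝ => ENNReal.ofReal (gauss p.2.1 p.1) :=
      (measurable_gauss.comp ((measurable_fst.comp measurable_snd).prodMk
        measurable_fst)).ennreal_ofReal
    have m2 : Measurable fun p : ℝ × ℝ × ℝ => ENNReal.ofReal (gauss p.2.2 p.1) :=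
      (measurable_gauss.comp ((measurable_snd.comp measurable_snd).prodMk
        measurable_fst)).ennreal_ofReal
    exact (m1.mul m2).aemeasurable

end

/-! ### The correlation form of a symmetric probability measure -/

section

/-- Measurable and square integrable. -/
def SqInt (f : ℝ → ℝ) : Prop := Measurable f ∧ Integrable fun x => f x ^ 2

/-- The squared `L²` norm. -/
def nsq (f : ℝ → ℝ) : ℝ := ∫ x, f x ^ 2

/-- The correlation of two functions. -/
def corr (f g : ℝ → ℝ) (u : ℝ) : ℝ := ∫ x, f x * g (x + u)

/-- The bilinear form `∬ f(x) g(x + u) dx dκ(u)`. -/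
def form (κ : Measure ℝ) (f g : ℝ → ℝ) : ℝ := ∫ u, corr f g u ∂κ

lemma nsq_nonneg (f : ℝ → ℝ) : 0 ≤ nsq f := integral_nonneg fun _ => sq_nonneg _

lemma SqInt.comp_add {f : ℝ → ℝ} (hf : SqInt f) (u : ℝ) : SqInt fun x => f (x + u) :=
  ⟨hf.1.comp (measurable_add_const u), hf.2.comp_add_right u⟩

lemma nsq_comp_add (f : ℝ → ℝ) (u : ℝ) : nsq (fun x => f (x + u)) = nsq f :=
  integral_add_right_eq_self (fun x => f x ^ 2) u

lemma SqInt.integrable_mul {f g : ℝ → ℝ} (hf : SqInt f) (hg : SqInt g) :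
    Integrable fun x => f x * g x := by
  refine (hf.2.add hg.2).mono' (hf.1.mul hg.1).aestronglyMeasurable
    (Eventually.of_forall fun x => ?_)
  simp only [Pi.add_apply, Real.norm_eq_abs]
  rw [abs_le]
  constructor <;> nlinarith [sq_nonneg (f x + g x), sq_nonneg (f x - g x)]

lemma SqInt.add {f g : ℝ → ℝ} (hf : SqInt f) (hg : SqInt g) : SqInt fun x => f x + g x := by
  refine ⟨hf.1.add hg.1, ?_⟩
  refine ((hf.2.add hg.2).add ((hf.integrable_mul hg).const_mul 2)).congr
    (Eventually.of_forall fun x => ?_)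
  simp only [Pi.add_apply]
  ring

lemma SqInt.const_mul {f : ℝ → ℝ} (hf : SqInt f) (c : ℝ) : SqInt fun x => c * f x := by
  refine ⟨hf.1.const_mul c, ?_⟩
  simp_rw [mul_pow]
  exact hf.2.const_mul _

lemma SqInt.abs {f : ℝ → ℝ} (hf : SqInt f) : SqInt fun x => |f x| :=
  ⟨hf.1.abs, by simpa only [sq_abs] using hf.2⟩

lemma SqInt.mono {f g : ℝ → ℝ} (hg : SqInt g) (hf : Measurable f) (h : ∀ x, |f x| ≤ |g x|) :
    SqInt f := by
  refine ⟨hf, hg.2.mono' (hf.pow_const 2).aestronglyMeasurable (Eventually.of_forall fun x => ?_)⟩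
  rw [Real.norm_of_nonneg (sq_nonneg _)]
  exact sq_le_sq.2 (h x)

lemma integral_abs_mul_le {f g : ℝ → ℝ} (hf : SqInt f) (hg : SqInt g) :
    ∫ x, |f x * g x| ≤ (nsq f + nsq g) / 2 := by
  rw [nsq, nsq, ← integral_add hf.2 hg.2, ← integral_div]
  refine integral_mono (hf.integrable_mul hg).abs ((hf.2.add hg.2).div_const 2) fun x => ?_
  simp only
  rw [abs_le]
  constructor <;> nlinarith [sq_nonneg (f x + g x), sq_nonneg (f x - g x)]

variable (κ : Measure ℝ)

lemma form_const_mul_left (c : ℝ) (f g : ℝ → ℝ) :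
    form κ (fun x => c * f x) g = c * form κ f g := by
  simp_rw [form, corr, mul_assoc, integral_const_mul]

lemma form_const_mul_right (c : ℝ) (f g : ℝ → ℝ) :
    form κ f (fun x => c * g x) = c * form κ f g := by
  simp_rw [form, corr, mul_left_comm _ c, integral_const_mul]

lemma corr_neg (f g : ℝ → ℝ) (u : ℝ) : corr f g (-u) = corr g f u := by
  rw [corr, corr, ← integral_add_right_eq_self _ u]
  simp [mul_comm]

lemma form_comm (hκ : MeasurePreserving (fun x : ℝ => -x) κ κ) (f g : ℝ → ℝ) :
    form κ f g = form κ g f := by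
  rw [form, form, ← hκ.integral_comp (MeasurableEquiv.neg ℝ).measurableEmbedding]
  simp_rw [corr_neg]

/-- Averaging over translations. -/
def avg (f : ℝ → ℝ) (x : ℝ) : ℝ := ∫ t, f (x - t) ∂κ

lemma avg_eq_add (hκ : MeasurePreserving (fun x : ℝ => -x) κ κ) (f : ℝ → ℝ) (x : ℝ) :
    avg κ f x = ∫ t, f (x + t) ∂κ := by
  rw [avg, ← hκ.integral_comp (MeasurableEquiv.neg ℝ).measurableEmbedding]
  simp

variable [IsProbabilityMeasure κ]

lemma integrable_form {f g : ℝ → ℝ} (hf : SqInt f) (hg : SqInt g) :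
    Integrable (fun p : ℝ × ℝ => f p.2 * g (p.2 + p.1)) (κ.prod volume) := by
  have hm : Measurable fun p : ℝ × ℝ => f p.2 * g (p.2 + p.1) :=
    (hf.1.comp measurable_snd).mul (hg.1.comp (measurable_snd.add measurable_fst))
  rw [integrable_prod_iff hm.aestronglyMeasurable]
  refine ⟨Eventually.of_forall fun u => hf.integrable_mul (hg.comp_add u), ?_⟩
  refine Integrable.of_bound (hm.stronglyMeasurable.norm.integral_prod_right').aestronglyMeasurable
    ((nsq f + nsq g) / 2) (Eventually.of_forall fun u => ?_)
  rw [Real.norm_of_nonneg (integral_nonneg fun _ => norm_nonneg _), ← nsq_comp_add g u]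
  exact integral_abs_mul_le hf (hg.comp_add u)

lemma integrable_corr {f g : ℝ → ℝ} (hf : SqInt f) (hg : SqInt g) : Integrable (corr f g) κ :=
  (integrable_form κ hf hg).integral_prod_left

lemma form_eq_prod {f g : ℝ → ℝ} (hf : SqInt f) (hg : SqInt g) :
    form κ f g = ∫ p : ℝ × ℝ, f p.2 * g (p.2 + p.1) ∂κ.prod volume :=
  (integral_prod _ (integrable_form κ hf hg)).symm

lemma form_add_left {f g h : ℝ → ℝ} (hf : SqInt f) (hg : SqInt g) (hh : SqInt h) :
    form κ (fun x => f x + g x) h = form κ f h + form κ g h := by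
  rw [form_eq_prod κ (hf.add hg) hh, form_eq_prod κ hf hh, form_eq_prod κ hg hh,
    ← integral_add (integrable_form κ hf hh) (integrable_form κ hg hh)]
  simp_rw [add_mul]

lemma form_add_right (hκ : MeasurePreserving (fun x : ℝ => -x) κ κ) {f g h : ℝ → ℝ}
    (hf : SqInt f) (hg : SqInt g) (hh : SqInt h) :
    form κ h (fun x => f x + g x) = form κ h f + form κ h g := by
  rw [form_comm κ hκ, form_add_left κ hf hg hh, form_comm κ hκ f, form_comm κ hκ g]

lemma form_add_mul_self (hκ : MeasurePreserving (fun x : ℝ => -x) κ κ) {f h : ℝ → ℝ}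
    (hf : SqInt f) (hh : SqInt h) (t : ℝ) :
    form κ (fun x => f x + t * h x) (fun x => f x + t * h x) =
      form κ f f + 2 * t * form κ h f + t ^ 2 * form κ h h := by
  have hth := hh.const_mul t
  rw [form_add_left κ hf hth (hf.add hth), form_add_right κ hκ hf hth hf,
    form_add_right κ hκ hf hth hth]
  simp only [form_const_mul_left, form_const_mul_right]
  rw [form_comm κ hκ f h]
  ring

lemma form_mono {f f' g g' : ℝ → ℝ} (hf : SqInt f) (hf' : SqInt f') (hg : SqInt g) (hg' : SqInt g')
    (h0 : ∀ x, 0 ≤ f x) (h0' : ∀ x, 0 ≤ g x)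
    (h : ∀ x, f x ≤ f' x) (h' : ∀ x, g x ≤ g' x) : form κ f g ≤ form κ f' g' := by
  rw [form_eq_prod κ hf hg, form_eq_prod κ hf' hg']
  exact integral_mono (integrable_form κ hf hg) (integrable_form κ hf' hg') fun p =>
    mul_le_mul (h _) (h' _) (h0' _) ((h0 _).trans (h _))

lemma form_le_form_abs {f : ℝ → ℝ} (hf : SqInt f) :
    form κ f f ≤ form κ (fun x => |f x|) (fun x => |f x|) := by
  rw [form_eq_prod κ hf hf, form_eq_prod κ hf.abs hf.abs]
  refine integral_mono (integrable_form κ hf hf) (integrable_form κ hf.abs hf.abs) fun p => ?_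
  simp only [← abs_mul]
  exact le_abs_self _

/-- As an integral of squares, `nsq - form` is nonnegative and lower semicontinuous under almost
everywhere convergence; the latter drives the compactness argument. -/
lemma integrable_sq_sub {f : ℝ → ℝ} (hf : SqInt f) :
    Integrable (fun p : ℝ × ℝ => (f p.2 - f (p.2 + p.1)) ^ 2) (κ.prod volume) ∧
    ∫ p : ℝ × ℝ, (f p.2 - f (p.2 + p.1)) ^ 2 ∂κ.prod volume = 2 * (nsq f - form κ f f) := by
  have h1 : Integrable (fun p : ℝ × ℝ => f p.2 ^ 2) (κ.prod volume) := hf.2.comp_snd κ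
  have h2 : Integrable (fun p : ℝ × ℝ => f (p.2 + p.1) ^ 2) (κ.prod volume) := by
    have hm : Measurable fun p : ℝ × ℝ => f (p.2 + p.1) ^ 2 :=
      (hf.1.comp (measurable_snd.add measurable_fst)).pow_const 2
    rw [integrable_prod_iff hm.aestronglyMeasurable]
    refine ⟨Eventually.of_forall fun u => (hf.comp_add u).2, ?_⟩
    refine (integrable_const (nsq f)).congr (Eventually.of_forall fun u => ?_)
    simp only [Real.norm_of_nonneg (sq_nonneg _)]
    exact (nsq_comp_add f u).symm
  have h3 := integrable_form κ hf hf
  have e : ∀ p : ℝ × ℝ, (f p.2 - f (p.2 + p.1)) ^ 2 =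
      f p.2 ^ 2 + f (p.2 + p.1) ^ 2 - 2 * (f p.2 * f (p.2 + p.1)) := fun p => by ring
  simp_rw [e]
  have h12 : Integrable (fun p : ℝ × ℝ => f p.2 ^ 2 + f (p.2 + p.1) ^ 2) (κ.prod volume) :=
    h1.add h2
  refine ⟨h12.sub (h3.const_mul 2), ?_⟩
  rw [integral_sub h12 (h3.const_mul 2), integral_add h1 h2, integral_const_mul,
    ← form_eq_prod κ hf hf, integral_prod _ h1, integral_prod _ h2]
  have : ∀ u, ∫ x, f (x + u) ^ 2 = nsq f := fun u => nsq_comp_add f u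
  simp only [this]
  rw [← nsq]
  simp
  ring

lemma form_le_nsq {f : ℝ → ℝ} (hf : SqInt f) : form κ f f ≤ nsq f := by
  have h := (integrable_sq_sub κ hf).2
  have : 0 ≤ ∫ p : ℝ × ℝ, (f p.2 - f (p.2 + p.1)) ^ 2 ∂κ.prod volume :=
    integral_nonneg fun _ => sq_nonneg _
  linarith

lemma form_eq_integral_avg (hκ : MeasurePreserving (fun x : ℝ => -x) κ κ) {f h : ℝ → ℝ}
    (hf : SqInt f) (hh : SqInt h) :
    Integrable (fun x => h x * avg κ f x) ∧ form κ h f = ∫ x, h x * avg κ f x := by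
  have h1 := integrable_form κ hh hf
  have h2 : ∀ x, ∫ u, h x * f (x + u) ∂κ = h x * avg κ f x := fun x => by
    rw [integral_const_mul, avg_eq_add κ hκ]
  constructor
  · have := h1.integral_prod_right
    simpa only [h2] using this
  · rw [form_eq_prod κ hh hf, integral_prod_symm _ h1]
    simp only [h2]

lemma measurable_avg {f : ℝ → ℝ} (hf : Measurable f) : Measurable (avg κ f) := by
  have : StronglyMeasurable (Function.uncurry fun x t : ℝ => f (x - t)) :=
    (hf.comp (measurable_fst.sub measurable_snd)).stronglyMeasurable
  exact this.integral_prod_right.measurable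

/-- The square of the average is a double integral over two shifts. Only their difference matters
after translation, and by symmetry of `κ` it may be replaced by their sum. -/
lemma integral_avg_sq (hκ : MeasurePreserving (fun x : ℝ => -x) κ κ) {f : ℝ → ℝ} (hf : SqInt f) :
    Integrable (fun x => avg κ f x ^ 2) ∧ ∫ x, avg κ f x ^ 2 = form (κ.conv κ) f f := by
  have hm : Measurable fun q : (ℝ × ℝ) × ℝ => f (q.2 - q.1.1) * f (q.2 - q.1.2) := by
    refine (hf.1.comp ?_).mul (hf.1.comp ?_) <;> fun_prop
  have hint : Integrable (fun q : (ℝ × ℝ) × ℝ => f (q.2 - q.1.1) * f (q.2 - q.1.2))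
      ((κ.prod κ).prod volume) := by
    rw [integrable_prod_iff hm.aestronglyMeasurable]
    have hs : ∀ s : ℝ, SqInt fun x => f (x - s) := fun s => by
      simpa only [sub_eq_add_neg] using hf.comp_add (-s)
    refine ⟨Eventually.of_forall fun p => (hs p.1).integrable_mul (hs p.2), ?_⟩
    refine Integrable.of_bound
      (hm.stronglyMeasurable.norm.integral_prod_right').aestronglyMeasurable
      (nsq f) (Eventually.of_forall fun p => ?_)
    rw [Real.norm_of_nonneg (integral_nonneg fun _ => norm_nonneg _)]
    have h1 := integral_abs_mul_le (hs p.1) (hs p.2)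
    have h2 : ∀ s : ℝ, nsq (fun x => f (x - s)) = nsq f := fun s => by
      simpa only [sub_eq_add_neg] using nsq_comp_add f (-s)
    rw [h2, h2] at h1
    simpa using h1
  have e : ∀ x, ∫ p : ℝ × ℝ, f (x - p.1) * f (x - p.2) ∂κ.prod κ = avg κ f x ^ 2 := fun x => by
    rw [integral_prod_mul (fun s => f (x - s)) (fun t => f (x - t)), ← pow_two]
    rfl
  constructor
  · have := hint.integral_prod_right
    simpa only [e] using this
  · have h3 : ∀ p : ℝ × ℝ, ∫ x, f (x - p.1) * f (x - p.2) = corr f f (p.1 - p.2) := fun p => by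
      rw [corr, ← integral_add_right_eq_self _ p.1]
      refine integral_congr_ae (Eventually.of_forall fun x => ?_)
      simp only [add_sub_cancel_right]
      congr 2
      ring
    calc ∫ x, avg κ f x ^ 2 = ∫ x, ∫ p : ℝ × ℝ, f (x - p.1) * f (x - p.2) ∂κ.prod κ := by
          simp only [e]
      _ = ∫ p : ℝ × ℝ, corr f f (p.1 - p.2) ∂κ.prod κ := by
          rw [← integral_prod_symm _ hint, integral_prod _ hint]
          simp only [h3]
      _ = ∫ s, ∫ t, corr f f (s - t) ∂κ ∂κ := by
          rw [integral_prod]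
          have := hint.integral_prod_left
          simpa only [h3] using this
      _ = ∫ s, ∫ t, corr f f (s + t) ∂κ ∂κ := by
          refine integral_congr_ae (Eventually.of_forall fun s => ?_)
          simp only
          rw [← hκ.integral_comp (MeasurableEquiv.neg ℝ).measurableEmbedding]
          simp
      _ = form (κ.conv κ) f f := by
          rw [form, integral_conv (integrable_corr _ hf hf)]

end

/-! ### The Young function and its derivative -/

section

/-- The right derivative of the Young function, extended to an odd function. -/
def dyoung (α t : ℝ) : ℝ :=
  2 * α * t - t * |t| + 4 * (max (t - α) 0) ^ 2 - 4 * (max (-t - α) 0) ^ 2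

variable {α : ℝ}

lemma young_eq (t : ℝ) :
    young α t = α * t ^ 2 - |t| ^ 3 / 3 + 4 / 3 * (max (|t| - α) 0) ^ 3 := by
  rw [young, ← sq_abs t]
  split_ifs with h
  · rw [max_eq_right (by linarith)]; ring
  · rw [max_eq_left (by linarith)]; ring

lemma young_abs (t : ℝ) : young α |t| = young α t := by simp [young]

lemma young_neg (t : ℝ) : young α (-t) = young α t := by simp [young]

lemma young_of_nonneg {t : ℝ} (ht : 0 ≤ t) :
    young α t = α * t ^ 2 - t ^ 3 / 3 + 4 / 3 * (max (t - α) 0) ^ 3 := by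
  rw [young_eq, abs_of_nonneg ht]

lemma dyoung_of_nonneg (hα : 0 < α) {t : ℝ} (ht : 0 ≤ t) :
    dyoung α t = 2 * α * t - t ^ 2 + 4 * (max (t - α) 0) ^ 2 := by
  rw [dyoung, abs_of_nonneg ht, max_eq_right (by linarith : -t - α ≤ 0)]
  ring

lemma dyoung_neg (t : ℝ) : dyoung α (-t) = -dyoung α t := by
  rw [dyoung, dyoung, abs_neg, neg_neg]
  ring

lemma continuous_young : Continuous (young α) := by
  have : young α = fun t => α * t ^ 2 - |t| ^ 3 / 3 + 4 / 3 * (max (|t| - α) 0) ^ 3 :=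
    funext young_eq
  rw [this]
  fun_prop

lemma continuous_dyoung : Continuous (dyoung α) := by
  unfold dyoung
  fun_prop

lemma young_ge_sq (hα : 0 < α) (t : ℝ) : α / 2 * t ^ 2 ≤ young α t := by
  rw [← young_abs, ← sq_abs, young_of_nonneg (abs_nonneg t)]
  have h0 := abs_nonneg t
  rcases le_total |t| α with h | h
  · rw [max_eq_right (by linarith)]
    nlinarith [mul_nonneg (sq_nonneg |t|) (sub_nonneg.2 h), mul_nonneg h0 (sq_nonneg |t|)]
  · rw [max_eq_left (by linarith)]
    obtain ⟨w, hw⟩ : ∃ w, w = |t| - α := ⟨_, rfl⟩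
    have ht : |t| = α + w := by linarith
    have hw0 : 0 ≤ w := by linarith
    rw [ht]
    nlinarith [mul_nonneg hα.le (sq_nonneg (α - 2 * w)), mul_nonneg hw0 (sq_nonneg (α - 2 * w)),
      mul_nonneg hα.le (sq_nonneg w), pow_pos hα 3, mul_nonneg hw0 (sq_nonneg w),
      mul_nonneg hw0 (sq_nonneg α), mul_nonneg hw0 (sq_nonneg (α - w))]

lemma young_nonneg (hα : 0 < α) (t : ℝ) : 0 ≤ young α t :=
  le_trans (by positivity) (young_ge_sq hα t)

lemma young_ge_cube (hα : 0 < α) (t : ℝ) : |t| ^ 3 / 3 ≤ young α t := by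
  rw [← young_abs, young_of_nonneg (abs_nonneg t)]
  have h0 := abs_nonneg t
  rcases le_total |t| α with h | h
  · rw [max_eq_right (by linarith)]
    nlinarith [mul_nonneg (sq_nonneg |t|) (sub_nonneg.2 h), mul_nonneg h0 (sq_nonneg |t|)]
  · rw [max_eq_left (by linarith)]
    obtain ⟨w, hw⟩ : ∃ w, w = |t| - α := ⟨_, rfl⟩
    have ht : |t| = α + w := by linarith
    have hw0 : 0 ≤ w := by linarith
    rw [ht]
    nlinarith [mul_nonneg (add_nonneg hα.le hw0) (sq_nonneg (α - w)),
      mul_nonneg hw0 (sq_nonneg (α - w)), mul_nonneg hα.le (sq_nonneg (α - w))]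

lemma young_le (hα : 0 < α) (t : ℝ) : young α t ≤ α * t ^ 2 + |t| ^ 3 := by
  rw [young_eq]
  have h0 := abs_nonneg t
  have h1 : max (|t| - α) 0 ≤ |t| := max_le (by linarith) h0
  have h2 := pow_le_pow_left₀ (le_max_right (|t| - α) 0) h1 3
  linarith

lemma dyoung_nonneg (hα : 0 < α) {t : ℝ} (ht : 0 ≤ t) : 0 ≤ dyoung α t := by
  rw [dyoung_of_nonneg hα ht]
  rcases le_total t α with h | h
  · rw [max_eq_right (by linarith)]
    nlinarith
  · rw [max_eq_left (by linarith)]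
    nlinarith [sq_nonneg (t - α)]

lemma dyoung_of_le (hα : 0 < α) {t : ℝ} (ht : 0 ≤ t) (h : t ≤ α) :
    dyoung α t = α ^ 2 - (α - t) ^ 2 := by
  rw [dyoung_of_nonneg hα ht, max_eq_right (by linarith)]
  ring

lemma dyoung_of_ge (hα : 0 < α) {t : ℝ} (h : α ≤ t) :
    dyoung α t = α ^ 2 + 3 * (t - α) ^ 2 := by
  rw [dyoung_of_nonneg hα (hα.le.trans h), max_eq_left (by linarith)]
  ring

/-- Convexity in tangent form. The four cases record on which side of `α` the points lie; in each
the Taylor remainder is a combination of the nonnegative products supplied, for instance `(y - x)²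
(α - (y + 2x)/3)` below `α`. -/
lemma young_tangent_aux (hα : 0 < α) {x y : ℝ} (hx : 0 ≤ x) (hy : 0 ≤ y) :
    young α x + dyoung α x * (y - x) ≤ young α y := by
  rw [young_of_nonneg hx, young_of_nonneg hy]
  rcases le_total x α with h | h <;> rcases le_total y α with h' | h'
  · rw [dyoung_of_le hα hx h, max_eq_right (by linarith : x - α ≤ 0),
      max_eq_right (by linarith : y - α ≤ 0)]
    have : 0 ≤ (y - x) ^ 2 * (α - (y + 2 * x) / 3) := mul_nonneg (sq_nonneg _) (by linarith)
    nlinarith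
  · rw [dyoung_of_le hα hx h, max_eq_right (by linarith : x - α ≤ 0),
      max_eq_left (by linarith : 0 ≤ y - α)]
    have h1 : 0 ≤ (α - x) ^ 2 * (α - (α + 2 * x) / 3) := mul_nonneg (sq_nonneg _) (by linarith)
    have h2 : 0 ≤ (y - α) ^ 3 := pow_nonneg (by linarith) 3
    have h3 : 0 ≤ (α - x) ^ 2 * (y - α) := mul_nonneg (sq_nonneg _) (by linarith)
    nlinarith
  · rw [dyoung_of_ge hα h, max_eq_left (by linarith : 0 ≤ x - α),
      max_eq_right (by linarith : y - α ≤ 0)]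
    have h1 : 0 ≤ (α - y) ^ 2 * (α - (y + 2 * α) / 3) := mul_nonneg (sq_nonneg _) (by linarith)
    have h2 : 0 ≤ (x - α) ^ 3 := pow_nonneg (by linarith) 3
    have h3 : 0 ≤ (x - α) ^ 2 * (α - y) := mul_nonneg (sq_nonneg _) (by linarith)
    nlinarith
  · rw [dyoung_of_ge hα h, max_eq_left (by linarith : 0 ≤ x - α),
      max_eq_left (by linarith : 0 ≤ y - α)]
    have h1 : 0 ≤ (y - x) ^ 2 * ((y - α) + 2 * (x - α)) := mul_nonneg (sq_nonneg _) (by linarith)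
    nlinarith

lemma young_tangent (hα : 0 < α) (x y : ℝ) :
    young α x + dyoung α x * (y - x) ≤ young α y := by
  rcases le_total 0 x with hx | hx
  · have h := young_tangent_aux hα hx (abs_nonneg y)
    rw [young_abs] at h
    have := mul_le_mul_of_nonneg_left (le_abs_self y) (dyoung_nonneg hα hx)
    linarith
  · have h := young_tangent_aux hα (neg_nonneg.2 hx) (abs_nonneg y)
    rw [young_abs, young_neg, dyoung_neg] at h
    have h1 := dyoung_nonneg hα (neg_nonneg.2 hx)
    rw [dyoung_neg] at h1
    have := mul_le_mul_of_nonneg_left (neg_le_abs y) h1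
    linarith

lemma convexOn_young (hα : 0 < α) : ConvexOn ℝ univ (young α) := by
  refine ⟨convex_univ, fun x _ y _ a b ha hb hab => ?_⟩
  simp only [smul_eq_mul]
  have h1 := young_tangent hα (a * x + b * y) x
  have h2 := young_tangent hα (a * x + b * y) y
  have h3 := mul_le_mul_of_nonneg_left h1 ha
  have h4 := mul_le_mul_of_nonneg_left h2 hb
  have h5 : a * (young α (a * x + b * y) + dyoung α (a * x + b * y) * (x - (a * x + b * y))) +
      b * (young α (a * x + b * y) + dyoung α (a * x + b * y) * (y - (a * x + b * y))) =
      (a + b) * young α (a * x + b * y) +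
        dyoung α (a * x + b * y) * ((a * x + b * y) * (1 - (a + b))) := by ring
  rw [hab] at h5
  linarith

lemma young_zero (hα : 0 < α) : young α 0 = 0 := by simp [young, hα]

lemma young_mono (hα : 0 < α) {x y : ℝ} (h : |x| ≤ |y|) : young α x ≤ young α y := by
  have h1 := young_tangent_aux hα (abs_nonneg x) (abs_nonneg y)
  rw [young_abs, young_abs] at h1
  have := mul_nonneg (dyoung_nonneg hα (abs_nonneg x)) (sub_nonneg.2 h)
  linarith

lemma young_mul_le (hα : 0 < α) {c : ℝ} (hc : 0 ≤ c) (hc1 : c ≤ 1) (t : ℝ) :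
    young α (c * t) ≤ c * young α t := by
  have h := (convexOn_young hα).2 (mem_univ t) (mem_univ 0) hc (by linarith : 0 ≤ 1 - c) (by ring)
  simpa [young_zero hα] using h

lemma abs_dyoung_le (hα : 0 < α) (t : ℝ) : |dyoung α t| ≤ 2 * α * |t| + 4 * t ^ 2 := by
  have key : ∀ t : ℝ, 0 ≤ t → |dyoung α t| ≤ 2 * α * |t| + 4 * t ^ 2 := by
    intro t ht
    rw [abs_of_nonneg (dyoung_nonneg hα ht), dyoung_of_nonneg hα ht, abs_of_nonneg ht]
    have h1 : max (t - α) 0 ≤ t := max_le (by linarith) ht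
    have h2 := pow_le_pow_left₀ (le_max_right (t - α) 0) h1 2
    nlinarith [sq_nonneg t]
  rcases le_total 0 t with h | h
  · exact key t h
  · have := key (-t) (by linarith)
    rwa [dyoung_neg, abs_neg, abs_neg, neg_sq] at this

/-- Below `α` the cubic terms cancel. Integrated, this expresses `α ∫ f²` through the modular and
the Lagrange multiplier, with an error only where `f > α`. -/
lemma young_identity (hα : 0 < α) {t : ℝ} (ht : 0 ≤ t) :
    3 * young α t - t * dyoung α t = α * t ^ 2 - 4 * α * (max (t - α) 0) ^ 2 := by
  rw [young_of_nonneg ht, dyoung_of_nonneg hα ht]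
  rcases le_total t α with h | h
  · rw [max_eq_right (by linarith)]; ring
  · rw [max_eq_left (by linarith)]; ring

/-- A `Δ₂` condition; `11 = 3 + 8`, from `young_identity` and `4αt² ≤ 8Ψ(t)`. -/
lemma mul_dyoung_le (hα : 0 < α) (t : ℝ) : t * dyoung α t ≤ 11 * young α t := by
  have key : ∀ t : ℝ, 0 ≤ t → t * dyoung α t ≤ 11 * young α t := by
    intro t ht
    have h := young_identity hα ht
    have h1 : max (t - α) 0 ≤ t := max_le (by linarith) ht
    have h2 := pow_le_pow_left₀ (le_max_right (t - α) 0) h1 2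
    have h3 := young_ge_sq hα t
    have h4 := mul_le_mul_of_nonneg_left h2 hα.le
    have h5 : 0 ≤ α * t ^ 2 := by positivity
    linarith
  rcases le_total 0 t with h | h
  · exact key t h
  · have := key (-t) (by linarith)
    rw [dyoung_neg, young_neg] at this
    linarith

/-- With `t = α(1 + w)` the quotient for `w ≥ 0` is `(1 + w)/(1 + 3w²)`, whose maximum is about
`1.0774`; `27/25` rounds it up. -/
lemma le_dyoung (hα : 0 < α) {t : ℝ} (ht : 0 ≤ t) : α * t ≤ 27 / 25 * dyoung α t := by
  rcases le_total t α with h | h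
  · rw [dyoung_of_le hα ht h]
    nlinarith
  · rw [dyoung_of_ge hα h]
    -- The quadratic `27/25 (α² + 3u²) - α(α + u)` in `u = t - α` has its minimum at `u = 25α/162`.
    nlinarith [sq_nonneg (t - α - 25 / 162 * α), sq_nonneg α]

lemma young_scale (hα : 0 < α) {c : ℝ} (hc : 1 ≤ c) (t : ℝ) :
    (1 - 11 * (c - 1)) * young α (c * t) ≤ young α t := by
  have h1 := young_tangent hα (c * t) t
  have h2 := mul_dyoung_le hα (c * t)
  have h3 := young_nonneg hα (c * t)
  have h4 : dyoung α (c * t) * (t - c * t) = -((c - 1) / c) * (c * t * dyoung α (c * t)) := by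
    field_simp
    ring
  have h5 : (c - 1) / c ≤ c - 1 := div_le_self (by linarith) hc
  have h6 : 0 ≤ (c - 1) / c := div_nonneg (by linarith) (by linarith)
  have h7 : (c - 1) / c * (c * t * dyoung α (c * t)) ≤ (c - 1) * (11 * young α (c * t)) := by
    calc _ ≤ (c - 1) / c * (11 * young α (c * t)) := by gcongr
      _ ≤ _ := by gcongr
  linarith

lemma young_param_le {α₀ : ℝ} (h0 : 0 < α₀) (h : α₀ ≤ α) (t : ℝ) :
    young α t ≤ (2 * (α / α₀) - 1) * young α₀ t := by
  have hα : 0 < α := h0.trans_le h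
  have hr : 1 ≤ α / α₀ := (one_le_div h0).2 h
  have h1 := young_ge_cube h0 t
  have h2 : young α t ≤ (α / α₀) * young α₀ t + (α / α₀ - 1) * (|t| ^ 3 / 3) := by
    rw [young_eq, young_eq]
    have h3 : max (|t| - α) 0 ≤ max (|t| - α₀) 0 := max_le_max (by linarith) le_rfl
    have h4 := pow_le_pow_left₀ (le_max_right (|t| - α) 0) h3 3
    have h5 : α / α₀ * α₀ = α := by field_simp
    have h6 : 0 ≤ (max (|t| - α₀) 0) ^ 3 := pow_nonneg (le_max_right _ _) 3
    nlinarith [mul_nonneg (sub_nonneg.2 hr) h6]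
  nlinarith [mul_le_mul_of_nonneg_left h1 (sub_nonneg.2 hr)]

/-- The cubic bound gives decay at infinity when applied to `f(x)`, the constant one gives control
near the origin. -/
lemma sq_sub_young_le (hα : 0 < α) {t : ℝ} (ht : 0 ≤ t) :
    α * t ^ 2 - young α t ≤ t ^ 3 / 3 ∧ α * t ^ 2 - young α t ≤ 4 / 3 * α ^ 3 := by
  rw [young_of_nonneg ht]
  rcases le_total t α with h | h
  · rw [max_eq_right (by linarith)]
    have := pow_le_pow_left₀ ht h 3
    have := pow_pos hα 3
    constructor <;> linarith
  · rw [max_eq_left (by linarith)]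
    obtain ⟨w, hw⟩ : ∃ w, w = t - α := ⟨_, rfl⟩
    have ht' : t = α + w := by linarith
    have hw0 : 0 ≤ w := by linarith
    rw [ht', add_sub_cancel_left]
    have := pow_nonneg hw0 3
    constructor
    · linarith
    · nlinarith [mul_nonneg (add_nonneg hα.le hw0) (sq_nonneg (α - w)),
        mul_nonneg hw0 (sq_nonneg (α - w)), mul_nonneg hα.le (sq_nonneg (α - w))]

lemma eq_of_dyoung_lt (hα : 0 < α) {t y : ℝ} (ht : 0 ≤ t) (h : dyoung α t = y) (hy : y < α ^ 2) :
    t = α - √(α ^ 2 - y) := by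
  rcases le_total t α with h' | h'
  · rw [dyoung_of_le hα ht h'] at h
    rw [← h, sub_sub_cancel, Real.sqrt_sq (by linarith)]
    ring
  · rw [dyoung_of_ge hα h'] at h
    nlinarith [sq_nonneg (t - α)]

end

/-! ### The Orlicz class, its modular, and bounds for `J` -/

section

instance : IsProbabilityMeasure (kap (1 / 2)) := isProbabilityMeasure_kap (by norm_num)

instance : IsProbabilityMeasure (kap (1 / 4)) := isProbabilityMeasure_kap (by norm_num)

/-- The square of the functional `energy`, as a quadratic form. -/
abbrev quad (f : ℝ → ℝ) : ℝ := form (kap (1 / 2)) f f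

/-- The modular of the Orlicz space. -/
def modular (α : ℝ) (f : ℝ → ℝ) : ℝ := ∫ x, young α (f x)

/-- Measurable functions in `L² ∩ L³`. -/
def Orl (f : ℝ → ℝ) : Prop := SqInt f ∧ Integrable fun x => |f x| ^ 3

lemma conv_eq_avg {s : ℝ} (hs : 0 < s) (f : ℝ → ℝ) : conv s f = avg (kap s) f :=
  funext fun x => conv_eq hs f x

lemma avg_congr_ae (s : ℝ) {f g : ℝ → ℝ} (h : f =ᵐ[volume] g) : avg (kap s) f = avg (kap s) g := by
  funext x
  have h1 : ∀ᵐ t, f (x - t) = g (x - t) :=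
    (Measure.measurePreserving_sub_left volume x).quasiMeasurePreserving.ae h
  exact integral_congr_ae ((kap_absolutelyContinuous s).ae_le h1)

lemma quad_eq {f : ℝ → ℝ} (hf : SqInt f) :
    Integrable (fun x => avg (kap (1 / 4)) f x ^ 2) ∧
      ∫ x, avg (kap (1 / 4)) f x ^ 2 = quad f := by
  have h := integral_avg_sq (kap (1 / 4)) (measurePreserving_neg_kap _) hf
  rw [kap_conv_kap (by norm_num) (by norm_num)] at h
  norm_num at h ⊢
  exact h

lemma quad_nonneg {f : ℝ → ℝ} (hf : SqInt f) : 0 ≤ quad f := by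
  rw [← (quad_eq hf).2]
  exact integral_nonneg fun _ => sq_nonneg _

lemma quad_le_nsq {f : ℝ → ℝ} (hf : SqInt f) : quad f ≤ nsq f := form_le_nsq _ hf

lemma quad_const_mul (c : ℝ) (f : ℝ → ℝ) : quad (fun x => c * f x) = c ^ 2 * quad f := by
  rw [quad, form_const_mul_left, form_const_mul_right]
  ring

lemma energy_eq {f : ℝ → ℝ} (hf : SqInt f) : energy f = √(quad f) := by
  have h := quad_eq hf
  have hm : Measurable (avg (kap (1 / 4)) f) := measurable_avg _ hf.1
  have hL : MemLp (avg (kap (1 / 4)) f) 2 :=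
    (memLp_two_iff_integrable_sq hm.aestronglyMeasurable).2 h.1
  rw [energy, conv_eq_avg (by norm_num),
    hL.eLpNorm_eq_integral_rpow_norm (by norm_num) (by norm_num), ENNReal.toReal_ofReal
    (by positivity), ← h.2, Real.sqrt_eq_rpow]
  norm_num

lemma energy_congr_ae {f g : ℝ → ℝ} (h : f =ᵐ[volume] g) : energy f = energy g := by
  rw [energy, energy, conv_eq_avg (by norm_num), conv_eq_avg (by norm_num), avg_congr_ae _ h]

lemma Admissible.congr_ae {α : ℝ} {f g : ℝ → ℝ} (hf : Admissible α f) (h : f =ᵐ[volume] g) :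
    Admissible α g := by
  have h1 : ∀ r : ℝ, ∫⁻ x, ENNReal.ofReal (young α (f x / r)) =
      ∫⁻ x, ENNReal.ofReal (young α (g x / r)) := fun r =>
    lintegral_congr_ae (h.mono fun x hx => by simp only [hx])
  obtain ⟨⟨hm, c, hc, hfin⟩, hN⟩ := hf
  refine ⟨⟨hm.congr h, c, hc, lt_of_eq_of_lt
    (lintegral_congr_ae (h.mono fun x hx => by simp only [hx])) hfin⟩, ?_⟩
  rw [← hN]
  simp only [gaugeNorm, h1]

lemma Orl.measurable {f : ℝ → ℝ} (hf : Orl f) : Measurable f := hf.1.1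

lemma Orl.const_mul {f : ℝ → ℝ} (hf : Orl f) (c : ℝ) : Orl fun x => c * f x := by
  refine ⟨hf.1.const_mul c, ?_⟩
  simp_rw [abs_mul, mul_pow]
  exact hf.2.const_mul _

lemma Orl.mono {f g : ℝ → ℝ} (hg : Orl g) (hf : Measurable f) (h : ∀ x, |f x| ≤ |g x|) :
    Orl f := by
  refine ⟨hg.1.mono hf h, hg.2.mono' (by fun_prop) (Eventually.of_forall fun x => ?_)⟩
  rw [Real.norm_of_nonneg (by positivity)]
  exact pow_le_pow_left₀ (abs_nonneg _) (h x) 3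

lemma Orl.abs {f : ℝ → ℝ} (hf : Orl f) : Orl fun x => |f x| :=
  hf.mono hf.measurable.abs fun x => by rw [abs_abs]

lemma Orl.add {f g : ℝ → ℝ} (hf : Orl f) (hg : Orl g) : Orl fun x => f x + g x := by
  refine ⟨hf.1.add hg.1, ((hf.2.add hg.2).const_mul 4).mono'
    ((hf.measurable.add hg.measurable).abs.pow_const 3).aestronglyMeasurable
    (Eventually.of_forall fun x => ?_)⟩
  rw [Real.norm_of_nonneg (by positivity)]
  have h := pow_le_pow_left₀ (abs_nonneg _) (abs_add_le (f x) (g x)) 3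
  have h1 := abs_nonneg (f x)
  have h2 := abs_nonneg (g x)
  simp only [Pi.add_apply]
  nlinarith [mul_nonneg (add_nonneg h1 h2) (sq_nonneg (|f x| - |g x|))]

variable {α : ℝ}

lemma Orl.integrable_young (hα : 0 < α) {f : ℝ → ℝ} (hf : Orl f) :
    Integrable fun x => young α (f x) := by
  refine ((hf.1.2.const_mul α).add hf.2).mono'
    (continuous_young.measurable.comp hf.measurable).aestronglyMeasurable
    (Eventually.of_forall fun x => ?_)
  rw [Real.norm_of_nonneg (young_nonneg hα _)]
  exact young_le hα _

lemma orl_of_integrable_young (hα : 0 < α) {f : ℝ → ℝ} (hm : Measurable f)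
    (hf : Integrable fun x => young α (f x)) : Orl f := by
  refine ⟨⟨hm, (hf.const_mul (2 / α)).mono' (hm.pow_const 2).aestronglyMeasurable
    (Eventually.of_forall fun x => ?_)⟩, (hf.const_mul 3).mono' (hm.abs.pow_const 3).aestronglyMeasurable
    (Eventually.of_forall fun x => ?_)⟩
  · rw [Real.norm_of_nonneg (sq_nonneg _), div_mul_eq_mul_div, le_div_iff₀ hα]
    linarith [young_ge_sq hα (f x)]
  · rw [Real.norm_of_nonneg (by positivity)]
    linarith [young_ge_cube hα (f x)]

lemma ofReal_modular (hα : 0 < α) {f : ℝ → ℝ} (hf : Orl f) :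
    ENNReal.ofReal (modular α f) = ∫⁻ x, ENNReal.ofReal (young α (f x)) :=
  ofReal_integral_eq_lintegral_ofReal (hf.integrable_young hα)
    (Eventually.of_forall fun _ => young_nonneg hα _)

lemma modular_nonneg (hα : 0 < α) (f : ℝ → ℝ) : 0 ≤ modular α f :=
  integral_nonneg fun _ => young_nonneg hα _

lemma modular_mono (hα : 0 < α) {f g : ℝ → ℝ} (hf : Orl f) (hg : Orl g)
    (h : ∀ x, |f x| ≤ |g x|) : modular α f ≤ modular α g :=
  integral_mono (hf.integrable_young hα) (hg.integrable_young hα) fun x => young_mono hα (h x)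

lemma nsq_le_modular (hα : 0 < α) {f : ℝ → ℝ} (hf : Orl f) : α / 2 * nsq f ≤ modular α f := by
  rw [nsq, ← integral_const_mul]
  exact integral_mono (hf.1.2.const_mul _) (hf.integrable_young hα) fun x => young_ge_sq hα _

lemma modular_mul_le (hα : 0 < α) {c : ℝ} (hc : 0 ≤ c) (hc1 : c ≤ 1) {f : ℝ → ℝ} (hf : Orl f) :
    modular α (fun x => c * f x) ≤ c * modular α f := by
  rw [modular, modular, ← integral_const_mul]
  exact integral_mono ((hf.const_mul c).integrable_young hα) ((hf.integrable_young hα).const_mul c)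
    fun x => young_mul_le hα hc hc1 _

lemma modular_scale (hα : 0 < α) {c : ℝ} (hc : 1 ≤ c) {f : ℝ → ℝ} (hf : Orl f) :
    (1 - 11 * (c - 1)) * modular α (fun x => c * f x) ≤ modular α f := by
  rw [modular, modular, ← integral_const_mul]
  exact integral_mono (((hf.const_mul c).integrable_young hα).const_mul _) (hf.integrable_young hα)
    fun x => young_scale hα hc _

lemma mem_gauge_iff (hα : 0 < α) {f : ℝ → ℝ} (hf : Orl f) (r : ℝ) :
    ∫⁻ x, ENNReal.ofReal (young α (f x / r)) ≤ 1 ↔ modular α (fun x => r⁻¹ * f x) ≤ 1 := by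
  rw [← ENNReal.ofReal_le_one, ofReal_modular hα (hf.const_mul _)]
  simp_rw [div_eq_inv_mul]

lemma memOrlicz_iff (hα : 0 < α) {f : ℝ → ℝ} (hm : Measurable f) : MemOrlicz α f ↔ Orl f := by
  constructor
  · rintro ⟨-, c, hc, h⟩
    have h1 : Measurable fun x => c * f x := hm.const_mul c
    have h2 : Orl fun x => c * f x := orl_of_integrable_young hα h1
      ⟨(continuous_young.measurable.comp h1).aestronglyMeasurable, by
        rw [hasFiniteIntegral_iff_ofReal (Eventually.of_forall fun _ => young_nonneg hα _)]
        exact h⟩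
    have := h2.const_mul c⁻¹
    simpa [inv_mul_cancel_left₀ hc.ne'] using this
  · intro h
    refine ⟨hm.aemeasurable, 1, one_pos, ?_⟩
    rw [← ofReal_modular hα (h.const_mul 1)]
    exact ENNReal.ofReal_lt_top

/-- Because of the `Δ₂` condition, in the form `modular_scale`, the modular cannot jump under
scaling, so the gauge norm is one exactly when the modular is. -/
lemma admissible_iff (hα : 0 < α) {f : ℝ → ℝ} (hm : Measurable f) :
    Admissible α f ↔ Orl f ∧ modular α f = 1 := by
  rw [Admissible, memOrlicz_iff hα hm]
  refine and_congr_right fun hf => ?_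
  have hS : {r : ℝ | 0 < r ∧ ∫⁻ x, ENNReal.ofReal (young α (f x / r)) ≤ 1} =
      {r : ℝ | 0 < r ∧ modular α (fun x => r⁻¹ * f x) ≤ 1} :=
    Set.ext fun r => and_congr_right fun _ => mem_gauge_iff hα hf r
  rw [gaugeNorm, hS]
  set S := {r : ℝ | 0 < r ∧ modular α (fun x => r⁻¹ * f x) ≤ 1} with hSdef
  have hbdd : BddBelow S := ⟨0, fun r hr => hr.1.le⟩
  constructor
  · intro h
    -- The infimum of the empty set is `0` by convention, which is not `1`.
    have hne : S.Nonempty := by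
      by_contra hne
      rw [Set.not_nonempty_iff_eq_empty.1 hne, Real.sInf_empty] at h
      norm_num at h
    refine le_antisymm ?_ ?_
    · by_contra! hM
      set M := modular α f
      obtain ⟨r, hr1, hr2⟩ : ∃ r : ℝ, 1 < r ∧ 1 < (1 - 11 * (r - 1)) * M := by
        refine ⟨1 + (M - 1) / (12 * M), ?_, ?_⟩
        · have : 0 < (M - 1) / (12 * M) := div_pos (by linarith) (by linarith)
          linarith
        · have : (1 - 11 * (1 + (M - 1) / (12 * M) - 1)) * M = M - 11 / 12 * (M - 1) := by
            field_simp
            ring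
          rw [this]
          linarith
      obtain ⟨q, hq, hqr⟩ := exists_lt_of_csInf_lt hne (h.trans_lt hr1)
      have h1 : modular α (fun x => r⁻¹ * f x) ≤ 1 := by
        refine le_trans (modular_mono hα (hf.const_mul _) (hf.const_mul _) fun x => ?_) hq.2
        rw [abs_mul, abs_mul, abs_of_pos (inv_pos.2 (by linarith)), abs_of_pos (inv_pos.2 hq.1)]
        exact mul_le_mul_of_nonneg_right (inv_anti₀ hq.1 hqr.le) (abs_nonneg _)
      have h2 := modular_scale hα hr1.le (hf.const_mul r⁻¹)
      simp_rw [mul_inv_cancel_left₀ (by linarith : r ≠ 0)] at h2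
      linarith
    · by_contra! hM
      have hM0 : 0 ≤ modular α f := modular_nonneg hα f
      set M := modular α f
      -- Chosen so that `1 - 11 (c - 1) = M`; then `modular_scale` reads `M * modular α (c f) ≤ M`.
      set c := 1 + (1 - M) / 11 with hc
      have hc1 : 1 < c := by linarith
      have h1 : modular α (fun x => c * f x) ≤ 1 := by
        rcases hM0.eq_or_lt with h0 | h0
        · have hs : modular α (fun x => (1 + 1 / 22 : ℝ) * f x) ≤ 0 := by
            have h2 := modular_scale hα (c := 1 + 1 / 22) (by norm_num) hf
            change _ ≤ M at h2
            rw [← h0] at h2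
            linarith
          have hn := nsq_le_modular hα hf
          have hn0 : nsq f = 0 := le_antisymm (by
            change _ ≤ M at hn
            rw [← h0] at hn
            by_contra! h3
            have := mul_pos (half_pos hα) h3
            linarith) (nsq_nonneg f)
          have hae : ∀ᵐ x, f x = 0 := by
            have := (integral_eq_zero_iff_of_nonneg (fun x => sq_nonneg (f x)) hf.1.2).1 hn0
            exact this.mono fun x hx => by simpa using hx
          have : modular α (fun x => c * f x) = 0 := by
            rw [modular, integral_congr_ae (g := fun _ => 0) (hae.mono fun x hx => by
              simp [hx, young_zero hα])]
            simp
          rw [this]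
          exact zero_le_one
        · have h2 := modular_scale hα hc1.le hf
          have h3 : 1 - 11 * (c - 1) = M := by rw [hc]; ring
          rw [h3] at h2
          exact le_of_mul_le_mul_left (by linarith : M * _ ≤ M * 1) h0
      have h4 : c⁻¹ ∈ S := ⟨by positivity, by simpa using h1⟩
      have h5 := csInf_le hbdd h4
      rw [h] at h5
      exact absurd (inv_lt_one_of_one_lt₀ hc1) (not_lt.2 h5)
  · intro h
    refine le_antisymm (csInf_le hbdd ⟨one_pos, by simpa using h.le⟩) (le_csInf ⟨1, one_pos, by simpa using h.le⟩ ?_)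
    rintro r ⟨hr, hr2⟩
    by_contra! hr1
    have h1 := modular_mul_le hα hr.le hr1.le (hf.const_mul r⁻¹)
    simp_rw [mul_inv_cancel_left₀ hr.ne'] at h1
    rw [h] at h1
    nlinarith

lemma exists_normalize (hα : 0 < α) {f : ℝ → ℝ} (hf : Orl f) (hn : 0 < nsq f)
    (hM : modular α f ≤ 1) : ∃ c : ℝ, 1 ≤ c ∧ modular α (fun x => c * f x) = 1 := by
  have hconv : ConvexOn ℝ univ fun c : ℝ => modular α (fun x => c * f x) := by
    refine ⟨convex_univ, fun x _ y _ a b ha hb hab => ?_⟩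
    simp only [modular, smul_eq_mul]
    rw [← integral_const_mul, ← integral_const_mul,
      ← integral_add (((hf.const_mul x).integrable_young hα).const_mul a)
        (((hf.const_mul y).integrable_young hα).const_mul b)]
    refine integral_mono ((hf.const_mul _).integrable_young hα)
      ((((hf.const_mul x).integrable_young hα).const_mul a).add
        (((hf.const_mul y).integrable_young hα).const_mul b)) fun z => ?_
    have := (convexOn_young hα).2 (mem_univ (x * f z)) (mem_univ (y * f z)) ha hb hab
    simp only [smul_eq_mul] at this
    simpa only [add_mul, mul_assoc] using this
  have hcont : Continuous fun c : ℝ => modular α (fun x => c * f x) :=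
    continuousOn_univ.1 (hconv.continuousOn isOpen_univ)
  -- Then `C² ≥ 2 / (α nsq f)`, so `nsq_le_modular` puts the modular of `C f` above `1`.
  set C := 1 + 2 / (α * nsq f) with hC
  have hp : 0 < 2 / (α * nsq f) := by positivity
  have hC1 : 1 ≤ C := by linarith
  have hbig : 1 ≤ modular α (fun x => C * f x) := by
    refine le_trans ?_ (nsq_le_modular hα (hf.const_mul C))
    have : nsq (fun x => C * f x) = C ^ 2 * nsq f := by
      simp_rw [nsq, mul_pow, integral_const_mul]
    rw [this]
    have h2 : 2 / (α * nsq f) ≤ C ^ 2 := by nlinarith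
    rw [div_le_iff₀ (by positivity)] at h2
    linarith
  obtain ⟨c, hc, hc2⟩ := intermediate_value_Icc hC1 hcont.continuousOn
    (show (1 : ℝ) ∈ Icc _ _ from ⟨by simpa using hM, hbig⟩)
  exact ⟨c, hc.1, hc2⟩

lemma J_bddAbove (hα : 0 < α) : BddAbove {j : ℝ | ∃ f : ℝ → ℝ, Admissible α f ∧ j = energy f} := by
  refine ⟨√(2 / α), ?_⟩
  rintro _ ⟨f, hf, rfl⟩
  have hm := hf.1.1
  have hf' := hf.congr_ae hm.ae_eq_mk
  rw [admissible_iff hα hm.measurable_mk] at hf'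
  rw [energy_congr_ae hm.ae_eq_mk, energy_eq hf'.1.1]
  refine Real.sqrt_le_sqrt ((quad_le_nsq hf'.1.1).trans ?_)
  have := nsq_le_modular hα hf'.1
  rw [le_div_iff₀ hα]
  linarith

lemma J_nonneg (α : ℝ) : 0 ≤ J α := by
  refine Real.sSup_nonneg ?_
  rintro _ ⟨f, -, rfl⟩
  exact ENNReal.toReal_nonneg

/-- Scaling `f` up to modular one does not decrease `quad`. -/
lemma quad_le_J_sq (hα : 0 < α) {f : ℝ → ℝ} (hf : Orl f) (hM : modular α f ≤ 1) :
    quad f ≤ J α ^ 2 := by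
  rcases (nsq_nonneg f).eq_or_lt with h | h
  · exact (quad_le_nsq hf.1).trans (h.symm.le.trans (sq_nonneg _))
  · obtain ⟨c, hc, hc1⟩ := exists_normalize hα hf h hM
    have h1 : Admissible α (fun x => c * f x) :=
      (admissible_iff hα (hf.const_mul c).measurable).2 ⟨hf.const_mul c, hc1⟩
    have h2 := le_csSup (J_bddAbove hα) ⟨_, h1, rfl⟩
    change _ ≤ J α at h2
    rw [energy_eq (hf.const_mul c).1, Real.sqrt_le_left (J_nonneg α), quad_const_mul] at h2
    exact (le_mul_of_one_le_left (quad_nonneg hf.1) (one_le_pow₀ hc)).trans h2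

lemma orl_indicator (A a : ℝ) : Orl ((Icc (-a) a).indicator fun _ => A) := by
  have hm : Measurable ((Icc (-a) a).indicator fun _ : ℝ => A) :=
    measurable_const.indicator measurableSet_Icc
  have h : ∀ n : ℕ, n ≠ 0 → Integrable fun x => |(Icc (-a) a).indicator (fun _ : ℝ => A) x| ^ n := by
    intro n hn
    have : (fun x => |(Icc (-a) a).indicator (fun _ : ℝ => A) x| ^ n) =
        (Icc (-a) a).indicator fun _ => |A| ^ n := by
      funext x
      by_cases hx : x ∈ Icc (-a) a
      · rw [indicator_of_mem hx, indicator_of_mem hx]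
      · rw [indicator_of_notMem hx, indicator_of_notMem hx, abs_zero, zero_pow hn]
    rw [this]
    exact continuous_const.integrableOn_Icc.integrable_indicator measurableSet_Icc
  exact ⟨⟨hm, by simpa only [sq_abs] using h 2 two_ne_zero⟩, h 3 three_ne_zero⟩

lemma modular_indicator (hα : 0 < α) (A : ℝ) {a : ℝ} (ha : 0 ≤ a) :
    modular α ((Icc (-a) a).indicator fun _ => A) = 2 * a * young α A := by
  have : (fun x => young α ((Icc (-a) a).indicator (fun _ : ℝ => A) x)) =
      (Icc (-a) a).indicator fun _ => young α A := by
    funext x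
    by_cases hx : x ∈ Icc (-a) a
    · rw [indicator_of_mem hx, indicator_of_mem hx]
    · rw [indicator_of_notMem hx, indicator_of_notMem hx, young_zero hα]
  rw [modular, this, integral_indicator measurableSet_Icc, setIntegral_const,
    Real.volume_real_Icc_of_le (by linarith), smul_eq_mul]
  ring

/-- An interval of length `2a` and its translate by `u` overlap in length at least `2a - |u|`. -/
lemma quad_indicator_ge (A a : ℝ) :
    A ^ 2 * (2 * a - ∫ u, |u| ∂kap (1 / 2)) ≤ quad ((Icc (-a) a).indicator fun _ => A) := by
  have hint := integrable_abs_kap (s := 1 / 2) (by norm_num) (by norm_num)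
  have : A ^ 2 * (2 * a - ∫ u, |u| ∂kap (1 / 2)) = ∫ u, A ^ 2 * (2 * a - |u|) ∂kap (1 / 2) := by
    rw [integral_const_mul, integral_sub (integrable_const _) hint, integral_const, probReal_univ,
      one_smul]
  rw [this]
  refine integral_mono (((integrable_const _).sub hint).const_mul _)
    (integrable_corr _ (orl_indicator A a).1 (orl_indicator A a).1) fun u => ?_
  have h : (fun x => (Icc (-a) a).indicator (fun _ : ℝ => A) x *
      (Icc (-a) a).indicator (fun _ : ℝ => A) (x + u)) =
      (Icc (max (-a) (-a - u)) (min a (a - u))).indicator fun _ => A ^ 2 := by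
    funext x
    have h1 : (Icc (-a) a).indicator (fun _ : ℝ => A) (x + u) =
        (Icc (-a - u) (a - u)).indicator (fun _ : ℝ => A) x := by
      simp only [indicator, mem_Icc, neg_le_iff_add_nonneg, sub_le_iff_le_add, le_sub_iff_add_le]
    rw [h1, ← Icc_inter_Icc, sq, ← inter_indicator_mul]
  simp only [corr, h]
  rw [integral_indicator measurableSet_Icc, setIntegral_const, Real.volume_real_Icc, smul_eq_mul,
    mul_comm]
  refine mul_le_mul_of_nonneg_right (le_max_of_le_left ?_) (sq_nonneg A)
  rcases le_total 0 u with hu | hu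
  · rw [abs_of_nonneg hu, min_eq_right (by linarith), max_eq_left (by linarith)]
    linarith
  · rw [abs_of_nonpos hu, min_eq_left (by linarith), max_eq_right (by linarith)]
    linarith

lemma indicator_le_J_sq (hα : 0 < α) {A : ℝ} (hA : 0 < A) :
    A ^ 2 * (1 / young α A - ∫ u, |u| ∂kap (1 / 2)) ≤ J α ^ 2 := by
  have hy : 0 < young α A := lt_of_lt_of_le (by positivity) (young_ge_sq hα A)
  have h := quad_le_J_sq hα (orl_indicator A (1 / (2 * young α A)))
    (by rw [modular_indicator hα A (by positivity)]; field_simp; rfl)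
  refine le_trans (le_of_eq ?_) ((quad_indicator_ge A (1 / (2 * young α A))).trans h)
  congr 2
  field_simp

/-- Test with indicators of height `A = cα` and modular one. Here `α A² / Ψ(A) = 1 / (1 - c/3) ≥ 1 +
c/3` gains a term linear in `c`, while the nonlocal loss `c² α³ m` is quadratic; the chosen `c`
makes it smaller than the gain. -/
lemma one_lt_mul_J_sq (hα : 0 < α) : 1 < α * J α ^ 2 := by
  set m := ∫ u, |u| ∂kap (1 / 2) with hm
  have hm0 : 0 ≤ m := integral_nonneg fun _ => abs_nonneg _
  set c := 1 / (1 + 3 * α ^ 3 * m) with hc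
  have hd : 0 < 1 + 3 * α ^ 3 * m := by positivity
  have hc0 : 0 < c := by positivity
  have hc1 : c ≤ 1 := by
    rw [hc, div_le_one hd]
    have : 0 ≤ 3 * α ^ 3 * m := by positivity
    linarith
  have hcm : 3 * (c * (α ^ 3 * m)) < 1 := by
    have : c * (1 + 3 * α ^ 3 * m) = 1 := by rw [hc]; field_simp
    linarith
  have h := indicator_le_J_sq hα (mul_pos hc0 hα)
  have hy : young α (c * α) = α ^ 3 * c ^ 2 * (1 - c / 3) := by
    rw [young_of_nonneg (by positivity), max_eq_right (by nlinarith)]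
    ring
  rw [hy] at h
  have h3 : 0 < 1 - c / 3 := by linarith
  have h4 : 1 + c / 3 ≤ 1 / (1 - c / 3) := by
    rw [le_div_iff₀ h3]
    nlinarith
  have h5 : α * ((c * α) ^ 2 * (1 / (α ^ 3 * c ^ 2 * (1 - c / 3)) - m)) =
      1 / (1 - c / 3) - c * (c * (α ^ 3 * m)) := by
    field_simp
  have h6 := mul_le_mul_of_nonneg_left h hα.le
  rw [h5] at h6
  have h7 := mul_lt_mul_of_pos_left hcm hc0
  linarith

/-- An indicator of height `3α/2` has `α A² / Ψ(A) = 54/31 > 3/2`, and the nonlocal loss is of order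
`α³`. -/
lemma three_halves_lt_mul_J_sq :
    ∃ β : ℝ, 0 < β ∧ ∀ α, 0 < α → α ≤ β → 3 / 2 < α * J α ^ 2 := by
  set m := ∫ u, |u| ∂kap (1 / 2) with hm
  have hm0 : 0 ≤ m := integral_nonneg fun _ => abs_nonneg _
  refine ⟨1 / (1 + 10 * m), by positivity, fun α hα h => ?_⟩
  have hb : (0 : ℝ) < 1 + 10 * m := by linarith
  rw [le_div_iff₀ hb] at h
  have hα1 : α ≤ 1 := by nlinarith
  have hα3 : α ^ 3 * m ≤ 1 / 10 := by
    have : α ^ 3 ≤ α := by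
      nlinarith [mul_nonneg hα.le hα.le]
    nlinarith
  have h1 := indicator_le_J_sq hα (A := 3 / 2 * α) (by positivity)
  have hy : young α (3 / 2 * α) = 31 / 24 * α ^ 3 := by
    rw [young_of_nonneg (by positivity), max_eq_left (by linarith)]
    ring
  rw [hy] at h1
  have h2 := mul_le_mul_of_nonneg_left h1 hα.le
  have h3 : α * ((3 / 2 * α) ^ 2 * (1 / (31 / 24 * α ^ 3) - m)) = 54 / 31 - 9 / 4 * (α ^ 3 * m) := by
    field_simp
    ring
  rw [h3] at h2
  linarith

lemma J_pos (hα : 0 < α) : 0 < J α := by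
  refine lt_of_le_of_ne (J_nonneg α) fun h => ?_
  have := one_lt_mul_J_sq hα
  rw [← h] at this
  norm_num at this

lemma exists_near_J (hα : 0 < α) {ε : ℝ} (hε : 0 < ε) :
    ∃ f : ℝ → ℝ, Orl f ∧ (∀ x, 0 ≤ f x) ∧ modular α f = 1 ∧ J α ^ 2 - ε < quad f := by
  have hJ := J_pos hα
  have hne : {j : ℝ | ∃ f : ℝ → ℝ, Admissible α f ∧ j = energy f}.Nonempty := by
    by_contra hne
    rw [J, Set.not_nonempty_iff_eq_empty.1 hne, Real.sSup_empty] at hJ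
    exact lt_irrefl _ hJ
  have hlt : √(J α ^ 2 - ε) < J α := by
    rw [Real.sqrt_lt' hJ]
    linarith
  obtain ⟨_, ⟨f, hf, rfl⟩, hfJ⟩ := exists_lt_of_lt_csSup hne hlt
  have hm := hf.1.1
  have hf' := hf.congr_ae hm.ae_eq_mk
  rw [admissible_iff hα hm.measurable_mk] at hf'
  rw [energy_congr_ae hm.ae_eq_mk, energy_eq hf'.1.1] at hfJ
  refine ⟨fun x => |hm.mk f x|, hf'.1.abs, fun _ => abs_nonneg _, ?_, ?_⟩
  · rw [← hf'.2]
    simp only [modular, young_abs]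
  · exact (lt_of_not_ge fun h => hfJ.not_ge (Real.sqrt_le_sqrt h)).trans_le (form_le_form_abs _ hf'.1.1)

/-- The factor tends to `1` as `α` decreases to `α₀`, so bounds valid above the threshold pass to
the threshold. -/
lemma J_sq_le_of_le {α₀ : ℝ} (h0 : 0 < α₀) (h : α₀ ≤ α) :
    J α₀ ^ 2 ≤ (2 * (α / α₀) - 1) ^ 2 * J α ^ 2 := by
  have hα : 0 < α := h0.trans_le h
  have hr : 1 ≤ α / α₀ := (one_le_div h0).2 h
  set ρ := 2 * (α / α₀) - 1 with hρ
  have hρ1 : 1 ≤ ρ := by linarith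
  refine le_of_forall_sub_le fun ε hε => ?_
  obtain ⟨f, hf, -, hM, hE⟩ := exists_near_J h0 hε
  have h1 : modular α f ≤ ρ := by
    have : modular α f ≤ ρ * modular α₀ f := by
      rw [modular, modular, ← integral_const_mul]
      exact integral_mono (hf.integrable_young hα) ((hf.integrable_young h0).const_mul _)
        fun x => young_param_le h0 h _
    rwa [hM, mul_one] at this
  have h2 := modular_mul_le hα (inv_nonneg.2 (by linarith)) (inv_le_one_of_one_le₀ hρ1) hf
  have h3 : ρ⁻¹ * modular α f ≤ 1 := by
    rw [inv_mul_le_iff₀ (by linarith)]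
    linarith
  have h4 := quad_le_J_sq hα (hf.const_mul ρ⁻¹) (h2.trans h3)
  rw [quad_const_mul, inv_pow, inv_mul_le_iff₀ (by positivity)] at h4
  linarith

lemma BellShaped.le_zero {f : ℝ → ℝ} (hf : BellShaped f) (hc : Continuous f) (x : ℝ) :
    f x ≤ f 0 := by
  have h : ∀ x, 0 < x → f x ≤ f 0 := fun x hx => by
    refine ge_of_tendsto (hc.continuousAt.tendsto.mono_left nhdsWithin_le_nhds :
      Tendsto f (𝓝[>] 0) (𝓝 (f 0))) ?_
    filter_upwards [Ioo_mem_nhdsGT hx] with y hy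
    exact hf.2.2 hy.1 hx hy.2.le
  rcases lt_trichotomy x 0 with hx | rfl | hx
  · rw [← hf.1]
    exact h _ (by linarith)
  · rfl
  · exact h x hx

lemma IsMaximizer.spec (hα : 0 < α) {f : ℝ → ℝ} (hf : IsMaximizer α f) :
    Orl f ∧ modular α f = 1 ∧ quad f = J α ^ 2 := by
  obtain ⟨hc, hb, ha, hE⟩ := hf
  obtain ⟨h1, h2⟩ := (admissible_iff hα hc.measurable).1 ha
  refine ⟨h1, h2, ?_⟩
  rw [← hE, energy_eq h1.1, Real.sq_sqrt (quad_nonneg h1.1)]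

/-- Where `f < α` one has `Ψ(f) ≥ (2/3) α f²`, hence `(2/3) α J² ≤ (2/3) α nsq f ≤ 1`. -/
lemma IsMaximizer.mul_J_sq_le (hα : 0 < α) {f : ℝ → ℝ} (hf : IsMaximizer α f) (h0 : f 0 < α) :
    α * J α ^ 2 ≤ 3 / 2 := by
  obtain ⟨h1, h2, h3⟩ := hf.spec hα
  have h4 : 2 / 3 * α * nsq f ≤ modular α f := by
    rw [nsq, ← integral_const_mul]
    refine integral_mono (h1.1.2.const_mul _) (h1.integrable_young hα) fun x => ?_
    have h5 := hf.2.1.2.1 x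
    have h6 := (hf.2.1.le_zero hf.1 x).trans h0.le
    simp only
    rw [young_of_nonneg h5, max_eq_right (by linarith)]
    nlinarith [mul_nonneg (mul_nonneg h5 h5) (sub_nonneg.2 h6)]
  have h7 := quad_le_nsq h1.1
  rw [h3] at h7
  nlinarith

end

/-! ### Bell-shaped functions: correlation, dilation, decay -/

section

/-- Nonnegative, even and decreasing in `|x|` away from the origin. -/
def Bell (f : ℝ → ℝ) : Prop := (∀ x, 0 ≤ f x) ∧ ∀ x y, y ≠ 0 → |y| ≤ |x| → f x ≤ f y

lemma Bell.neg {f : ℝ → ℝ} (hf : Bell f) (x : ℝ) : f (-x) = f x := by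
  rcases eq_or_ne x 0 with rfl | hx
  · rw [neg_zero]
  · exact le_antisymm (hf.2 _ _ hx (abs_neg x).ge) (hf.2 _ _ (neg_ne_zero.2 hx) (abs_neg x).le)

/-- `Bell` leaves the value at the origin free because `dens s 0` may be the default value of a
divergent integral. -/
lemma bell_dens {s : ℝ} (hs : 0 < s) : Bell (dens s) := by
  refine ⟨dens_nonneg s, fun x y hy h => ?_⟩
  exact dens_anti hs hy h

lemma corr_neg_right {f g : ℝ → ℝ} (hf : ∀ x, f (-x) = f x) (hg : ∀ x, g (-x) = g x) (u : ℝ) :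
    corr f g (-u) = corr f g u := by
  rw [corr, corr, ← integral_neg_eq_self]
  refine integral_congr_ae (Eventually.of_forall fun x => ?_)
  simp only
  rw [hf, ← neg_add, hg]

/-- Averaging each correlation with its reflected copy reduces the claim to the pointwise inequality
`(f(x) - f(x+u+v)) (g(x+u) - g(x+v)) ≤ 0`. -/
lemma Bell.corr_anti {f g : ℝ → ℝ} (hf : Bell f) (hg : Bell g)
    (hint : ∀ u, Integrable fun x => f x * g (x + u)) {u v : ℝ} (h : |v| ≤ |u|) :
    corr f g u ≤ corr f g v := by
  wlog hu : 0 ≤ u generalizing u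
  · rw [← corr_neg_right hf.neg hg.neg]
    exact this (by rwa [abs_neg]) (by linarith)
  wlog hv : 0 ≤ v generalizing v
  · rw [← corr_neg_right hf.neg hg.neg v]
    exact this (by rwa [abs_neg]) (by linarith)
  rw [abs_of_nonneg hu, abs_of_nonneg hv] at h
  have key : ∀ a b : ℝ, Integrable (fun x => f (x + a + b) * g (x + b)) ∧
      ∫ x, f (x + a + b) * g (x + b) = corr f g a := by
    intro a b
    have h1 : (fun x => f (x + a + b) * g (x + b)) =
        fun x => (fun y => f y * g (y + a)) (-(a + b) - x) := by
      funext x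
      simp only
      rw [← hf.neg (x + a + b), ← hg.neg (x + b)]
      congr 2 <;> ring
    rw [h1]
    exact ⟨(hint a).comp_sub_left _, integral_sub_left_eq_self (fun y => f y * g (y + a)) volume _⟩
  have e1 := key u v
  have e2 := key v u
  have hle : corr f g u + corr f g u ≤ corr f g v + corr f g v := by
    nth_rw 2 [← e1.2]
    nth_rw 2 [← e2.2]
    rw [corr, corr, ← integral_add (hint u) e1.1, ← integral_add (hint v) e2.1]
    refine integral_mono_ae ((hint u).add e1.1) ((hint v).add e2.1) ?_
    have hne : ∀ c : ℝ, ∀ᵐ x : ℝ, x + c ≠ 0 := fun c => by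
      refine (measure_eq_zero_iff_ae_notMem.1 (Real.volume_singleton (a := -c))).mono fun x hx h0 => hx ?_
      exact (eq_neg_of_add_eq_zero_left h0 : x = -c)
    filter_upwards [hne 0, hne (u + v), hne u, hne v] with x h0 huv hu' hv'
    rw [add_zero] at h0
    rw [show x + u + v = x + (u + v) by ring, show x + v + u = x + (u + v) by ring]
    -- The sign of `2x + u + v` decides both which of `x`, `x + u + v` and which of `x + u`, `x + v`
    -- is nearer the origin.
    rcases le_total 0 (2 * x + (u + v)) with hx | hx
    · have a1 : f (x + (u + v)) ≤ f x := hf.2 _ _ h0 (sq_le_sq.1 (by nlinarith))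
      have a2 : g (x + u) ≤ g (x + v) := hg.2 _ _ hv' (sq_le_sq.1 (by nlinarith))
      nlinarith
    · have a1 : f x ≤ f (x + (u + v)) := hf.2 _ _ huv (sq_le_sq.1 (by nlinarith))
      have a2 : g (x + v) ≤ g (x + u) := hg.2 _ _ hu' (sq_le_sq.1 (by nlinarith))
      nlinarith
  linarith

lemma Orl.comp_div {f : ℝ → ℝ} (hf : Orl f) {θ : ℝ} (hθ : θ ≠ 0) : Orl fun x => f (x / θ) :=
  ⟨⟨hf.measurable.comp (measurable_id.div_const θ), hf.1.2.comp_div hθ⟩, hf.2.comp_div hθ⟩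

/-- Dilation by `θ` turns the correlation at `u` into `θ` times the correlation at `u / θ`, which is
larger for bell-shaped functions. -/
lemma quad_comp_div_ge {f : ℝ → ℝ} (hf : SqInt f) (hb : Bell f) {θ : ℝ} (hθ : 1 ≤ θ) :
    θ * quad f ≤ quad fun x => f (x / θ) := by
  have h0 : 0 < θ := by linarith
  have hd : SqInt fun x => f (x / θ) :=
    ⟨hf.1.comp (measurable_id.div_const θ), hf.2.comp_div h0.ne'⟩
  rw [quad, form, ← integral_const_mul]
  refine integral_mono ((integrable_corr _ hf hf).const_mul θ) (integrable_corr _ hd hd) fun u => ?_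
  have h1 : corr (fun x => f (x / θ)) (fun x => f (x / θ)) u = θ * corr f f (u / θ) := by
    have := Measure.integral_comp_div (fun x => f x * f (x + u / θ)) θ
    rw [abs_of_pos h0, smul_eq_mul] at this
    rw [corr, corr, ← this]
    simp_rw [add_div]
  simp only
  rw [h1]
  refine mul_le_mul_of_nonneg_left (hb.corr_anti hb (fun v => hf.integrable_mul (hf.comp_add v)) ?_)
    h0.le
  rw [abs_div, abs_of_pos h0]
  exact div_le_self (abs_nonneg u) hθ

variable {α : ℝ}

/-- Dilate by the reciprocal of the modular to reach modular one. This linear gain over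
`quad_le_J_sq` excludes loss of mass in the limit and bounds the Lagrange multiplier. -/
lemma Bell.quad_le {f : ℝ → ℝ} (hα : 0 < α) (hf : Orl f) (hb : Bell f) (hM : modular α f ≤ 1) :
    quad f ≤ J α ^ 2 * modular α f := by
  rcases (modular_nonneg hα f).eq_or_lt with h0 | h0
  · have h1 := nsq_le_modular hα hf
    rw [← h0] at h1 ⊢
    rw [mul_zero]
    refine (quad_le_nsq hf.1).trans ?_
    by_contra! h3
    have := mul_pos (half_pos hα) h3
    linarith
  · set θ := (modular α f)⁻¹ with hθ
    have hθ1 : 1 ≤ θ := (one_le_inv₀ h0).2 hM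
    have hθ0 : 0 < θ := by linarith
    have h1 : modular α (fun x => f (x / θ)) = 1 := by
      have := Measure.integral_comp_div (fun x => young α (f x)) θ
      rw [abs_of_pos hθ0, smul_eq_mul] at this
      rw [modular, this, hθ]
      exact inv_mul_cancel₀ h0.ne'
    have h2 := quad_le_J_sq hα (hf.comp_div hθ0.ne') h1.le
    have h3 := (quad_comp_div_ge hf.1 hb hθ1).trans h2
    rw [hθ, inv_mul_le_iff₀ h0] at h3
    linarith

/-- A bell-shaped `f` dominates almost everywhere the indicator of `[-|x|, |x|]` with height `f x`.
-/
lemma Bell.young_tail {f : ℝ → ℝ} (hα : 0 < α) (hf : Orl f) (hb : Bell f) {x : ℝ} :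
    2 * |x| * young α (f x) ≤ modular α f := by
  rw [← modular_indicator hα (f x) (abs_nonneg x), modular, modular]
  refine integral_mono_ae ((orl_indicator _ _).integrable_young hα) (hf.integrable_young hα) ?_
  filter_upwards [measure_eq_zero_iff_ae_notMem.1 (Real.volume_singleton (a := 0))] with y hy
  refine young_mono hα ?_
  rw [abs_of_nonneg (hb.1 y)]
  by_cases h : y ∈ Icc (-|x|) |x|
  · rw [indicator_of_mem h, abs_of_nonneg (hb.1 x)]
    exact hb.2 _ _ hy (abs_le.2 h)
  · rw [indicator_of_notMem h, abs_zero]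
    exact hb.1 y

lemma Bell.cube_tail {f : ℝ → ℝ} (hα : 0 < α) (hf : Orl f) (hb : Bell f) {x : ℝ} :
    2 * |x| * f x ^ 3 ≤ 3 * modular α f := by
  have h1 := hb.young_tail hα hf (x := x)
  have h2 := young_ge_cube hα (f x)
  rw [abs_of_nonneg (hb.1 x)] at h2
  have := mul_le_mul_of_nonneg_left h2 (mul_nonneg zero_le_two (abs_nonneg x))
  linarith

lemma Bell.sq_tail {f : ℝ → ℝ} (hα : 0 < α) (hf : Orl f) (hb : Bell f) {x : ℝ} :
    α * |x| * f x ^ 2 ≤ modular α f := by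
  have h1 := hb.young_tail hα hf (x := x)
  have h2 := young_ge_sq hα (f x)
  have := mul_le_mul_of_nonneg_left h2 (mul_nonneg zero_le_two (abs_nonneg x))
  linarith

lemma Bell.countable_not_continuousAt {f : ℝ → ℝ} (hb : Bell f) :
    {x | ¬ContinuousAt f x}.Countable := by
  have hanti : Antitone fun t => f (Real.exp t) := fun s t hst =>
    hb.2 _ _ (Real.exp_pos s).ne' (by
      rw [abs_of_pos (Real.exp_pos s), abs_of_pos (Real.exp_pos t)]
      exact Real.exp_le_exp.2 hst)
  have h1 := hanti.countable_not_continuousAt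
  have hpos : ∀ x : ℝ, 0 < x → ContinuousAt (fun t => f (Real.exp t)) (Real.log x) →
      ContinuousAt f x := fun x hx h => by
    have h2 : ContinuousAt ((fun t => f (Real.exp t)) ∘ Real.log) x :=
      ContinuousAt.comp h (Real.continuousAt_log hx.ne')
    refine h2.congr ?_
    filter_upwards [Ioi_mem_nhds hx] with y hy
    simp [Real.exp_log (show 0 < y from hy)]
  refine (((h1.image Real.exp).union (h1.image fun t => -Real.exp t)).union
    (countable_singleton (0 : ℝ))).mono fun x hx => ?_
  rcases lt_trichotomy x 0 with h | h | h
  · refine Or.inl (Or.inr ⟨Real.log (-x), fun hc => hx ?_, by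
      simp only; rw [Real.exp_log (by linarith), neg_neg]⟩)
    have h3 : ContinuousAt (f ∘ Neg.neg) x :=
      ContinuousAt.comp (hpos (-x) (by linarith) hc) continuous_neg.continuousAt
    exact h3.congr (Eventually.of_forall hb.neg)
  · exact Or.inr h
  · exact Or.inl (Or.inl ⟨Real.log x, fun hc => hx (hpos x h hc), Real.exp_log h⟩)

lemma continuous_avg {f : ℝ → ℝ} {s β : ℝ} (hs : 0 < s) (hm : Measurable f) (hb : Bell f)
    (hβ : ∀ x, f x ≤ β) : Continuous (avg (kap s) f) := by
  have := isProbabilityMeasure_kap hs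
  refine continuous_iff_continuousAt.2 fun x => ?_
  refine tendsto_integral_filter_of_dominated_convergence (fun _ => β)
    (Eventually.of_forall fun y => (hm.comp (measurable_const.sub measurable_id)).aestronglyMeasurable)
    (Eventually.of_forall fun y => Eventually.of_forall fun t => ?_) (integrable_const _) ?_
  · rw [Real.norm_of_nonneg (hb.1 _)]
    exact hβ _
  · have h1 : volume ((fun t => x - t) ⁻¹' {x | ¬ContinuousAt f x}) = 0 :=
      ((hb.countable_not_continuousAt).preimage sub_right_injective).measure_zero _
    refine (kap_absolutelyContinuous s).ae_le ?_
    filter_upwards [measure_eq_zero_iff_ae_notMem.1 h1] with t ht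
    have h2 : ContinuousAt f (x - t) := not_not.1 ht
    exact h2.tendsto.comp ((continuous_sub_right t).tendsto x)

lemma Bell.avg {f : ℝ → ℝ} {s β : ℝ} (hs : 0 < s) (hm : Measurable f) (hb : Bell f)
    (hβ : ∀ x, f x ≤ β) {x y : ℝ} (h : |y| ≤ |x|) : avg (kap s) f x ≤ avg (kap s) f y := by
  have h1 : ∀ x, Whitham.avg (kap s) f x = corr (dens s) f x := fun x => by
    rw [avg_eq_add _ (measurePreserving_neg_kap s), integral_kap, corr]
    simp_rw [smul_eq_mul, add_comm]
  rw [h1, h1]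
  refine (bell_dens hs).corr_anti hb (fun u => ?_) h
  refine (integrable_dens hs).mul_bdd (c := β)
    (hm.comp (measurable_add_const u)).aestronglyMeasurable (Eventually.of_forall fun t => ?_)
  rw [Real.norm_of_nonneg (hb.1 _)]
  exact hβ _

end

/-! ### Approximation by step functions -/

section

lemma ae_prod_add (κ : Measure ℝ) [IsProbabilityMeasure κ] {P : ℝ → Prop} (h : ∀ᵐ x, P x) :
    ∀ᵐ p : ℝ × ℝ ∂κ.prod volume, P p.2 ∧ P (p.2 + p.1) := by
  have h1 : MeasurePreserving (fun p : ℝ × ℝ => (p.1, p.2 + p.1)) (κ.prod volume)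
      (κ.prod volume) :=
    (MeasurePreserving.id κ).skew_product (measurable_snd.add measurable_fst)
      (Eventually.of_forall fun u => (measurePreserving_add_right volume u).map_eq)
  have h2 : ∀ᵐ p : ℝ × ℝ ∂κ.prod volume, P p.2 := Measure.quasiMeasurePreserving_snd.ae h
  exact h2.and (h1.quasiMeasurePreserving.ae h2)

/-- Fatou's lemma, phrased for strict lower bounds of real integrals. -/
lemma eventually_lt_integral {X : Type*} [MeasurableSpace X] {μ : Measure X} {f : X → ℝ}
    {g : ℕ → X → ℝ} (hf : Integrable f μ) (hg : ∀ n, Integrable (g n) μ) (hf0 : ∀ x, 0 ≤ f x)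
    (hg0 : ∀ n x, 0 ≤ g n x) (h : ∀ᵐ x ∂μ, Tendsto (fun n => g n x) atTop (𝓝 (f x))) {c : ℝ}
    (hc : c < ∫ x, f x ∂μ) : ∀ᶠ n in atTop, c < ∫ x, g n x ∂μ := by
  rcases lt_or_ge c 0 with hc0 | hc0
  · exact Eventually.of_forall fun n => hc0.trans_le (integral_nonneg (hg0 n))
  have e : ∀ n, ENNReal.ofReal (∫ x, g n x ∂μ) = ∫⁻ x, ENNReal.ofReal (g n x) ∂μ := fun n =>
    ofReal_integral_eq_lintegral_ofReal (hg n) (Eventually.of_forall (hg0 n))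
  have h1 : ENNReal.ofReal (∫ x, f x ∂μ) ≤
      liminf (fun n => ENNReal.ofReal (∫ x, g n x ∂μ)) atTop := by
    simp only [e]
    rw [ofReal_integral_eq_lintegral_ofReal hf (Eventually.of_forall hf0)]
    refine le_trans (le_of_eq (lintegral_congr_ae ?_))
      (lintegral_liminf_le' fun n => (hg n).1.aemeasurable.ennreal_ofReal)
    filter_upwards [h] with p hp
    exact (((ENNReal.continuous_ofReal.tendsto _).comp hp).liminf_eq).symm
  have h2 : ENNReal.ofReal c < liminf (fun n => ENNReal.ofReal (∫ x, g n x ∂μ)) atTop :=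
    lt_of_lt_of_le ((ENNReal.ofReal_lt_ofReal_iff_of_nonneg hc0).2 hc) h1
  exact (eventually_lt_of_lt_liminf h2).mono fun n hn =>
    (ENNReal.ofReal_lt_ofReal_iff_of_nonneg hc0).1 hn

lemma eventually_quad_gt {f : ℝ → ℝ} {g : ℕ → ℝ → ℝ} (hf : SqInt f) (hg : ∀ n, SqInt (g n))
    (hf0 : ∀ x, 0 ≤ f x) (hg0 : ∀ n x, 0 ≤ g n x)
    (h : ∀ᵐ x, Tendsto (fun n => g n x) atTop (𝓝 (f x))) {c : ℝ} (hc : c < quad f) :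
    ∀ᶠ n in atTop, c < quad (g n) := by
  have e : ∀ n, quad (g n) = _ := fun n => form_eq_prod _ (hg n) (hg n)
  rw [quad, form_eq_prod _ hf hf] at hc
  simp only [e]
  exact eventually_lt_integral (integrable_form _ hf hf) (fun n => integrable_form _ (hg n) (hg n))
    (fun p => mul_nonneg (hf0 _) (hf0 _)) (fun n p => mul_nonneg (hg0 n _) (hg0 n _))
    ((ae_prod_add _ h).mono fun p hp => hp.1.mul hp.2) hc

lemma orl_of_bound {f : ℝ → ℝ} (hm : Measurable f) {R a : ℝ} (hR : ∀ x, |f x| ≤ R)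
    (ha : ∀ x, a < |x| → f x = 0) : Orl f := by
  refine (orl_indicator R a).mono hm fun x => ?_
  by_cases hx : x ∈ Icc (-a) a
  · rw [indicator_of_mem hx]
    exact (hR x).trans (le_abs_self R)
  · have : a < |x| := by
      by_contra! h
      exact hx (abs_le.1 h)
    rw [ha x this, abs_zero]
    exact abs_nonneg _

/-- The truncation of a function in range and domain. -/
def trunc (R : ℝ) (f : ℝ → ℝ) : ℝ → ℝ := (Icc (-R) R).indicator fun x => min (f x) R

lemma measurable_trunc (R : ℝ) {f : ℝ → ℝ} (hf : Measurable f) : Measurable (trunc R f) :=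
  (hf.min measurable_const).indicator measurableSet_Icc

lemma trunc_mem {R : ℝ} (hR : 0 ≤ R) {f : ℝ → ℝ} (hf : ∀ x, 0 ≤ f x) (x : ℝ) :
    0 ≤ trunc R f x ∧ trunc R f x ≤ R ∧ trunc R f x ≤ f x ∧ (R < |x| → trunc R f x = 0) := by
  by_cases hx : x ∈ Icc (-R) R
  · rw [trunc, indicator_of_mem hx]
    exact ⟨le_min (hf x) hR, min_le_right _ _, min_le_left _ _,
      fun h => absurd (abs_le.2 hx) (not_le.2 h)⟩
  · rw [trunc, indicator_of_notMem hx]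
    exact ⟨le_rfl, hR, hf x, fun _ => rfl⟩

variable {α : ℝ}

lemma exists_trunc (hα : 0 < α) {f : ℝ → ℝ} (hf : Orl f) (h0 : ∀ x, 0 ≤ f x) {c : ℝ}
    (hc : c < quad f) : ∃ (g : ℝ → ℝ) (R : ℝ), Measurable g ∧ 0 < R ∧ (∀ x, 0 ≤ g x) ∧
      (∀ x, g x ≤ R) ∧ (∀ x, R < |x| → g x = 0) ∧ modular α g ≤ modular α f ∧ c < quad g := by
  have hR : ∀ n : ℕ, (0 : ℝ) ≤ n := fun n => n.cast_nonneg
  have ho : ∀ n : ℕ, Orl (trunc n f) := fun n =>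
    hf.mono (measurable_trunc _ hf.measurable) fun x => by
      rw [abs_of_nonneg (trunc_mem (hR n) h0 x).1, abs_of_nonneg (h0 x)]
      exact (trunc_mem (hR n) h0 x).2.2.1
  have ht : ∀ x, Tendsto (fun n : ℕ => trunc n f x) atTop (𝓝 (f x)) := fun x => by
    refine tendsto_const_nhds.congr' ?_
    filter_upwards [tendsto_natCast_atTop_atTop.eventually_ge_atTop (max |x| (f x))] with n hn
    rw [trunc, indicator_of_mem (show x ∈ Icc (-(n : ℝ)) n from
      abs_le.1 ((le_max_left _ _).trans hn)),
      min_eq_left ((le_max_right _ _).trans hn)]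
  obtain ⟨n, hn, hn1⟩ := ((eventually_quad_gt hf.1 (fun n => (ho n).1) h0
    (fun n x => (trunc_mem (hR n) h0 x).1) (Eventually.of_forall ht) hc).and
    (eventually_ge_atTop 1)).exists
  refine ⟨trunc n f, n, (ho n).measurable, by exact_mod_cast hn1, fun x => (trunc_mem (hR n) h0 x).1,
    fun x => (trunc_mem (hR n) h0 x).2.1, fun x => (trunc_mem (hR n) h0 x).2.2.2, ?_, hn⟩
  exact modular_mono hα (ho n) hf fun x => by
    rw [abs_of_nonneg (trunc_mem (hR n) h0 x).1, abs_of_nonneg (h0 x)]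
    exact (trunc_mem (hR n) h0 x).2.2.1

/-- The step function with values `x i` on the cells `[i h, (i + 1) h)`. -/
def step (h : ℝ) (x : ℤ → ℝ) (t : ℝ) : ℝ := x ⌊t / h⌋

/-- The indicator function of a cell. -/
def cell (h : ℝ) (i : ℤ) : ℝ → ℝ := (Ico (i * h) ((i + 1) * h)).indicator fun _ => 1

lemma floor_div_eq_iff {h : ℝ} (hh : 0 < h) (t : ℝ) (i : ℤ) :
    ⌊t / h⌋ = i ↔ t ∈ Ico (i * h) ((i + 1) * h) := by
  rw [Int.floor_eq_iff, le_div_iff₀ hh, div_lt_iff₀ hh]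
  rfl

lemma cell_eq {h : ℝ} (hh : 0 < h) (i : ℤ) (t : ℝ) : cell h i t = if ⌊t / h⌋ = i then 1 else 0 := by
  simp only [cell, indicator, floor_div_eq_iff hh]

lemma measurable_cell (h : ℝ) (i : ℤ) : Measurable (cell h i) :=
  measurable_const.indicator measurableSet_Ico

lemma measurable_step (h : ℝ) (x : ℤ → ℝ) : Measurable (step h x) :=
  measurable_from_top.comp (Int.measurable_floor.comp (measurable_id.div_const h))

lemma integral_cell_mul {h : ℝ} (i : ℤ) (f : ℝ → ℝ) :
    ∫ t, cell h i t * f t = ∫ t in Ico (i * h) ((i + 1) * h), f t := by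
  rw [← integral_indicator measurableSet_Ico]
  refine integral_congr_ae (Eventually.of_forall fun t => ?_)
  by_cases ht : t ∈ Ico (i * h) ((i + 1) * h)
  · simp [cell, ht]
  · simp [cell, ht]

lemma integrable_cell_mul {h : ℝ} (i : ℤ) {f : ℝ → ℝ} (hf : Integrable f) :
    Integrable fun t => cell h i t * f t := by
  refine hf.bdd_mul (c := 1) (measurable_cell h i).aestronglyMeasurable
    (Eventually.of_forall fun t => ?_)
  by_cases ht : t ∈ Ico (i * h) ((i + 1) * h)
  · simp [cell, ht]
  · simp [cell, ht]

lemma integral_cell {h : ℝ} (hh : 0 < h) (i : ℤ) : ∫ t, cell h i t = h := by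
  rw [cell, integral_indicator measurableSet_Ico, setIntegral_const, Real.volume_real_Ico_of_le
    (by nlinarith)]
  simp only [smul_eq_mul]
  ring

lemma integrable_cell {h : ℝ} (i : ℤ) : Integrable (cell h i) :=
  (continuous_const.integrableOn_Icc.mono_set Ico_subset_Icc_self).integrable_indicator
    measurableSet_Ico

lemma comp_step_eq_sum {h : ℝ} (hh : 0 < h) {x : ℤ → ℝ} {F : Finset ℤ} (hx : ∀ i, i ∉ F → x i = 0)
    {Φ : ℝ → ℝ} (hΦ : Φ 0 = 0) (t : ℝ) :
    Φ (step h x t) = ∑ i ∈ F, Φ (x i) * cell h i t := by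
  simp_rw [cell_eq hh, mul_ite, mul_one, mul_zero, Finset.sum_ite_eq]
  split_ifs with h1
  · rfl
  · rw [step, hx _ h1, hΦ]

lemma modular_step (hα : 0 < α) {h : ℝ} (hh : 0 < h) {x : ℤ → ℝ} {F : Finset ℤ}
    (hx : ∀ i, i ∉ F → x i = 0) : modular α (step h x) = h * ∑ i ∈ F, young α (x i) := by
  rw [modular]
  simp_rw [comp_step_eq_sum hh hx (young_zero hα)]
  rw [integral_finsetSum _ fun i _ => (integrable_cell i).const_mul _]
  simp_rw [integral_const_mul, integral_cell hh]
  rw [← Finset.sum_mul, mul_comm]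

lemma orl_step {h : ℝ} (hh : 0 < h) {x : ℤ → ℝ} {F : Finset ℤ}
    (hx : ∀ i, i ∉ F → x i = 0) : Orl (step h x) := by
  have h1 := measurable_step h x
  refine ⟨⟨h1, ?_⟩, ?_⟩
  · simp_rw [comp_step_eq_sum hh hx (Φ := fun t => t ^ 2) (by norm_num)]
    exact integrable_finsetSum _ fun i _ => (integrable_cell i).const_mul _
  · simp_rw [comp_step_eq_sum hh hx (Φ := fun t => |t| ^ 3) (by norm_num)]
    exact integrable_finsetSum _ fun i _ => (integrable_cell i).const_mul _

/-- The averages of a function over the cells. -/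
def cellAvg (h : ℝ) (f : ℝ → ℝ) (i : ℤ) : ℝ := h⁻¹ * ∫ t, cell h i t * f t

lemma cellAvg_eq_average {h : ℝ} (hh : 0 < h) (f : ℝ → ℝ) (i : ℤ) :
    cellAvg h f i = ⨍ t in Metric.closedBall ((i + 1 / 2) * h) (h / 2), f t := by
  have h1 : Metric.closedBall (((i : ℝ) + 1 / 2) * h) (h / 2) = Icc (i * h) ((i + 1) * h) := by
    rw [Real.closedBall_eq_Icc]
    congr 1 <;> ring
  rw [cellAvg, integral_cell_mul, h1, setAverage_eq, setIntegral_congr_set Ico_ae_eq_Icc,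
    Real.volume_real_Icc_of_le (by nlinarith), smul_eq_mul]
  congr 2
  ring

/-- Lebesgue differentiation. The cells contain `t` without being centred there, hence the version
with non-centred balls. -/
lemma tendsto_step_cellAvg {f : ℝ → ℝ} (hf : Integrable f) :
    ∀ᵐ t, Tendsto (fun n : ℕ => step (1 / ((n : ℝ) + 1)) (cellAvg (1 / ((n : ℝ) + 1)) f) t) atTop
      (𝓝 (f t)) := by
  filter_upwards [IsUnifLocDoublingMeasure.ae_tendsto_average (μ := volume)
    hf.locallyIntegrable 1] with t ht
  have hp : ∀ n : ℕ, (0 : ℝ) < 1 / ((n : ℝ) + 1) := fun n => by positivity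
  have h0 : Tendsto (fun n : ℕ => 1 / ((n : ℝ) + 1) / 2) atTop (𝓝[>] 0) := by
    refine tendsto_nhdsWithin_iff.2 ⟨?_, Eventually.of_forall fun n => half_pos (hp n)⟩
    simpa using tendsto_one_div_add_atTop_nhds_zero_nat.div_const (2 : ℝ)
  have h1 := ht (fun n : ℕ => (((⌊t / (1 / ((n : ℝ) + 1))⌋ : ℤ) : ℝ) + 1 / 2) * (1 / ((n : ℝ) + 1)))
    (fun n : ℕ => 1 / ((n : ℝ) + 1) / 2) h0 (Eventually.of_forall fun n => by
      have h2 := (floor_div_eq_iff (hp n) t _).1 rfl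
      rw [Real.closedBall_eq_Icc]
      constructor <;> linarith [h2.1, h2.2])
  refine h1.congr fun n => ?_
  rw [step, cellAvg_eq_average (hp n)]

/-- Jensen's inequality on each cell, using the tangent line of `young` at the average. -/
lemma sum_young_cellAvg_le (hα : 0 < α) {h : ℝ} (hh : 0 < h) {f : ℝ → ℝ} (hf : Orl f)
    (hfi : Integrable f) (F : Finset ℤ) :
    h * ∑ i ∈ F, young α (cellAvg h f i) ≤ modular α f := by
  have hi := hf.integrable_young hα
  have h1 : ∀ i, h * young α (cellAvg h f i) ≤ ∫ t, cell h i t * young α (f t) := fun i => by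
    set a := cellAvg h f i with ha
    have ha' : ∫ t, cell h i t * f t = h * a := by
      rw [ha, cellAvg, mul_inv_cancel_left₀ hh.ne']
    have h2 : ∫ t, ((young α a - dyoung α a * a) * cell h i t + dyoung α a * (cell h i t * f t)) =
        h * young α a := by
      rw [integral_add ((integrable_cell i).const_mul _) ((integrable_cell_mul i hfi).const_mul _),
        integral_const_mul, integral_const_mul, integral_cell hh, ha']
      ring
    rw [← h2]
    refine integral_mono (((integrable_cell i).const_mul _).add
      ((integrable_cell_mul i hfi).const_mul _)) (integrable_cell_mul i hi) fun t => ?_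
    have h3 := young_tangent hα a (f t)
    simp only
    rw [cell_eq hh]
    split_ifs
    · linarith
    · simp
  rw [Finset.mul_sum]
  refine (Finset.sum_le_sum fun i _ => h1 i).trans ?_
  rw [← integral_finsetSum _ fun i _ => integrable_cell_mul i hi]
  refine integral_mono (integrable_finsetSum _ fun i _ => integrable_cell_mul i hi) hi fun t => ?_
  simp only
  rw [← Finset.sum_mul]
  simp_rw [cell_eq hh, Finset.sum_ite_eq]
  split_ifs
  · rw [one_mul]
  · rw [zero_mul]
    exact young_nonneg hα _

/-- The requirement `2 h Ψ(R) ≤ ε` pays for the symmetrisation error in `modular_step_abs_le`. -/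
lemma exists_step (hα : 0 < α) {f : ℝ → ℝ} (hf : Orl f) (h0 : ∀ x, 0 ≤ f x) {c ε : ℝ}
    (hc : c < quad f) (hε : 0 < ε) : ∃ (R h : ℝ) (N : ℕ) (x : ℤ → ℝ), 0 < R ∧ 0 < h ∧
      2 * h * young α R ≤ ε ∧ (∀ i, 0 ≤ x i) ∧ (∀ i, x i ≤ R) ∧
      (∀ i, i ∉ Finset.Icc (-N : ℤ) N → x i = 0) ∧
      h * ∑ i ∈ Finset.Icc (-N : ℤ) N, young α (x i) ≤ modular α f ∧ c < quad (step h x) := by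
  obtain ⟨g, R, hg, hR, g0, gR, gs, gM, gq⟩ := exists_trunc hα hf h0 hc
  have go : Orl g := orl_of_bound hg (fun x => by rw [abs_of_nonneg (g0 x)]; exact gR x) gs
  have gi : Integrable g := by
    refine ((continuous_const (y := R)).integrableOn_Icc.integrable_indicator
      (measurableSet_Icc (a := -R) (b := R))).mono' hg.aestronglyMeasurable
      (Eventually.of_forall fun x => ?_)
    rw [Real.norm_of_nonneg (g0 x)]
    by_cases hx : x ∈ Icc (-R) R
    · rw [indicator_of_mem hx]
      exact gR x
    · rw [indicator_of_notMem hx, gs x]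
      by_contra! h
      exact hx (abs_le.1 h)
  have hx0 : ∀ h : ℝ, 0 < h → ∀ i, 0 ≤ cellAvg h g i := fun h hh i => by
    refine mul_nonneg (inv_nonneg.2 hh.le) (integral_nonneg fun t => mul_nonneg ?_ (g0 t))
    rw [cell_eq hh]
    split_ifs <;> norm_num
  have hxR : ∀ h : ℝ, 0 < h → ∀ i, cellAvg h g i ≤ R := fun h hh i => by
    rw [cellAvg, inv_mul_le_iff₀ hh, mul_comm]
    nth_rw 2 [← integral_cell hh i]
    rw [← integral_const_mul]
    refine integral_mono (integrable_cell_mul i gi) ((integrable_cell i).const_mul R) fun t => ?_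
    simp only
    rw [cell_eq hh]
    split_ifs
    · simpa using gR t
    · simp
  have hxs : ∀ h : ℝ, 0 < h → ∀ i, i ∉ Finset.Icc (-(⌈R / h⌉₊ + 1 : ℕ) : ℤ) (⌈R / h⌉₊ + 1 : ℕ) →
      cellAvg h g i = 0 := fun h hh i hi => by
    have hN := Nat.le_ceil (R / h)
    rw [div_le_iff₀ hh] at hN
    set N := ⌈R / h⌉₊
    rw [cellAvg, integral_congr_ae (g := fun _ => 0), integral_zero, mul_zero]
    refine Eventually.of_forall fun t => ?_
    simp only
    by_cases ht : ⌊t / h⌋ = i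
    · rw [gs t, mul_zero]
      have h2 := (floor_div_eq_iff hh t i).1 ht
      rw [Finset.mem_Icc, not_and_or, not_le, not_le] at hi
      rcases hi with hi | hi
      · have h3 : (i : ℝ) + 1 ≤ -((N : ℝ) + 1) := by exact_mod_cast hi
        have h4 := h2.2
        rw [lt_abs]
        right
        nlinarith
      · have h3 : (N : ℝ) + 1 < i := by exact_mod_cast hi
        have h4 := h2.1
        rw [lt_abs]
        left
        nlinarith
    · rw [cell_eq hh, if_neg ht, zero_mul]
  have hp : ∀ n : ℕ, (0 : ℝ) < 1 / ((n : ℝ) + 1) := fun n => by positivity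
  have hlim : Tendsto (fun n : ℕ => 2 * (1 / ((n : ℝ) + 1)) * young α R) atTop (𝓝 0) := by
    simpa using (tendsto_one_div_add_atTop_nhds_zero_nat.const_mul (2 : ℝ)).mul_const (young α R)
  obtain ⟨n, hn, hn2⟩ := ((eventually_quad_gt go.1
    (fun n => (orl_step (hp n) (hxs _ (hp n))).1) g0 (fun n t => hx0 _ (hp n) _)
    (tendsto_step_cellAvg gi) gq).and (hlim.eventually_le_const hε)).exists
  exact ⟨R, _, _, cellAvg (1 / ((n : ℝ) + 1)) g, hR, hp n, hn2, hx0 _ (hp n), hxR _ (hp n),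
    hxs _ (hp n), (sum_young_cellAvg_le hα (hp n) go gi _).trans gM, hn⟩

end

/-! ### Discrete rearrangement by polarization -/

section

/-- The interaction of two cells at distance `n`. -/
def interaction (h : ℝ) (n : ℕ) : ℝ := ∫ u, max (h - |u + n * h|) 0 ∂kap (1 / 2)

lemma corr_cell {h : ℝ} (i j : ℤ) (u : ℝ) :
    corr (cell h i) (cell h j) u = max (h - |u + ((i - j : ℤ) : ℝ) * h|) 0 := by
  have h1 : (fun x => cell h i x * cell h j (x + u)) =
      (Ico (max (i * h) (j * h - u)) (min ((i + 1) * h) ((j + 1) * h - u))).indicator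
        fun _ => (1 : ℝ) := by
    funext x
    have h1 : cell h j (x + u) =
        (Ico (j * h - u) ((j + 1) * h - u)).indicator (fun _ : ℝ => (1 : ℝ)) x := by
      simp only [cell, indicator, mem_Ico, sub_le_iff_le_add, lt_sub_iff_add_lt]
    rw [h1, ← Ico_inter_Ico, cell, ← inter_indicator_mul, mul_one]
  rw [corr, h1, integral_indicator measurableSet_Ico, setIntegral_const, Real.volume_real_Ico,
    smul_eq_mul, mul_one]
  congr 1
  push_cast
  rcases le_total (j * h - u) (i * h) with h2 | h2
  · rw [max_eq_left h2, min_eq_right (by linarith), abs_of_nonneg (by linarith)]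
    ring
  · rw [max_eq_right h2, min_eq_left (by linarith), abs_of_nonpos (by linarith)]
    ring

lemma sqInt_cell (h : ℝ) (i : ℤ) : SqInt (cell h i) := by
  refine ⟨measurable_cell h i, (integrable_cell (h := h) i).congr (Eventually.of_forall fun t => ?_)⟩
  by_cases ht : t ∈ Ico (i * h) ((i + 1) * h) <;> simp [cell, ht]

lemma form_cell {h : ℝ} (i j : ℤ) :
    form (kap (1 / 2)) (cell h i) (cell h j) = interaction h (i - j).natAbs := by
  rw [form]
  simp_rw [corr_cell, interaction]
  rcases Int.natAbs_eq (i - j) with h1 | h1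
  · nth_rw 1 [h1]
    simp
  · nth_rw 1 [h1]
    rw [← (measurePreserving_neg_kap (1 / 2)).integral_comp
      (MeasurableEquiv.neg ℝ).measurableEmbedding]
    refine integral_congr_ae (Eventually.of_forall fun u => ?_)
    simp only [Int.cast_neg, Int.cast_natCast]
    rw [← abs_neg]
    congr 3
    ring

/-- The interaction is the correlation of the bell-shaped kernel with a tent function. -/
lemma interaction_anti {h : ℝ} (hh : 0 < h) : Antitone (interaction h) := by
  have hb : Bell fun u => max (h - |u|) 0 :=
    ⟨fun u => le_max_right _ _, fun x y _ hxy => max_le_max_right 0 (by linarith)⟩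
  have hc : Continuous fun u : ℝ => max (h - |u|) 0 := by fun_prop
  have e : ∀ n : ℕ, interaction h n = corr (dens (1 / 2)) (fun u => max (h - |u|) 0) (n * h) :=
    fun n => by
      rw [interaction, integral_kap, corr]
      simp_rw [smul_eq_mul]
  intro m n hmn
  rw [e, e]
  refine (bell_dens (by norm_num)).corr_anti hb (fun u => ?_) ?_
  · refine (integrable_dens (by norm_num)).mul_bdd (c := h)
      (hc.comp (continuous_add_const u)).aestronglyMeasurable (Eventually.of_forall fun t => ?_)
    rw [Real.norm_of_nonneg (le_max_right _ _)]
    exact max_le (by linarith [abs_nonneg (t + u)]) hh.le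
  · rw [abs_of_nonneg (by positivity), abs_of_nonneg (by positivity)]
    exact mul_le_mul_of_nonneg_right (by exact_mod_cast hmn) hh.le

/-- A discrete convolution quadratic form. -/
def dform (c : ℕ → ℝ) (F : Finset ℤ) (x : ℤ → ℝ) : ℝ :=
  ∑ i ∈ F, ∑ j ∈ F, x i * x j * c (i - j).natAbs

lemma quad_step {h : ℝ} (hh : 0 < h) {x : ℤ → ℝ} {F : Finset ℤ} (hx : ∀ i, i ∉ F → x i = 0) :
    quad (step h x) = dform (interaction h) F x := by
  have hs := orl_step hh hx
  have e : step h x = fun t => ∑ i ∈ F, x i * cell h i t :=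
    funext (comp_step_eq_sum hh hx (Φ := fun t => t) rfl)
  rw [quad, form_eq_prod _ hs.1 hs.1, e, dform]
  have hI : ∀ i j, Integrable (fun p : ℝ × ℝ => x i * x j * (cell h i p.2 * cell h j (p.2 + p.1)))
      ((kap (1 / 2)).prod volume) := fun i j =>
    (integrable_form _ (sqInt_cell h i) (sqInt_cell h j)).const_mul _
  simp_rw [Finset.sum_mul_sum, mul_mul_mul_comm]
  rw [integral_finsetSum _ fun i _ => integrable_finsetSum _ fun j _ => hI i j]
  refine Finset.sum_congr rfl fun i _ => ?_
  rw [integral_finsetSum _ fun j _ => hI i j]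
  refine Finset.sum_congr rfl fun j _ => ?_
  rw [integral_const_mul, ← form_eq_prod _ (sqInt_cell h i) (sqInt_cell h j), form_cell]

lemma max_min_rearrangement {A B : ℝ} (h : B ≤ A) (a a' b b' : ℝ) :
    A * (a * b + a' * b') + B * (a' * b + a * b') ≤
      A * (max a a' * max b b' + min a a' * min b b') +
        B * (min a a' * max b b' + max a a' * min b b') := by
  rcases le_total a a' with h1 | h1 <;> rcases le_total b b' with h2 | h2
  · rw [max_eq_right h1, min_eq_left h1, max_eq_right h2, min_eq_left h2]
    linarith
  · rw [max_eq_right h1, min_eq_left h1, max_eq_left h2, min_eq_right h2]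
    nlinarith [mul_nonneg (sub_nonneg.2 h) (mul_nonneg (sub_nonneg.2 h1) (sub_nonneg.2 h2))]
  · rw [max_eq_left h1, min_eq_right h1, max_eq_right h2, min_eq_left h2]
    nlinarith [mul_nonneg (sub_nonneg.2 h) (mul_nonneg (sub_nonneg.2 h1) (sub_nonneg.2 h2))]
  · rw [max_eq_left h1, min_eq_right h1, max_eq_left h2, min_eq_right h2]

/-- The polarization of `x` with respect to the reflection `i ↦ p - i`; the larger value goes to
the side `G`. -/
def polar (p : ℤ) (G : ℤ → Prop) [DecidablePred G] (x : ℤ → ℝ) (i : ℤ) : ℝ :=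
  if G i then max (x i) (x (p - i)) else min (x i) (x (p - i))

lemma sum_sub_left {p : ℤ} {F : Finset ℤ} (hF : ∀ i ∈ F, p - i ∈ F) (g : ℤ → ℝ) :
    ∑ i ∈ F, g (p - i) = ∑ i ∈ F, g i :=
  Finset.sum_nbij' (fun i => p - i) (fun i => p - i) hF hF (fun i _ => sub_sub_cancel p i)
    (fun i _ => sub_sub_cancel p i) fun _ _ => rfl

section Polar

variable {p : ℤ} {G : ℤ → Prop} [DecidablePred G] {F : Finset ℤ} (hF : ∀ i ∈ F, p - i ∈ F)
  (hG : ∀ i, p - i = i ∨ (G (p - i) ↔ ¬ G i))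

include hG in
lemma polar_of_pos (x : ℤ → ℝ) {i : ℤ} (h : G i) :
    polar p G x i = max (x i) (x (p - i)) ∧ polar p G x (p - i) = min (x i) (x (p - i)) := by
  refine ⟨if_pos h, ?_⟩
  rcases hG i with h1 | h1
  · rw [h1, polar, if_pos h, h1, max_self, min_self]
  · rw [polar, if_neg (by tauto), sub_sub_cancel, min_comm]

include hG in
lemma polar_of_neg (x : ℤ → ℝ) {i : ℤ} (h : ¬ G i) :
    polar p G x i = min (x i) (x (p - i)) ∧ polar p G x (p - i) = max (x i) (x (p - i)) := by
  refine ⟨if_neg h, ?_⟩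
  rcases hG i with h1 | h1
  · rw [h1, polar, if_neg h, h1, max_self, min_self]
  · rw [polar, if_pos (by tauto), sub_sub_cancel, max_comm]

include hF hG in
lemma sum_polar (x : ℤ → ℝ) (g : ℝ → ℝ) : ∑ i ∈ F, g (polar p G x i) = ∑ i ∈ F, g (x i) := by
  have h1 := sum_sub_left hF fun i => g (polar p G x i)
  have h2 := sum_sub_left hF fun i => g (x i)
  have h3 : ∑ i ∈ F, (g (polar p G x i) + g (polar p G x (p - i))) =
      ∑ i ∈ F, (g (x i) + g (x (p - i))) := by
    refine Finset.sum_congr rfl fun i _ => ?_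
    by_cases h : G i
    · rw [(polar_of_pos hG x h).1, (polar_of_pos hG x h).2]
      rcases le_total (x i) (x (p - i)) with h4 | h4
      · rw [max_eq_right h4, min_eq_left h4, add_comm]
      · rw [max_eq_left h4, min_eq_right h4]
    · rw [(polar_of_neg hG x h).1, (polar_of_neg hG x h).2]
      rcases le_total (x i) (x (p - i)) with h4 | h4
      · rw [max_eq_right h4, min_eq_left h4]
      · rw [max_eq_left h4, min_eq_right h4, add_comm]
  rw [Finset.sum_add_distrib, Finset.sum_add_distrib] at h3
  linarith

include hF in
-- Symmetrising in both indices collects the four pairings of `{i, p - i}` with `{j, p - j}`, the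
-- configuration of `max_min_rearrangement`.
lemma four_mul_dform (c : ℕ → ℝ) (x : ℤ → ℝ) : 4 * dform c F x = ∑ i ∈ F, ∑ j ∈ F,
    (c (i - j).natAbs * (x i * x j + x (p - i) * x (p - j)) +
      c (p - i - j).natAbs * (x (p - i) * x j + x i * x (p - j))) := by
  have e1 : ∑ i ∈ F, ∑ j ∈ F, c (i - j).natAbs * (x (p - i) * x (p - j)) = dform c F x := by
    symm
    rw [dform, ← sum_sub_left hF]
    refine Finset.sum_congr rfl fun i _ => ?_
    rw [← sum_sub_left hF]
    refine Finset.sum_congr rfl fun j _ => ?_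
    rw [show p - i - (p - j) = -(i - j) by ring, Int.natAbs_neg]
    ring
  have e2 : ∑ i ∈ F, ∑ j ∈ F, c (p - i - j).natAbs * (x (p - i) * x j) = dform c F x := by
    symm
    rw [dform, ← sum_sub_left hF]
    refine Finset.sum_congr rfl fun i _ => Finset.sum_congr rfl fun j _ => ?_
    ring
  have e3 : ∑ i ∈ F, ∑ j ∈ F, c (p - i - j).natAbs * (x i * x (p - j)) = dform c F x := by
    symm
    rw [dform]
    refine Finset.sum_congr rfl fun i _ => ?_
    rw [← sum_sub_left hF]
    refine Finset.sum_congr rfl fun j _ => ?_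
    rw [show i - (p - j) = -(p - i - j) by ring, Int.natAbs_neg]
    ring
  have e0 : ∑ i ∈ F, ∑ j ∈ F, c (i - j).natAbs * (x i * x j) = dform c F x := by
    rw [dform]
    refine Finset.sum_congr rfl fun i _ => Finset.sum_congr rfl fun j _ => ?_
    ring
  simp_rw [mul_add, Finset.sum_add_distrib]
  rw [e0, e1, e2, e3]
  ring

include hF hG in
lemma dform_le_polar {c : ℕ → ℝ} (hc : Antitone c)
    (h1 : ∀ i j, (G i ↔ G j) → (i - j).natAbs ≤ (p - i - j).natAbs)
    (h2 : ∀ i j, ¬ (G i ↔ G j) → (p - i - j).natAbs ≤ (i - j).natAbs) (x : ℤ → ℝ) :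
    dform c F x ≤ dform c F (polar p G x) := by
  have key : 4 * dform c F x ≤ 4 * dform c F (polar p G x) := by
    rw [four_mul_dform hF, four_mul_dform hF]
    refine Finset.sum_le_sum fun i _ => Finset.sum_le_sum fun j _ => ?_
    by_cases hi : G i <;> by_cases hj : G j
    · rw [(polar_of_pos hG x hi).1, (polar_of_pos hG x hi).2, (polar_of_pos hG x hj).1,
        (polar_of_pos hG x hj).2]
      exact max_min_rearrangement (hc (h1 i j (by tauto))) _ _ _ _
    · rw [(polar_of_pos hG x hi).1, (polar_of_pos hG x hi).2, (polar_of_neg hG x hj).1,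
        (polar_of_neg hG x hj).2]
      have := max_min_rearrangement (hc (h2 i j (by tauto))) (x i) (x (p - i)) (x (p - j)) (x j)
      rw [max_comm (x (p - j)), min_comm (x (p - j))] at this
      linarith
    · rw [(polar_of_neg hG x hi).1, (polar_of_neg hG x hi).2, (polar_of_pos hG x hj).1,
        (polar_of_pos hG x hj).2]
      have := max_min_rearrangement (hc (h2 i j (by tauto))) (x (p - i)) (x i) (x j) (x (p - j))
      rw [max_comm (x (p - i)), min_comm (x (p - i))] at this
      linarith
    · rw [(polar_of_neg hG x hi).1, (polar_of_neg hG x hi).2, (polar_of_neg hG x hj).1,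
        (polar_of_neg hG x hj).2]
      have := max_min_rearrangement (hc (h1 i j (by tauto))) (x (p - i)) (x i) (x (p - j)) (x j)
      rw [max_comm (x (p - i)), min_comm (x (p - i)), max_comm (x (p - j)),
        min_comm (x (p - j))] at this
      linarith
  linarith

include hF hG in
-- Polarization moves larger values to the side of smaller weight, so it lowers the weighted sum
-- strictly unless the sequence is already polarized.
lemma le_of_weight_le {w : ℤ → ℝ} (hw : ∀ i, G i → p - i = i ∨ w i < w (p - i))
    {x : ℤ → ℝ} (h : ∑ i ∈ F, w i * x i ≤ ∑ i ∈ F, w i * polar p G x i) {i : ℤ} (hi : G i)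
    (hiF : i ∈ F) : x (p - i) ≤ x i := by
  set y := polar p G x with hy
  have hsum : ∀ i, x i + x (p - i) = y i + y (p - i) := fun i => by
    by_cases h : G i
    · rw [hy, (polar_of_pos hG x h).1, (polar_of_pos hG x h).2, max_add_min]
    · rw [hy, (polar_of_neg hG x h).1, (polar_of_neg hG x h).2, min_add_max]
  have hnn : ∀ i, 0 ≤ (w i - w (p - i)) * (x i - y i) := fun i => by
    by_cases h : G i
    · have h1 : x i ≤ y i := by rw [hy, (polar_of_pos hG x h).1]; exact le_max_left _ _
      rcases hw i h with h2 | h2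
      · rw [h2, sub_self, zero_mul]
      · exact mul_nonneg_of_nonpos_of_nonpos (by linarith) (by linarith)
    · have h1 : y i ≤ x i := by rw [hy, (polar_of_neg hG x h).1]; exact min_le_left _ _
      rcases hG i with h2 | h2
      · rw [h2, sub_self, zero_mul]
      · rcases hw (p - i) (h2.2 h) with h3 | h3
        · rw [sub_sub_cancel] at h3
          rw [← h3, sub_self, zero_mul]
        · rw [sub_sub_cancel] at h3
          exact mul_nonneg (by linarith) (by linarith)
  have e : ∑ i ∈ F, (w i - w (p - i)) * (x i - y i) =
      2 * (∑ i ∈ F, w i * x i - ∑ i ∈ F, w i * y i) := by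
    have e1 := sum_sub_left hF fun i => w i * (x i - y i)
    have e2 : ∑ i ∈ F, (w i - w (p - i)) * (x i - y i) =
        ∑ i ∈ F, w i * (x i - y i) + ∑ i ∈ F, w (p - i) * (x (p - i) - y (p - i)) := by
      rw [← Finset.sum_add_distrib]
      refine Finset.sum_congr rfl fun i _ => ?_
      have := hsum i
      rw [show x (p - i) - y (p - i) = -(x i - y i) by linarith]
      ring
    rw [e2, e1]
    simp_rw [mul_sub, Finset.sum_sub_distrib]
    ring
  have h0 := (Finset.sum_eq_zero_iff_of_nonneg fun i _ => hnn i).1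
    (le_antisymm (by linarith) (Finset.sum_nonneg fun i _ => hnn i)) i hiF
  rcases hw i hi with h2 | h2
  · rw [h2]
  · have h3 : x i = y i := by
      rcases mul_eq_zero.1 h0 with h4 | h4 <;> linarith
    rw [h3, hy, (polar_of_pos hG x hi).1]
    exact le_max_right _ _

end Polar

lemma sum_congr_support {x : ℤ → ℝ} {F F' : Finset ℤ} (hFF : F ⊆ F') (hx : ∀ i, i ∉ F → x i = 0)
    {g : ℤ → ℝ → ℝ} (hg : ∀ i, g i 0 = 0) : ∑ i ∈ F, g i (x i) = ∑ i ∈ F', g i (x i) :=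
  Finset.sum_subset hFF fun i _ hi => by rw [hx i hi, hg]

lemma dform_congr_support (c : ℕ → ℝ) {x : ℤ → ℝ} {F F' : Finset ℤ} (hFF : F ⊆ F')
    (hx : ∀ i, i ∉ F → x i = 0) : dform c F x = dform c F' x := by
  rw [dform, dform]
  refine (sum_congr_support hFF hx (g := fun i t => ∑ j ∈ F, t * x j * c (i - j).natAbs)
    fun i => by simp).trans (Finset.sum_congr rfl fun i _ => ?_)
  exact sum_congr_support hFF hx (g := fun j t => x i * t * c (i - j).natAbs) fun j => by simp

/-- No polarizations are iterated. Among the maximizers of the form on a compact set, take one of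
minimal weight `∑ |4i - 1| z i`; this weight orders the cells as `0, 1, -1, 2, -2, …`. A
polarization keeps the constraint and does not decrease the form, so it cannot lower the weight, and
the minimizer is already polarized for both reflections. -/
lemma exists_sorted {c : ℕ → ℝ} (hc : Antitone c) {Ψ : ℝ → ℝ} (hΨ : Continuous Ψ) (hΨ0 : Ψ 0 = 0)
    {N : ℕ} {R : ℝ} {x : ℤ → ℝ} (hx0 : ∀ i, 0 ≤ x i) (hxR : ∀ i, x i ≤ R)
    (hxF : ∀ i, i ∉ Finset.Icc (-N : ℤ) N → x i = 0) :
    ∃ z : ℤ → ℝ, (∀ i, 0 ≤ z i) ∧ (∀ i, z i ≤ R) ∧ (∀ i, i ∉ Finset.Icc (-N : ℤ) N → z i = 0) ∧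
      ∑ i ∈ Finset.Icc (-N : ℤ) N, Ψ (z i) ≤ ∑ i ∈ Finset.Icc (-N : ℤ) N, Ψ (x i) ∧
      dform c (Finset.Icc (-N : ℤ) N) x ≤ dform c (Finset.Icc (-N : ℤ) N) z ∧
      ∀ i, 0 < i → z (-i) ≤ z i ∧ z i ≤ z (1 - i) := by
  set F := Finset.Icc (-N : ℤ) N with hFdef
  have hR : 0 ≤ R := (hx0 0).trans (hxR 0)
  set m := ∑ i ∈ F, Ψ (x i)
  set S : Set (ℤ → ℝ) := (univ.pi fun i => Icc 0 (if i ∈ F then R else 0)) ∩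
    {z | ∑ i ∈ F, Ψ (z i) ≤ m} with hS
  have hSc : IsCompact S :=
    (isCompact_univ_pi fun i => isCompact_Icc).inter_right
      (isClosed_le (by fun_prop) continuous_const)
  have hQ : Continuous (dform c F) := by unfold dform; fun_prop
  have hmem : ∀ z, z ∈ S ↔ (∀ i, 0 ≤ z i) ∧ (∀ i, z i ≤ R) ∧ (∀ i, i ∉ F → z i = 0) ∧
      ∑ i ∈ F, Ψ (z i) ≤ m := by
    intro z
    constructor
    · rintro ⟨h1, h2⟩
      have h3 : ∀ i, z i ∈ Icc 0 (if i ∈ F then R else 0) := fun i => h1 i (mem_univ i)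
      refine ⟨fun i => (h3 i).1, fun i => (h3 i).2.trans ?_, fun i hi => ?_, h2⟩
      · split_ifs <;> simp [hR]
      · have := h3 i
        rw [if_neg hi] at this
        exact le_antisymm this.2 this.1
    · rintro ⟨h1, h2, h3, h4⟩
      refine ⟨fun i _ => ⟨h1 i, ?_⟩, h4⟩
      split_ifs with h
      · exact h2 i
      · exact (h3 i h).le
  obtain ⟨z₀, hz₀, hmax⟩ := hSc.exists_isMaxOn ⟨x, (hmem x).2 ⟨hx0, hxR, hxF, le_rfl⟩⟩
    hQ.continuousOn
  set w : ℤ → ℝ := fun i => ((4 * i - 1).natAbs : ℝ) with hw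
  obtain ⟨z, hz, hmin⟩ := (hSc.inter_right (isClosed_le (continuous_const (y := dform c F z₀))
    hQ)).exists_isMinOn ⟨z₀, hz₀, le_refl (dform c F z₀)⟩
    (f := fun z => ∑ i ∈ F, w i * z i) (by fun_prop)
  obtain ⟨hzS, hzQ⟩ := hz
  obtain ⟨h1, h2, h3, h4⟩ := (hmem z).1 hzS
  have hout : ∀ {p : ℤ} {G : ℤ → Prop} [DecidablePred G] {F' : Finset ℤ}, F ⊆ F' →
      (∀ i ∈ F', p - i ∈ F') → (∀ i, p - i = i ∨ (G (p - i) ↔ ¬ G i)) →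
      (∀ i j, (G i ↔ G j) → (i - j).natAbs ≤ (p - i - j).natAbs) →
      (∀ i j, ¬ (G i ↔ G j) → (p - i - j).natAbs ≤ (i - j).natAbs) →
      (∀ i, G i → p - i = i ∨ w i < w (p - i)) →
      (∀ i, i ∉ F → polar p G z i = 0) → ∀ i, G i → i ∈ F' → z (p - i) ≤ z i := by
    intro p G _ F' hFF hF' hG g1 g2 hwG hsupp i hi hiF
    set y := polar p G z with hy
    have hyS : y ∈ S := by
      refine (hmem y).2 ⟨fun i => ?_, fun i => ?_, hsupp, ?_⟩
      · rw [hy, polar]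
        split_ifs
        · exact le_max_of_le_left (h1 i)
        · exact le_min (h1 _) (h1 _)
      · rw [hy, polar]
        split_ifs
        · exact max_le (h2 _) (h2 _)
        · exact min_le_of_left_le (h2 _)
      · rw [sum_congr_support hFF hsupp (g := fun _ => Ψ) fun _ => hΨ0, hy, sum_polar hF' hG z Ψ,
          ← sum_congr_support hFF h3 (g := fun _ => Ψ) fun _ => hΨ0]
        exact h4
    have hyQ : dform c F z₀ ≤ dform c F y := by
      refine hzQ.trans ?_
      rw [dform_congr_support c hFF h3, dform_congr_support c hFF hsupp]
      exact dform_le_polar hF' hG hc g1 g2 z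
    have hyw : ∑ i ∈ F, w i * z i ≤ ∑ i ∈ F, w i * y i := hmin ⟨hyS, hyQ⟩
    rw [sum_congr_support hFF h3 (g := fun i t => w i * t) fun _ => mul_zero _,
      sum_congr_support hFF hsupp (g := fun i t => w i * t) fun _ => mul_zero _] at hyw
    exact le_of_weight_le hF' hG hwG hyw hi hiF
  refine ⟨z, h1, h2, h3, h4, (hmax ((hmem x).2 ⟨hx0, hxR, hxF, le_rfl⟩)).trans hzQ, fun i hi => ?_⟩
  have hwlt : ∀ i j : ℤ, (4 * i - 1).natAbs < (4 * j - 1).natAbs → w i < w j := fun i j h => by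
    exact Nat.cast_lt.2 h
  by_cases hiF : i ∈ F
  · rw [hFdef, Finset.mem_Icc] at hiF
    constructor
    -- Reflection `i ↦ -i`, favouring the nonnegative side.
    · have := hout (p := 0) (G := fun i => 0 ≤ i) (F' := F) subset_rfl
        (fun i hi => by rw [hFdef, Finset.mem_Icc] at hi ⊢; omega) (fun i => by omega)
        (fun i j h => by omega) (fun i j h => by omega)
        (fun i hi => by
          rcases eq_or_ne i 0 with rfl | h0
          · left; rfl
          · exact Or.inr (hwlt _ _ (by omega)))
        (fun i hi => by
          have hi' : 0 - i ∉ F := by rw [hFdef, Finset.mem_Icc] at hi ⊢; omega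
          rw [polar, h3 i hi, h3 _ hi', max_self, min_self, ite_self])
        i hi.le (by rw [hFdef, Finset.mem_Icc]; omega)
      rwa [zero_sub] at this
    -- Reflection `i ↦ 1 - i`, favouring `i ≤ 0`. The window is enlarged by one cell to be
    -- invariant; the extra cell receives a minimum with `0`, so the support does not grow.
    · have := hout (p := 1) (G := fun i => i ≤ 0) (F' := Finset.Icc (-N : ℤ) (N + 1))
        (Finset.Icc_subset_Icc le_rfl (by omega))
        (fun i hi => by rw [Finset.mem_Icc] at hi ⊢; omega) (fun i => by omega)
        (fun i j h => by omega) (fun i j h => by omega)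
        (fun i hi => Or.inr (hwlt _ _ (by omega)))
        (fun i hi => by
          by_cases hi' : 1 - i ∈ F
          · have h0 : ¬ i ≤ 0 := by rw [hFdef, Finset.mem_Icc] at hi hi'; omega
            rw [polar, if_neg h0, h3 i hi, min_eq_left (h1 _)]
          · rw [polar, h3 i hi, h3 _ hi', max_self, min_self, ite_self])
        (1 - i) (by omega) (by rw [Finset.mem_Icc]; omega)
      rwa [sub_sub_cancel] at this
  · rw [h3 i hiF, h3 (-i) (by rw [hFdef, Finset.mem_Icc] at hiF ⊢; omega)]
    exact ⟨le_rfl, h1 _⟩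

end

/-! ### From sorted sequences to bell-shaped functions -/

section

section Sorted

variable {z : ℤ → ℝ} (hz : ∀ i, 0 < i → z (-i) ≤ z i ∧ z i ≤ z (1 - i))

include hz in
lemma sorted_le {i j : ℤ} (h : (4 * i - 1).natAbs ≤ (4 * j - 1).natAbs) : z j ≤ z i := by
  -- The enumeration `0, 1, -1, 2, -2, …`, in which `i` has position `(|4i - 1| - 1) / 2`.
  set e : ℕ → ℤ := fun k => if k % 2 = 0 then -((k / 2 : ℕ) : ℤ) else ((k + 1) / 2 : ℕ) with he
  have ha : Antitone fun k => z (e k) := by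
    refine antitone_nat_of_succ_le fun k => ?_
    simp only [he]
    rcases Nat.mod_two_eq_zero_or_one k with h0 | h0
    · rw [if_neg (by omega), if_pos h0]
      have := (hz (((k + 1 + 1) / 2 : ℕ) : ℤ) (by omega)).2
      rwa [show 1 - (((k + 1 + 1) / 2 : ℕ) : ℤ) = -((k / 2 : ℕ) : ℤ) by omega] at this
    · rw [if_pos (by omega), if_neg (by omega)]
      exact (hz (((k + 1) / 2 : ℕ) : ℤ) (by omega)).1
  have hi : ∀ i : ℤ, e (((4 * i - 1).natAbs - 1) / 2) = i := fun i => by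
    simp only [he]
    split_ifs <;> omega
  have := ha (Nat.div_le_div_right (c := 2) (Nat.sub_le_sub_right h 1))
  simpa only [hi] using this

include hz in
lemma bell_step_abs {h : ℝ} (hh : 0 < h) (h0 : ∀ i, 0 ≤ z i) : Bell fun t => step h z |t| := by
  refine ⟨fun t => h0 _, fun x y _ hxy => sorted_le hz ?_⟩
  have h1 : ⌊|y| / h⌋ ≤ ⌊|x| / h⌋ := Int.floor_le_floor (div_le_div_of_nonneg_right hxy hh.le)
  have h2 : 0 ≤ ⌊|y| / h⌋ := Int.floor_nonneg.2 (by positivity)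
  omega

include hz in
lemma step_le_step_abs {h : ℝ} (hh : 0 < h) (t : ℝ) : step h z t ≤ step h z |t| := by
  rcases le_or_gt 0 t with ht | ht
  · rw [abs_of_nonneg ht]
  · refine sorted_le hz ?_
    have h1 : ⌊t / h⌋ < 0 := Int.floor_lt_zero.2 (div_neg_of_neg_of_pos ht hh)
    have h2 : 0 ≤ ⌊|t| / h⌋ := Int.floor_nonneg.2 (by positivity)
    have h3 : ⌊|t| / h⌋ ≤ -⌊t / h⌋ := by
      rw [abs_of_neg ht, neg_div, Int.floor_neg, neg_le_neg_iff]
      exact Int.floor_le_ceil _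
    omega

include hz in
lemma step_le_step_reflect {h : ℝ} (hh : 0 < h) {t : ℝ} (ht : h < t) :
    step h z t ≤ step h z (2 * h - t) := by
  refine sorted_le hz ?_
  have h1 := (floor_div_eq_iff hh t _).1 rfl
  have h2 := (floor_div_eq_iff hh (2 * h - t) _).1 rfl
  have h0 : 1 ≤ ⌊t / h⌋ := Int.le_floor.2 (by
    rw [Int.cast_one, one_le_div hh]
    exact ht.le)
  set i := ⌊t / h⌋
  set j := ⌊(2 * h - t) / h⌋
  have h3 : i + j ≤ 2 := by
    have : ((i : ℝ) + j) ≤ 2 := le_of_mul_le_mul_right (by linarith [h1.1, h2.1]) hh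
    exact_mod_cast this
  have h4 : 0 < i + j := by
    have : (0 : ℝ) < (i : ℝ) + j := lt_of_mul_lt_mul_right (by linarith [h1.2, h2.2]) hh.le
    exact_mod_cast this
  omega

variable {α : ℝ}

include hz in
-- Symmetrising doubles the right half. Its part beyond `h` is at most the integral over `(-∞, h]`,
-- by reflection at `h`; only the first cell is counted in excess.
lemma modular_step_abs_le (hα : 0 < α) {h R : ℝ} (hh : 0 < h) {F : Finset ℤ} (h0 : ∀ i, 0 ≤ z i)
    (hR : ∀ i, z i ≤ R) (hF : ∀ i, i ∉ F → z i = 0) :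
    modular α (fun t => step h z |t|) ≤ modular α (step h z) + 2 * h * young α R := by
  set g : ℝ → ℝ := fun t => young α (step h z t) with hg
  have hi : Integrable g := (orl_step hh hF).integrable_young hα
  have e1 : modular α (fun t => step h z |t|) = 2 * ∫ t in Ioi 0, g t := integral_comp_abs (f := g)
  have e2 : ∫ t in Ioi 0, g t = (∫ t in Ioc 0 h, g t) + ∫ t in Ioi h, g t := by
    rw [← Ioc_union_Ioi_eq_Ioi hh.le, setIntegral_union (by
      rw [disjoint_left]
      intro x hx hx'
      exact absurd hx.2 (not_le.2 hx')) measurableSet_Ioi hi.integrableOn hi.integrableOn]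
  have e3 : ∫ t in Ioc 0 h, g t ≤ h * young α R := by
    have : ∫ t in Ioc 0 h, g t ≤ ∫ t in Ioc 0 h, young α R := by
      refine setIntegral_mono hi.integrableOn (integrableOn_const (by simp)) fun t => ?_
      refine young_mono hα ?_
      rw [step, abs_of_nonneg (h0 _), abs_of_nonneg ((h0 0).trans (hR 0))]
      exact hR _
    rwa [setIntegral_const, Real.volume_real_Ioc_of_le hh.le, sub_zero, smul_eq_mul] at this
  have e4 : ∫ t in Ioi h, g t ≤ ∫ t in Iic h, g t := by
    calc ∫ t in Ioi h, g t ≤ ∫ t in Ioi h, g (2 * h - t) := by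
          refine setIntegral_mono_on hi.integrableOn (hi.comp_sub_left (2 * h)).integrableOn
            measurableSet_Ioi fun t ht => ?_
          refine young_mono hα ?_
          rw [step, abs_of_nonneg (h0 _), step, abs_of_nonneg (h0 _)]
          exact step_le_step_reflect hz hh ht
      _ = ∫ t, (Iio h).indicator g (2 * h - t) := by
          rw [← integral_indicator measurableSet_Ioi]
          refine integral_congr_ae (Eventually.of_forall fun t => ?_)
          simp only
          by_cases ht : h < t
          · rw [indicator_of_mem (show t ∈ Ioi h from ht), indicator_of_mem
              (show 2 * h - t ∈ Iio h from show 2 * h - t < h by linarith)]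
          · rw [indicator_of_notMem (show t ∉ Ioi h from ht), indicator_of_notMem
              (show 2 * h - t ∉ Iio h from fun h' : 2 * h - t < h => ht (by linarith))]
      _ = ∫ t in Iic h, g t := by
          rw [integral_sub_left_eq_self ((Iio h).indicator g) volume (2 * h),
            integral_indicator measurableSet_Iio, integral_Iic_eq_integral_Iio]
  have e5 : (∫ t in Iic h, g t) + ∫ t in Ioi h, g t = modular α (step h z) :=
    intervalIntegral.integral_Iic_add_Ioi hi.integrableOn hi.integrableOn
  rw [e1, e2]
  linarith

end Sorted

variable {α : ℝ}

/-- Approximate rearrangement: bell-shaped functions are almost optimal. -/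
lemma exists_bell_near_J (hα : 0 < α) {ε : ℝ} (hε : 0 < ε) :
    ∃ b : ℝ → ℝ, Bell b ∧ Orl b ∧ modular α b ≤ 1 + ε ∧ J α ^ 2 - ε < quad b := by
  obtain ⟨f, hf, f0, fM, fq⟩ := exists_near_J hα hε
  obtain ⟨R, h, N, x, -, hh, hRε, x0, xR, xF, xM, xq⟩ := exists_step hα hf f0 fq hε
  obtain ⟨z, z0, zR, zF, zM, zq, hz⟩ := exists_sorted (interaction_anti hh)
    continuous_young (young_zero hα) x0 xR xF
  have ho := orl_step hh zF
  have hb := bell_step_abs hz hh z0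
  have hneg : Orl fun t => step h z (-t) :=
    ⟨⟨ho.measurable.comp measurable_neg, ho.1.2.comp_neg⟩, ho.2.comp_neg⟩
  have hob : Orl fun t => step h z |t| := by
    refine (ho.add hneg).mono (ho.measurable.comp measurable_norm) fun t => ?_
    have z0' : ∀ t, 0 ≤ step h z t := fun t => z0 _
    rw [abs_of_nonneg (hb.1 t), abs_of_nonneg (add_nonneg (z0' _) (z0' _))]
    simp only
    rcases abs_cases t with h1 | h1 <;> rw [h1.1]
    · exact le_add_of_nonneg_right (z0' _)
    · exact le_add_of_nonneg_left (z0' _)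
  refine ⟨_, hb, hob, ?_, ?_⟩
  · refine (modular_step_abs_le hz hα hh z0 zR zF).trans ?_
    rw [modular_step hα hh zF]
    have := mul_le_mul_of_nonneg_left zM hh.le
    linarith
  · refine xq.trans_le ?_
    rw [quad_step hh xF]
    refine zq.trans ?_
    rw [← quad_step hh zF]
    exact form_mono _ ho.1 hob.1 ho.1 hob.1 (fun t => z0 _) (fun t => z0 _)
      (step_le_step_abs hz hh) (step_le_step_abs hz hh)

end

/-! ### Compactness and existence of a maximizer -/

section

lemma Bell.measurable {f : ℝ → ℝ} (hb : Bell f) : Measurable f := by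
  have hanti : Antitone fun t => f (Real.exp t) := fun s t hst =>
    hb.2 _ _ (Real.exp_pos s).ne' (by
      rw [abs_of_pos (Real.exp_pos s), abs_of_pos (Real.exp_pos t)]
      exact Real.exp_le_exp.2 hst)
  have h1 : Measurable fun x => f (Real.exp (Real.log x)) :=
    hanti.measurable.comp Real.measurable_log
  have h2 : f = fun x => if x = 0 then f 0 else f (Real.exp (Real.log x)) := by
    funext x
    split_ifs with hx
    · rw [hx]
    · rw [Real.exp_log_eq_abs hx]
      rcases abs_choice x with h | h <;> rw [h]
      exact (hb.neg x).symm
  rw [h2]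
  exact Measurable.ite (measurableSet_singleton 0) measurable_const h1

/-- Helly's selection theorem for bell-shaped functions. -/
lemma exists_bell_subseq {f : ℕ → ℝ → ℝ} (hf : ∀ n, Bell (f n)) {B : ℝ → ℝ}
    (hB : ∀ n x, 0 < x → f n x ≤ B x) : ∃ (g : ℝ → ℝ) (φ : ℕ → ℕ), Bell g ∧ StrictMono φ ∧
      ∀ᵐ x, Tendsto (fun n => f (φ n) x) atTop (𝓝 (g x)) := by
  have hanti : ∀ n {x y : ℝ}, 0 < x → x ≤ y → f n y ≤ f n x := fun n x y hx hxy =>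
    (hf n).2 _ _ hx.ne' (by rwa [abs_of_pos hx, abs_of_pos (hx.trans_le hxy)])
  have hpos : ∀ q : {q : ℚ // 0 < q}, (0 : ℝ) < q.1 := fun q => by exact_mod_cast q.2
  -- Compactness of a countable product replaces the diagonal argument.
  obtain ⟨v, -, φ, hφ, hv⟩ := (isCompact_univ_pi fun q : {q : ℚ // 0 < q} =>
    isCompact_Icc (a := (0 : ℝ)) (b := B q.1)).tendsto_subseq
      (x := fun n q => f n (q.1 : ℝ)) fun n q _ => ⟨(hf n).1 _, hB n _ (hpos q)⟩
  rw [tendsto_pi_nhds] at hv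
  have hv0 : ∀ q, 0 ≤ v q := fun q =>
    ge_of_tendsto (hv q) (Eventually.of_forall fun n => (hf _).1 _)
  set S : ℝ → Set ℝ := fun x => {y | ∃ q : {q : ℚ // 0 < q}, (q.1 : ℝ) < |x| ∧ v q = y} with hS
  have hbdd : ∀ x, BddBelow (S x) := fun x => ⟨0, by rintro _ ⟨q, -, rfl⟩; exact hv0 q⟩
  have hne : ∀ x, x ≠ 0 → (S x).Nonempty := fun x hx => by
    obtain ⟨q, hq1, hq2⟩ := exists_rat_btwn (abs_pos.2 hx)
    exact ⟨_, ⟨q, by exact_mod_cast hq1⟩, hq2, rfl⟩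
  -- At `x = 0` the set is empty and the default value `0` is harmless, since `Bell` ignores the
  -- origin.
  set g : ℝ → ℝ := fun x => sInf (S x) with hg
  have hgb : Bell g := by
    refine ⟨fun x => Real.sInf_nonneg (by rintro _ ⟨q, -, rfl⟩; exact hv0 q), fun x y hy hxy => ?_⟩
    refine csInf_le_csInf (hbdd x) (hne y hy) ?_
    rintro _ ⟨q, hq, rfl⟩
    exact ⟨q, hq.trans_le hxy, rfl⟩
  refine ⟨g, φ, hgb, hφ, ?_⟩
  have hp : ∀ x, 0 < x → ContinuousAt g x → Tendsto (fun n => f (φ n) x) atTop (𝓝 (g x)) := by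
    intro x hx hc
    refine tendsto_order.2 ⟨fun a ha => ?_, fun a ha => ?_⟩
    · obtain ⟨y, hy, hxy⟩ := ((hc.eventually (lt_mem_nhds ha)).filter_mono
        (nhdsWithin_le_nhds (s := Ioi x))).and self_mem_nhdsWithin |>.exists
      obtain ⟨q, hq1, hq2⟩ := exists_rat_btwn (show x < y from hxy)
      have hq0 : 0 < q := by exact_mod_cast hx.trans hq1
      have h1 : a < v ⟨q, hq0⟩ := hy.trans_le (csInf_le (hbdd y)
        ⟨⟨q, hq0⟩, by rwa [abs_of_pos (hx.trans hxy)], rfl⟩)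
      filter_upwards [(hv ⟨q, hq0⟩).eventually (lt_mem_nhds h1)] with n hn
      exact hn.trans_le (hanti _ hx hq1.le)
    · obtain ⟨_, ⟨q, hq, rfl⟩, hqa⟩ := exists_lt_of_csInf_lt (hne x hx.ne') ha
      rw [abs_of_pos hx] at hq
      filter_upwards [(hv q).eventually (gt_mem_nhds hqa)] with n hn
      exact (hanti _ (hpos q) hq.le).trans_lt hn
  filter_upwards [measure_eq_zero_iff_ae_notMem.1 (hgb.countable_not_continuousAt.measure_zero volume),
    measure_eq_zero_iff_ae_notMem.1 (Real.volume_singleton (a := 0))] with x hx hx0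
  have hx' : ContinuousAt g x := not_not.1 hx
  rcases lt_or_gt_of_ne (show x ≠ 0 from hx0) with h | h
  · have h1 : ContinuousAt g (-x) := by
      have : ContinuousAt (g ∘ Neg.neg) (-x) :=
        ContinuousAt.comp (by rwa [neg_neg]) continuous_neg.continuousAt
      exact this.congr (Eventually.of_forall hgb.neg)
    have h2 := hp (-x) (by linarith) h1
    rw [hgb.neg] at h2
    simpa only [(hf _).neg] using h2
  · exact hp x h hx'

variable {α : ℝ}

/-- An integrable majorant common to the whole maximizing sequence. For `|x| ≤ 1` the constant `8α³`
suffices because the power is at least `1/4`; for `|x| ≥ 1` use `f² ≤ 4 / (α(1 + |x|))` in the cubic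
bound. -/
lemma sq_sub_young_le_decay (hα : 0 < α) {f : ℝ → ℝ} (hf : Orl f) (hb : Bell f)
    (hM : modular α f ≤ 2) (x : ℝ) : α * f x ^ 2 - young α (f x) ≤
      (8 * α ^ 3 + (4 / α) ^ (3 / 2 : ℝ)) * (1 + |x|) ^ (-(3 / 2) : ℝ) := by
  have h1 := sq_sub_young_le hα (hb.1 x)
  have hy : 0 < 1 + |x| := by positivity
  set y := 1 + |x|
  have hA : (0 : ℝ) ≤ (4 / α) ^ (3 / 2 : ℝ) := by positivity
  have hy2 : (0 : ℝ) ≤ y ^ (-(3 / 2) : ℝ) := by positivity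
  rcases le_total |x| 1 with hx | hx
  · have h2 : (1 / 4 : ℝ) ≤ y ^ (-(3 / 2) : ℝ) := by
      have h3 : (2 : ℝ) ^ (-2 : ℝ) ≤ y ^ (-(3 / 2) : ℝ) := by
        calc (2 : ℝ) ^ (-2 : ℝ) ≤ 2 ^ (-(3 / 2) : ℝ) :=
              Real.rpow_le_rpow_of_exponent_le (by norm_num) (by norm_num)
          _ ≤ y ^ (-(3 / 2) : ℝ) :=
              Real.rpow_le_rpow_of_nonpos hy (by simp only [y]; linarith) (by norm_num)
      rw [Real.rpow_neg (by norm_num), Real.rpow_two] at h3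
      norm_num at h3 ⊢
      exact h3
    have := mul_le_mul_of_nonneg_left h2 (show 0 ≤ 8 * α ^ 3 by positivity)
    have := mul_nonneg hA hy2
    have := pow_pos hα 3
    linarith [h1.2]
  · have h2 := hb.sq_tail hα hf (x := x)
    have h3 : f x ^ 2 ≤ 4 / α * y⁻¹ := by
      rw [← div_eq_mul_inv, le_div_iff₀ hy, le_div_iff₀ hα]
      have : f x ^ 2 * y * α ≤ 2 * (α * |x| * f x ^ 2) := by
        have h4 : y ≤ 2 * |x| := by simp only [y]; linarith
        have := mul_le_mul_of_nonneg_left h4 (mul_nonneg hα.le (sq_nonneg (f x)))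
        linarith
      linarith
    have h4 : f x ^ 3 ≤ (4 / α) ^ (3 / 2 : ℝ) * y ^ (-(3 / 2) : ℝ) := by
      calc f x ^ 3 = (f x ^ 2) ^ (3 / 2 : ℝ) := by
            rw [← Real.rpow_natCast (f x) 2, ← Real.rpow_mul (hb.1 x), ← Real.rpow_natCast]
            norm_num
        _ ≤ (4 / α * y⁻¹) ^ (3 / 2 : ℝ) :=
            Real.rpow_le_rpow (sq_nonneg _) h3 (by norm_num)
        _ = (4 / α) ^ (3 / 2 : ℝ) * y ^ (-(3 / 2) : ℝ) := by
            rw [Real.mul_rpow (by positivity) (by positivity), Real.inv_rpow hy.le,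
              Real.rpow_neg hy.le]
    have := mul_nonneg hA hy2
    have := mul_nonneg (show 0 ≤ 8 * α ^ 3 by positivity) hy2
    linarith [h1.1]

/-- Existence of a bell-shaped maximizer. -/
lemma exists_bell_maximizer (hα : 0 < α) :
    ∃ f : ℝ → ℝ, Bell f ∧ Orl f ∧ modular α f = 1 ∧ quad f = J α ^ 2 := by
  have hp : ∀ n : ℕ, (0 : ℝ) < 1 / ((n : ℝ) + 1) := fun n => by positivity
  choose F hFb hFo hFM hFq using fun n : ℕ => exists_bell_near_J hα (hp n)
  have hp1 : ∀ n : ℕ, 1 / ((n : ℝ) + 1) ≤ 1 := fun n => by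
    rw [div_le_one (by positivity)]
    linarith [n.cast_nonneg (α := ℝ)]
  have hF2 : ∀ n, modular α (F n) ≤ 2 := fun n => by linarith [hFM n, hp1 n]
  obtain ⟨f, φ, hb, hφ, hlim⟩ := exists_bell_subseq hFb (B := fun x => 1 + 3 / x) fun n x hx => by
    have h1 := (hFb n).cube_tail hα (hFo n) (x := x)
    rw [abs_of_pos hx] at h1
    have h2 : F n x ^ 3 ≤ 3 / x := by
      rw [le_div_iff₀ hx]
      linarith [hF2 n]
    have h3 : 0 ≤ 3 / x := by positivity
    by_contra! h4
    have h5 : F n x ≤ F n x ^ 3 := le_self_pow₀ (by linarith) (by norm_num)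
    linarith
  set g : ℕ → ℝ → ℝ := fun n => F (φ n) with hg
  have hε : Tendsto (fun n : ℕ => 1 / (((φ n : ℕ) : ℝ) + 1)) atTop (𝓝 0) :=
    tendsto_one_div_add_atTop_nhds_zero_nat.comp hφ.tendsto_atTop
  have hyc := continuous_young (α := α)
  have hlimΨ : ∀ᵐ x, Tendsto (fun n => young α (g n x)) atTop (𝓝 (young α (f x))) :=
    hlim.mono fun x hx => (hyc.tendsto _).comp hx
  have hfo : Orl f := by
    refine orl_of_integrable_young hα hb.measurable
      ⟨(hyc.measurable.comp hb.measurable).aestronglyMeasurable, ?_⟩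
    rw [hasFiniteIntegral_iff_ofReal (Eventually.of_forall fun _ => young_nonneg hα _)]
    have h1 : ∫⁻ x, ENNReal.ofReal (young α (f x)) ≤
        liminf (fun n => ∫⁻ x, ENNReal.ofReal (young α (g n x))) atTop := by
      refine le_trans (le_of_eq (lintegral_congr_ae ?_)) (lintegral_liminf_le fun n =>
        (hyc.measurable.comp (hFb _).measurable).ennreal_ofReal)
      filter_upwards [hlimΨ] with x hx
      exact (((ENNReal.continuous_ofReal.tendsto _).comp hx).liminf_eq).symm
    refine lt_of_le_of_lt h1 (lt_of_le_of_lt (b := ENNReal.ofReal 2) ?_ ENNReal.ofReal_lt_top)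
    refine liminf_le_of_le (by isBoundedDefault) fun c hc => ?_
    obtain ⟨n, hn⟩ := hc.exists
    refine hn.trans ?_
    rw [← ofReal_modular hα (hFo _)]
    exact ENNReal.ofReal_le_ofReal (hF2 _)
  have hM1 : modular α f ≤ 1 := by
    by_contra! h
    obtain ⟨c, hc1, hc2⟩ := exists_between h
    obtain ⟨n, hn1, hn2⟩ := ((eventually_lt_integral (hfo.integrable_young hα)
      (fun n => (hFo (φ n)).integrable_young hα) (fun _ => young_nonneg hα _)
      (fun _ _ => young_nonneg hα _) hlimΨ hc2).and
      (hε.eventually (gt_mem_nhds (sub_pos.2 hc1)))).exists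
    have h3 := hFM (φ n)
    change c < modular α (F (φ n)) at hn1
    linarith
  set b : ℝ → ℝ := fun x => (8 * α ^ 3 + (4 / α) ^ (3 / 2 : ℝ)) * (1 + |x|) ^ (-(3 / 2) : ℝ) with hbdef
  have hbi : Integrable b := by
    have : Integrable fun x : ℝ => (1 + ‖x‖) ^ (-(3 / 2) : ℝ) :=
      integrable_one_add_norm (by norm_num)
    exact this.const_mul _
  have hτ : ∀ h : ℝ → ℝ, Orl h → Integrable (fun x => b x - (α * h x ^ 2 - young α (h x))) ∧
      ∫ x, (b x - (α * h x ^ 2 - young α (h x))) = (∫ x, b x) - (α * nsq h - modular α h) := by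
    intro h hh
    have i1 := hh.1.2.const_mul α
    have i2 := hh.integrable_young hα
    have i3 : Integrable fun x => α * h x ^ 2 - young α (h x) := i1.sub i2
    refine ⟨hbi.sub i3, ?_⟩
    rw [integral_sub hbi i3, integral_sub i1 i2, nsq, modular, ← integral_const_mul]
  -- Write `α quad = modular + (α nsq - modular) - α (nsq - quad)` along the sequence. The middle
  -- term is upper semicontinuous thanks to the majorant `b`, and `nsq - quad` is lower
  -- semicontinuous.
  have key : α * J α ^ 2 ≤ 1 - modular α f + α * quad f := by
    refine le_of_forall_pos_le_add fun ε hε' => ?_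
    set δ := ε / (3 + 3 * α) with hδ
    have hδ0 : 0 < δ := by positivity
    have hδe : δ * (3 + 3 * α) = ε := by rw [hδ]; field_simp
    have e1 := eventually_lt_integral (integrable_sq_sub (kap (1 / 2)) hfo.1).1
      (fun n => (integrable_sq_sub (kap (1 / 2)) (hFo (φ n)).1).1) (fun _ => sq_nonneg _)
      (fun _ _ => sq_nonneg _)
      ((ae_prod_add (kap (1 / 2)) hlim).mono fun p hp => (hp.1.sub hp.2).pow 2)
      (sub_lt_self _ hδ0)
    have e2 := eventually_lt_integral (hτ f hfo).1 (fun n => (hτ _ (hFo (φ n))).1)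
      (fun x => sub_nonneg.2 (sq_sub_young_le_decay hα hfo hb (by linarith) x))
      (fun n x => sub_nonneg.2 (sq_sub_young_le_decay hα (hFo _) (hFb _) (hF2 _) x))
      (by
        filter_upwards [hlim, hlimΨ] with x hx hx'
        exact tendsto_const_nhds.sub (((hx.pow 2).const_mul α).sub hx'))
      (sub_lt_self _ hδ0)
    obtain ⟨n, ⟨h1, h2⟩, h3⟩ := ((e1.and e2).and (hε.eventually (gt_mem_nhds hδ0))).exists
    rw [(integrable_sq_sub (kap (1 / 2)) hfo.1).2,
      (integrable_sq_sub (kap (1 / 2)) (hFo (φ n)).1).2] at h1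
    rw [(hτ f hfo).2, (hτ _ (hFo (φ n))).2] at h2
    have h4 := hFM (φ n)
    have h5 := hFq (φ n)
    have h6 : J α ^ 2 < quad (F (φ n)) + δ := by linarith
    have h7 := mul_lt_mul_of_pos_left h6 hα
    have h8 := mul_lt_mul_of_pos_left h1 hα
    simp only [quad] at *
    nlinarith
  have h1 := hb.quad_le hα hfo hM1
  have h2 := one_lt_mul_J_sq hα
  -- Combining `key` with `quad f ≤ J² M` gives `(α J² - 1)(1 - M) ≤ 0`, and `α J² > 1`.
  have hM : modular α f = 1 := by
    refine le_antisymm hM1 ?_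
    have h3 := mul_le_mul_of_nonneg_left h1 hα.le
    by_contra! h4
    nlinarith [mul_pos (sub_pos.2 h2) (sub_pos.2 h4)]
  refine ⟨f, hb, hfo, hM, le_antisymm (by rw [hM, mul_one] at h1; exact h1) ?_⟩
  rw [hM, sub_self, zero_add] at key
  exact le_of_mul_le_mul_left key hα

end

/-! ### The Euler–Lagrange equation and a pointwise bound for averages -/

section

variable {α : ℝ}

lemma abs_dyoung_mul_le (hα : 0 < α) {a b t : ℝ} (ht : |t| ≤ 1) :
    |dyoung α (a + t * b) * b| ≤ 2 * α * (|a| + |b|) ^ 2 + 4 * (|a| + |b|) ^ 3 := by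
  have ha := abs_nonneg a
  have hb := abs_nonneg b
  have h1 : |a + t * b| ≤ |a| + |b| := by
    refine (abs_add_le _ _).trans ?_
    rw [abs_mul]
    nlinarith
  set m := |a| + |b|
  have hm : 0 ≤ m := by positivity
  have h2 := abs_dyoung_le hα (a + t * b)
  have h3 : (a + t * b) ^ 2 ≤ m ^ 2 := sq_le_sq.2 (by rwa [abs_of_nonneg hm])
  have h4 : |dyoung α (a + t * b)| ≤ 2 * α * m + 4 * m ^ 2 := by
    have := mul_le_mul_of_nonneg_left h1 (by positivity : 0 ≤ 2 * α)
    linarith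
  rw [abs_mul]
  calc |dyoung α (a + t * b)| * |b| ≤ (2 * α * m + 4 * m ^ 2) * m :=
        mul_le_mul h4 (by simp only [m]; linarith) hb (by positivity)
    _ = _ := by ring

lemma integrable_dyoung_bound {f h : ℝ → ℝ} (hf : Orl f) (hh : Orl h) :
    Integrable fun x => 2 * α * (|f x| + |h x|) ^ 2 + 4 * (|f x| + |h x|) ^ 3 := by
  have hm := hf.abs.add hh.abs
  refine (hm.1.2.const_mul (2 * α)).add ((hm.2.const_mul 4).congr (Eventually.of_forall fun x => ?_))
  simp only
  rw [abs_of_nonneg (by positivity : 0 ≤ |f x| + |h x|)]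

lemma aestronglyMeasurable_dyoung_mul {f h : ℝ → ℝ} (hf : Orl f) (hh : Orl h) (t : ℝ) :
    AEStronglyMeasurable (fun x => dyoung α (f x + t * h x) * h x) volume :=
  ((continuous_dyoung.measurable.comp
    (hf.measurable.add (hh.measurable.const_mul t))).mul hh.measurable).aestronglyMeasurable

lemma integrable_dyoung_mul_add (hα : 0 < α) {f h : ℝ → ℝ} (hf : Orl f) (hh : Orl h) {t : ℝ}
    (ht : |t| ≤ 1) : Integrable fun x => dyoung α (f x + t * h x) * h x :=
  (integrable_dyoung_bound hf hh).mono' (aestronglyMeasurable_dyoung_mul hf hh t)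
    (Eventually.of_forall fun _ => abs_dyoung_mul_le hα ht)

lemma integrable_dyoung_mul (hα : 0 < α) {f h : ℝ → ℝ} (hf : Orl f) (hh : Orl h) :
    Integrable fun x => dyoung α (f x) * h x := by
  simpa using integrable_dyoung_mul_add hα hf hh (t := 0) (by simp)

lemma tendsto_integral_dyoung (hα : 0 < α) {f h : ℝ → ℝ} (hf : Orl f) (hh : Orl h) :
    Tendsto (fun n : ℕ => ∫ x, dyoung α (f x + 1 / ((n : ℝ) + 1) * h x) * h x) atTop
      (𝓝 (∫ x, dyoung α (f x) * h x)) := by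
  refine tendsto_integral_of_dominated_convergence _
    (fun n => aestronglyMeasurable_dyoung_mul hf hh _) (integrable_dyoung_bound (α := α) hf hh)
    (fun n => Eventually.of_forall fun x => abs_dyoung_mul_le hα ?_)
    (Eventually.of_forall fun x => ?_)
  · rw [abs_of_pos (by positivity), div_le_one (by positivity)]
    linarith [n.cast_nonneg (α := ℝ)]
  · have h1 : Tendsto (fun n : ℕ => f x + 1 / ((n : ℝ) + 1) * h x) atTop (𝓝 (f x)) := by
      simpa using (tendsto_one_div_add_atTop_nhds_zero_nat.mul_const (h x)).const_add (f x)
    exact ((continuous_dyoung.tendsto _).comp h1).mul_const _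

/-- The tangent is taken at the perturbed point, so convexity yields an upper bound for the
perturbed modular. -/
lemma modular_add_le (hα : 0 < α) {f h : ℝ → ℝ} (hf : Orl f) (hh : Orl h) {t : ℝ} (ht : |t| ≤ 1) :
    modular α (fun x => f x + t * h x) ≤
      modular α f + t * ∫ x, dyoung α (f x + t * h x) * h x := by
  have hi := integrable_dyoung_mul_add hα hf hh ht
  rw [modular, modular, ← integral_const_mul, ← integral_add (hf.integrable_young hα)
    (hi.const_mul t)]
  refine integral_mono ((hf.add (hh.const_mul t)).integrable_young hα)
    ((hf.integrable_young hα).add (hi.const_mul t)) fun x => ?_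
  have := young_tangent hα (f x + t * h x) (f x)
  simp only
  linarith

/-- If the modular decreases in the direction `h`, then `f + t h` is a competitor for small `t > 0`,
so `quad` cannot increase to first order. -/
lemma form_nonpos_of_integral_dyoung_neg (hα : 0 < α) {f h : ℝ → ℝ} (hf : Orl f) (hh : Orl h)
    (hM : modular α f = 1) (hE : quad f = J α ^ 2) (hneg : ∫ x, dyoung α (f x) * h x < 0) :
    form (kap (1 / 2)) h f ≤ 0 := by
  have h1 : ∀ᶠ n : ℕ in atTop,
      2 * form (kap (1 / 2)) h f + 1 / ((n : ℝ) + 1) * form (kap (1 / 2)) h h ≤ 0 := by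
    filter_upwards [(tendsto_integral_dyoung hα hf hh).eventually (gt_mem_nhds hneg)] with n hn
    set t := 1 / ((n : ℝ) + 1) with htdef
    have ht : 0 < t := by positivity
    have ht1 : |t| ≤ 1 := by
      rw [abs_of_pos ht, htdef, div_le_one (by positivity)]
      linarith [n.cast_nonneg (α := ℝ)]
    have h2 := modular_add_le hα hf hh ht1
    have h3 := quad_le_J_sq hα (hf.add (hh.const_mul t)) (by nlinarith)
    rw [quad, form_add_mul_self _ (measurePreserving_neg_kap _) hf.1 hh.1] at h3
    rw [quad] at hE
    by_contra! h4
    nlinarith [mul_pos ht h4]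
  have h2 : Tendsto (fun n : ℕ => 2 * form (kap (1 / 2)) h f +
      1 / ((n : ℝ) + 1) * form (kap (1 / 2)) h h) atTop (𝓝 (2 * form (kap (1 / 2)) h f)) := by
    simpa using (tendsto_one_div_add_atTop_nhds_zero_nat.mul_const
      (form (kap (1 / 2)) h h)).const_add (2 * form (kap (1 / 2)) h f)
  have := le_of_tendsto h2 h1
  linarith

/-- The Lagrange multiplier `∫ f Ψ'(f)`. -/
def lagr (α : ℝ) (f : ℝ → ℝ) : ℝ := ∫ x, dyoung α (f x) * f x

lemma one_le_lagr (hα : 0 < α) {f : ℝ → ℝ} (hf : Orl f) (hM : modular α f = 1) :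
    1 ≤ lagr α f := by
  rw [← hM]
  refine integral_mono (hf.integrable_young hα) (integrable_dyoung_mul hα hf hf) fun x => ?_
  have := young_tangent hα (f x) 0
  rw [young_zero hα] at this
  simp only
  linarith

lemma form_le_lagr (hα : 0 < α) {f h : ℝ → ℝ} (hf : Orl f) (hh : Orl h)
    (hM : modular α f = 1) (hE : quad f = J α ^ 2) :
    form (kap (1 / 2)) h f ≤ (∫ x, dyoung α (f x) * h x) / lagr α f * J α ^ 2 := by
  have hL := one_le_lagr hα hf hM
  have hL0 : 0 < lagr α f := by linarith
  have hJ := J_pos hα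
  set D := ∫ x, dyoung α (f x) * h x with hD
  refine le_of_forall_pos_le_add fun ε hε => ?_
  set δ := ε / J α ^ 2 with hδ
  have hδ0 : 0 < δ := by positivity
  -- Slightly more than the coefficient that makes the first variation vanish, so that `h - c f` is
  -- a direction of strict decrease of the modular.
  set c := D / lagr α f + δ with hc
  have i1 := integrable_dyoung_mul hα hf hh
  have i2 := integrable_dyoung_mul hα hf hf
  have hneg : ∫ x, dyoung α (f x) * (h x + -c * f x) < 0 := by
    have e : ∀ x, dyoung α (f x) * (h x + -c * f x) =
        dyoung α (f x) * h x + -c * (dyoung α (f x) * f x) := fun x => by ring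
    simp_rw [e]
    rw [integral_add i1 (i2.const_mul _), integral_const_mul]
    change D + -c * lagr α f < 0
    have : c * lagr α f = D + δ * lagr α f := by rw [hc]; field_simp
    nlinarith [mul_pos hδ0 hL0]
  have h1 := form_nonpos_of_integral_dyoung_neg hα hf (hh.add (hf.const_mul (-c))) hM hE hneg
  rw [form_add_left _ hh.1 (hf.const_mul (-c)).1 hf.1, form_const_mul_left] at h1
  rw [quad] at hE
  rw [hE] at h1
  have h2 : δ * J α ^ 2 = ε := by rw [hδ]; field_simp
  have h3 : c * J α ^ 2 = D / lagr α f * J α ^ 2 + ε := by rw [hc, add_mul, h2]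
  linarith

lemma form_eq_lagr (hα : 0 < α) {f h : ℝ → ℝ} (hf : Orl f) (hh : Orl h)
    (hM : modular α f = 1) (hE : quad f = J α ^ 2) :
    form (kap (1 / 2)) h f = (∫ x, dyoung α (f x) * h x) / lagr α f * J α ^ 2 := by
  refine le_antisymm (form_le_lagr hα hf hh hM hE) ?_
  have h1 := form_le_lagr hα hf (hh.const_mul (-1)) hM hE
  rw [form_const_mul_left] at h1
  have e : ∀ x, dyoung α (f x) * (-1 * h x) = -1 * (dyoung α (f x) * h x) := fun x => by ring
  simp_rw [e] at h1
  rw [integral_const_mul, mul_div_assoc, mul_assoc] at h1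
  linarith

lemma orl_indicator_one {s : Set ℝ} (hs : MeasurableSet s) (hfin : volume s < ⊤) :
    Orl (s.indicator fun _ => (1 : ℝ)) := by
  have hi : Integrable (s.indicator fun _ => (1 : ℝ)) :=
    (integrableOn_const hfin.ne).integrable_indicator hs
  have hm : Measurable (s.indicator fun _ => (1 : ℝ)) := measurable_const.indicator hs
  refine ⟨⟨hm, hi.congr (Eventually.of_forall fun x => ?_)⟩,
    hi.congr (Eventually.of_forall fun x => ?_)⟩ <;>
  · by_cases hx : x ∈ s <;> simp [hx]

/-- The Euler--Lagrange equation. -/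
lemma euler_lagrange (hα : 0 < α) {f : ℝ → ℝ} (hf : Orl f) (hM : modular α f = 1)
    (hE : quad f = J α ^ 2) :
    ∀ᵐ x, avg (kap (1 / 2)) f x = J α ^ 2 / lagr α f * dyoung α (f x) := by
  have hκ := measurePreserving_neg_kap (1 / 2)
  have hi : ∀ s : Set ℝ, ∀ g : ℝ → ℝ, MeasurableSet s →
      (Integrable fun x => s.indicator (fun _ => (1 : ℝ)) x * g x) →
      IntegrableOn g s ∧ ∫ x, s.indicator (fun _ => (1 : ℝ)) x * g x = ∫ x in s, g x := by
    intro s g hs hg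
    have e : (fun x => s.indicator (fun _ => (1 : ℝ)) x * g x) = s.indicator g := by
      funext x
      by_cases hx : x ∈ s <;> simp [hx]
    rw [e] at hg
    rw [e, integral_indicator hs]
    exact ⟨(integrable_indicator_iff hs).1 hg, rfl⟩
  have h1 : ∀ s : Set ℝ, MeasurableSet s → volume s < ⊤ →
      (Integrable fun x => s.indicator (fun _ => (1 : ℝ)) x * avg (kap (1 / 2)) f x) ∧
      (Integrable fun x => s.indicator (fun _ => (1 : ℝ)) x *
        (J α ^ 2 / lagr α f * dyoung α (f x))) ∧
      ∫ x, s.indicator (fun _ => (1 : ℝ)) x * avg (kap (1 / 2)) f x =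
        ∫ x, s.indicator (fun _ => (1 : ℝ)) x * (J α ^ 2 / lagr α f * dyoung α (f x)) := by
    intro s hs hfin
    have ho := orl_indicator_one hs hfin
    have h2 := form_eq_integral_avg _ hκ hf.1 ho.1
    have e : ∀ x, s.indicator (fun _ => (1 : ℝ)) x * (J α ^ 2 / lagr α f * dyoung α (f x)) =
      J α ^ 2 / lagr α f * (dyoung α (f x) * s.indicator (fun _ => (1 : ℝ)) x) := fun x => by ring
    simp_rw [e]
    refine ⟨h2.1, (integrable_dyoung_mul hα hf ho).const_mul _, ?_⟩
    rw [← h2.2, form_eq_lagr hα hf ho hM hE, integral_const_mul]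
    ring
  refine ae_eq_of_forall_setIntegral_eq_of_sigmaFinite
    (fun s hs hfin => (hi s _ hs (h1 s hs hfin).1).1)
    (fun s hs hfin => (hi s _ hs (h1 s hs hfin).2.1).1) fun s hs hfin => ?_
  have h2 := h1 s hs hfin
  rw [← (hi s _ hs h2.1).2, ← (hi s _ hs h2.2.1).2]
  exact h2.2.2

/-- By `Bell.quad_le`, the modular of `(1 - t) f` is at least `(1 - t)²`. Its slope at `t = 0` is
`-lagr α f`, which must be at least `-2`. -/
lemma lagr_le_two (hα : 0 < α) {f : ℝ → ℝ} (hb : Bell f) (hf : Orl f) (hM : modular α f = 1)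
    (hE : quad f = J α ^ 2) : lagr α f ≤ 2 := by
  have hneg := hf.const_mul (-1)
  have e : ∫ x, dyoung α (f x) * (-1 * f x) = -lagr α f := by
    rw [lagr, ← integral_neg]
    refine integral_congr_ae (Eventually.of_forall fun x => ?_)
    simp only
    ring
  have hlim := tendsto_integral_dyoung hα hf hneg
  rw [e] at hlim
  have h1 : -2 ≤ -lagr α f := by
    refine ge_of_tendsto hlim (Eventually.of_forall fun n => ?_)
    set t := 1 / ((n : ℝ) + 1) with htdef
    have ht : 0 < t := by positivity
    have ht1 : t ≤ 1 := by
      rw [htdef, div_le_one (by positivity)]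
      linarith [n.cast_nonneg (α := ℝ)]
    have h2 := modular_add_le hα hf hneg (t := t) (by rwa [abs_of_pos ht])
    have e2 : (fun x => f x + t * (-1 * f x)) = fun x => (1 - t) * f x := funext fun x => by ring
    rw [e2, hM] at h2
    have ho := hf.const_mul (1 - t)
    have hb' : Bell fun x => (1 - t) * f x :=
      ⟨fun x => mul_nonneg (by linarith) (hb.1 x), fun x y hy hxy =>
        mul_le_mul_of_nonneg_left (hb.2 x y hy hxy) (by linarith)⟩
    have h3 : modular α (fun x => (1 - t) * f x) ≤ 1 := by
      refine (modular_mul_le hα (by linarith) (by linarith) hf).trans ?_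
      rw [hM]
      linarith
    have h4 := hb'.quad_le hα ho h3
    rw [quad_const_mul, hE, mul_comm] at h4
    have h5 := le_of_mul_le_mul_left h4 (pow_pos (J_pos hα) 2)
    by_contra! h6
    have h7 := mul_lt_mul_of_pos_left h6 ht
    nlinarith
  linarith

lemma ofReal_avg_le (κ : Measure ℝ) [IsProbabilityMeasure κ] {f : ℝ → ℝ} (hf : Measurable f)
    (h0 : ∀ x, 0 ≤ f x) (x : ℝ) :
    ENNReal.ofReal (avg κ f x) ≤ ∫⁻ t, ENNReal.ofReal (f (x - t)) ∂κ := by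
  have hm : Measurable fun t => f (x - t) := hf.comp (measurable_const.sub measurable_id)
  rw [avg, integral_eq_lintegral_of_nonneg_ae (Eventually.of_forall fun t => h0 _)
    hm.aestronglyMeasurable]
  exact ENNReal.ofReal_toReal_le

lemma lintegral_kap_one_le {f : ℝ → ℝ} (hf : SqInt f) (h0 : ∀ x, 0 ≤ f x) (x : ℝ) :
    ∫⁻ t, ENNReal.ofReal (f (x - t)) ∂kap 1 ≤
      ENNReal.ofReal (√(2 / Real.pi * nsq f)) := by
  have hm : Measurable fun t => ENNReal.ofReal (f (x - t)) :=
    (hf.1.comp (measurable_const.sub measurable_id)).ennreal_ofReal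
  rw [lintegral_kap]
  have hd : Measurable fun t => ENNReal.ofReal (dens 1 t) := (measurable_dens 1).ennreal_ofReal
  have h1 := ENNReal.lintegral_mul_le_Lp_mul_Lq volume Real.HolderConjugate.two_two
    hd.aemeasurable hm.aemeasurable
  refine h1.trans ?_
  have h2 : ∫⁻ t, ENNReal.ofReal (f (x - t)) ^ (2 : ℝ) = ENNReal.ofReal (nsq f) := by
    rw [nsq, ofReal_integral_eq_lintegral_ofReal hf.2 (Eventually.of_forall fun _ => sq_nonneg _)]
    have : ∀ t, ENNReal.ofReal (f (x - t)) ^ (2 : ℝ) = ENNReal.ofReal (f (x - t) ^ 2) := fun t => by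
      rw [ENNReal.rpow_two, ENNReal.ofReal_pow (h0 _)]
    simp_rw [this]
    exact lintegral_sub_left_eq_self (fun t => ENNReal.ofReal (f t ^ 2)) x
  have h3 : ∫⁻ t, ENNReal.ofReal (dens 1 t) ^ (2 : ℝ) ≤ ENNReal.ofReal (2 / Real.pi) := by
    simp_rw [ENNReal.rpow_two]
    exact lintegral_dens_sq_le
  rw [h2]
  calc _ ≤ ENNReal.ofReal (2 / Real.pi) ^ (1 / 2 : ℝ) * ENNReal.ofReal (nsq f) ^ (1 / 2 : ℝ) := by
        gcongr
    _ = ENNReal.ofReal (√(2 / Real.pi * nsq f)) := by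
        rw [ENNReal.ofReal_rpow_of_nonneg (by positivity) (by norm_num),
          ENNReal.ofReal_rpow_of_nonneg (nsq_nonneg f) (by norm_num),
          ← ENNReal.ofReal_mul (by positivity), Real.sqrt_eq_rpow,
          Real.mul_rpow (by positivity) (nsq_nonneg f)]

/-- Inserting the bound for `f` into the average gives two convolutions with `K_{1/2}`, that is one
with `K_1`. Its density is square integrable, so Cauchy–Schwarz applies. -/
lemma avg_le_of_le_avg {f : ℝ → ℝ} (hf : SqInt f) (h0 : ∀ x, 0 ≤ f x) {c : ℝ} (hc : 0 ≤ c)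
    (h : ∀ᵐ x, f x ≤ c * avg (kap (1 / 2)) f x) (x : ℝ) :
    avg (kap (1 / 2)) f x ≤ c * √(2 / Real.pi * nsq f) := by
  rw [← ENNReal.ofReal_le_ofReal_iff (by positivity), ENNReal.ofReal_mul hc]
  refine le_trans ?_ (mul_le_mul_right (lintegral_kap_one_le hf h0 x) _)
  have h1 : ∀ᵐ t ∂kap (1 / 2), f (x - t) ≤ c * avg (kap (1 / 2)) f (x - t) :=
    (kap_absolutelyContinuous _).ae_le
      ((Measure.measurePreserving_sub_left volume x).quasiMeasurePreserving.ae h)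
  have hm : Measurable fun t => ENNReal.ofReal (f (x - t)) :=
    (hf.1.comp (measurable_const.sub measurable_id)).ennreal_ofReal
  calc ENNReal.ofReal (avg (kap (1 / 2)) f x)
      ≤ ∫⁻ t, ENNReal.ofReal (f (x - t)) ∂kap (1 / 2) := ofReal_avg_le _ hf.1 h0 x
    _ ≤ ∫⁻ t, ENNReal.ofReal (c * avg (kap (1 / 2)) f (x - t)) ∂kap (1 / 2) :=
        lintegral_mono_ae (h1.mono fun t ht => ENNReal.ofReal_le_ofReal ht)
    _ ≤ ∫⁻ t, ENNReal.ofReal c * ∫⁻ s, ENNReal.ofReal (f (x - t - s)) ∂kap (1 / 2)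
          ∂kap (1 / 2) := by
        refine lintegral_mono fun t => ?_
        rw [ENNReal.ofReal_mul hc]
        exact mul_le_mul_right (ofReal_avg_le _ hf.1 h0 _) _
    _ = ENNReal.ofReal c * ∫⁻ t, ∫⁻ s, ENNReal.ofReal (f (x - (t + s))) ∂kap (1 / 2)
          ∂kap (1 / 2) := by
        rw [lintegral_const_mul' _ _ ENNReal.ofReal_ne_top]
        simp_rw [sub_sub]
    _ = ENNReal.ofReal c * ∫⁻ t, ENNReal.ofReal (f (x - t)) ∂kap 1 := by
        have := kap_conv_kap (a := 1 / 2) (b := 1 / 2) (by norm_num) (by norm_num)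
        rw [show (1 / 2 + 1 / 2 : ℝ) = 1 by norm_num] at this
        rw [← this, Measure.lintegral_conv hm]

end

/-! ### Maximizers stay below `α` when `α³ ≥ 12` -/

section

variable {α : ℝ}

lemma integrable_pos_part_sq (hα : 0 < α) {f : ℝ → ℝ} (hf : Orl f) :
    Integrable fun x => (max (f x - α) 0) ^ 2 := by
  refine hf.1.2.mono' (((hf.measurable.sub_const α).max measurable_const).pow_const 2
    ).aestronglyMeasurable (Eventually.of_forall fun x => ?_)
  rw [Real.norm_of_nonneg (sq_nonneg _), sq_le_sq, abs_of_nonneg (le_max_right _ _)]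
  exact max_le (by linarith [le_abs_self (f x)]) (abs_nonneg _)

lemma mul_nsq_eq (hα : 0 < α) {f : ℝ → ℝ} (hf : Orl f) (h0 : ∀ x, 0 ≤ f x)
    (hM : modular α f = 1) :
    α * nsq f = 3 - lagr α f + 4 * α * ∫ x, (max (f x - α) 0) ^ 2 := by
  have i1 := hf.integrable_young hα
  have i2 := integrable_dyoung_mul hα hf hf
  have h1 : ∫ x, (3 * young α (f x) - dyoung α (f x) * f x) =
      ∫ x, (α * f x ^ 2 - 4 * α * (max (f x - α) 0) ^ 2) := by
    refine integral_congr_ae (Eventually.of_forall fun x => ?_)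
    simp only
    rw [← young_identity hα (h0 x)]
    ring
  rw [integral_sub (i1.const_mul 3) i2, integral_sub (hf.1.2.const_mul α)
    ((integrable_pos_part_sq hα hf).const_mul _), integral_const_mul, integral_const_mul,
    integral_const_mul] at h1
  change 3 * modular α f - lagr α f = α * nsq f - _ at h1
  rw [hM] at h1
  linarith

/-- The integrand is at most `α² w²` and lives where `Ψ(f) ≥ Ψ(α) = (2/3) α³`, so the modular
controls it. -/
lemma integral_pos_part_sq_le (hα : 0 < α) {f : ℝ → ℝ} (hf : Orl f) (h0 : ∀ x, 0 ≤ f x)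
    (hM : modular α f = 1) {w : ℝ} (hle : ∀ᵐ x, f x ≤ α * (1 + w)) :
    4 * α * ∫ x, (max (f x - α) 0) ^ 2 ≤ 6 * w ^ 2 := by
  have h1 : ∫ x, (max (f x - α) 0) ^ 2 ≤ ∫ x, α ^ 2 * w ^ 2 * (3 / (2 * α ^ 3)) * young α (f x) := by
    refine integral_mono_ae (integrable_pos_part_sq hα hf) ((hf.integrable_young hα).const_mul _) ?_
    filter_upwards [hle] with x hx
    have hy := young_nonneg hα (f x)
    rcases le_total (f x) α with h | h
    · rw [max_eq_right (by linarith), zero_pow two_ne_zero]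
      exact mul_nonneg (by positivity) hy
    · rw [max_eq_left (by linarith)]
      have h2 : 2 / 3 * α ^ 3 ≤ young α (f x) := by
        have := young_mono hα (x := α) (y := f x) (by
          rwa [abs_of_pos hα, abs_of_nonneg (h0 x)])
        rw [young_of_nonneg hα.le, sub_self, max_self] at this
        linarith
      have h3 : (f x - α) ^ 2 ≤ α ^ 2 * w ^ 2 := by
        rw [← mul_pow]
        exact pow_le_pow_left₀ (by linarith) (by linarith) 2
      refine h3.trans ?_
      have h4 : 1 ≤ 3 / (2 * α ^ 3) * young α (f x) := by
        rw [div_mul_eq_mul_div, le_div_iff₀ (by positivity)]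
        linarith
      calc α ^ 2 * w ^ 2 ≤ α ^ 2 * w ^ 2 * (3 / (2 * α ^ 3) * young α (f x)) :=
            le_mul_of_one_le_right (by positivity) h4
        _ = _ := by ring
  rw [integral_const_mul] at h1
  change _ ≤ _ * modular α f at h1
  rw [hM, mul_one] at h1
  have h2 := mul_le_mul_of_nonneg_left h1 (by positivity : 0 ≤ 4 * α)
  have h3 : 4 * α * (α ^ 2 * w ^ 2 * (3 / (2 * α ^ 3))) = 6 * w ^ 2 := by
    field_simp
    ring
  linarith

/-- Both powers of the multiplier, from `L⁴` and from `α nsq f = 3 - L + s`, are worst at `L = 2`,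
where equality holds for `s = 0`. -/
lemma pow_four_mul_le {L s : ℝ} (h1 : 1 ≤ L) (h2 : L ≤ 2) (hs : 0 ≤ s) :
    L ^ 4 * (3 - L + s) ≤ 16 * (1 + s) := by
  have h3 : L ^ 4 ≤ 16 := by
    calc L ^ 4 ≤ 2 ^ 4 := pow_le_pow_left₀ (by linarith) h2 4
      _ = 16 := by norm_num
  have h4 : L ^ 4 * (3 - L) ≤ 16 := by
    have e : 16 - L ^ 4 * (3 - L) = (2 - L) * (8 + 4 * L + 2 * L ^ 2 + L ^ 3 - L ^ 4) := by ring
    have h5 : L ^ 4 ≤ 2 * L ^ 3 := by nlinarith [pow_pos (show 0 < L by linarith) 3]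
    have h6 : L ^ 3 ≤ 2 * L ^ 2 := by nlinarith [pow_pos (show 0 < L by linarith) 2]
    have := mul_nonneg (sub_nonneg.2 h2)
      (show 0 ≤ 8 + 4 * L + 2 * L ^ 2 + L ^ 3 - L ^ 4 by nlinarith)
    linarith
  nlinarith [mul_le_mul_of_nonneg_right h3 hs]

/-- For `α³ ≥ 12` the derivative `Ψ'(f)` of a maximizer stays below `α²`. -/
lemma exists_avg_bound (hα : 0 < α) (hα12 : 12 ≤ α ^ 3) {f : ℝ → ℝ} (hb : Bell f) (hf : Orl f)
    (hM : modular α f = 1) (hE : quad f = J α ^ 2) :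
    ∃ Y < α ^ 2, ∀ x, lagr α f / J α ^ 2 * avg (kap (1 / 2)) f x ≤ Y := by
  have hEL := euler_lagrange hα hf hM hE
  have hL1 := one_le_lagr hα hf hM
  have hL2 := lagr_le_two hα hb hf hM hE
  have hJ1 := one_lt_mul_J_sq hα
  have hJ : 0 < J α ^ 2 := pow_pos (J_pos hα) 2
  have hnsq := mul_nsq_eq hα hf hb.1 hM
  set L := lagr α f with hL
  set j := J α ^ 2 with hj
  have hL0 : 0 < L := by linarith
  have hdy : ∀ᵐ x, dyoung α (f x) = L / j * avg (kap (1 / 2)) f x := by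
    filter_upwards [hEL] with x hx
    rw [hx]
    field_simp
  set c := 27 / 25 * L / (α * j) with hc
  have hc0 : 0 ≤ c := by positivity
  have h1 : ∀ᵐ x, f x ≤ c * avg (kap (1 / 2)) f x := by
    filter_upwards [hdy] with x hx
    have h2 := le_dyoung hα (hb.1 x)
    rw [hx] at h2
    have h3 : c * avg (kap (1 / 2)) f x = 27 / 25 * (L / j * avg (kap (1 / 2)) f x) / α := by
      rw [hc]
      field_simp
    rw [h3, le_div_iff₀ hα]
    linarith
  set Y := L / j * (c * √(2 / Real.pi * nsq f)) with hY
  have hY' : ∀ x, L / j * avg (kap (1 / 2)) f x ≤ Y := fun x =>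
    mul_le_mul_of_nonneg_left (avg_le_of_le_avg hf.1 hb.1 hc0 h1 x) (by positivity)
  refine ⟨Y, ?_, hY'⟩
  by_contra! hYα
  -- Chosen so that `Y = Ψ'(α(1 + w))`; a bound `Y` for `Ψ'(f)` thus means `f ≤ α(1 + w)`.
  set w := √((Y / α ^ 2 - 1) / 3) with hw
  have hw2 : Y = α ^ 2 * (1 + 3 * w ^ 2) := by
    rw [hw, Real.sq_sqrt (by
      have : 1 ≤ Y / α ^ 2 := (one_le_div (by positivity)).2 hYα
      linarith)]
    field_simp
    ring
  have hw0 : 0 ≤ w := Real.sqrt_nonneg _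
  have hfle : ∀ᵐ x, f x ≤ α * (1 + w) := by
    filter_upwards [hdy] with x hx
    have h2 : dyoung α (f x) ≤ Y := hx ▸ hY' x
    by_contra! h3
    have h4 : α ≤ f x := by nlinarith
    rw [dyoung_of_ge hα h4, hw2] at h2
    have h5 : α * w < f x - α := by linarith
    have h6 := pow_lt_pow_left₀ h5 (by positivity) two_ne_zero
    nlinarith
  have hs := integral_pos_part_sq_le hα hf hb.1 hM hfle
  set s := 4 * α * ∫ x, (max (f x - α) 0) ^ 2
  have hs0 : 0 ≤ s := mul_nonneg (by positivity) (integral_nonneg fun _ => sq_nonneg _)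
  have hY2 : Y ^ 2 = (27 / 25) ^ 2 * L ^ 4 * (2 / Real.pi * (α * nsq f)) * α / (α * j) ^ 4 := by
    rw [hY, hc, mul_pow, mul_pow, Real.sq_sqrt (mul_nonneg (by positivity) (nsq_nonneg f))]
    field_simp
  have hY3 : Y ^ 2 ≤ (27 / 25) ^ 2 * L ^ 4 * (2 / Real.pi * (α * nsq f)) * α := by
    rw [hY2]
    refine div_le_self ?_ (one_le_pow₀ hJ1.le)
    have := nsq_nonneg f
    positivity
  have h4 := pow_four_mul_le hL1 hL2 hs0
  have hπ : 2 / Real.pi ≤ 100 / 157 := by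
    rw [div_le_div_iff₀ Real.pi_pos (by norm_num)]
    linarith [Real.pi_gt_d2]
  rw [hnsq] at hY3
  -- Numerically `(27/25)² · (100/157) · 16 ≈ 11.89 < 12`, whereas `Y² = α⁴ (1 + 3w²)² ≥ 12 α (1 +
  -- 6w²)`; this contradiction is the origin of the condition `α³ ≥ 12`.
  have h5 : Y ^ 2 ≤ (27 / 25) ^ 2 * (100 / 157) * (16 * (1 + 6 * w ^ 2)) * α := by
    refine hY3.trans ?_
    have h6 : L ^ 4 * (3 - L + s) ≤ 16 * (1 + 6 * w ^ 2) := h4.trans (by linarith)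
    have h7 : 0 ≤ L ^ 4 * (3 - L + s) := mul_nonneg (by positivity) (by linarith)
    calc (27 / 25) ^ 2 * L ^ 4 * (2 / Real.pi * (3 - L + s)) * α
        = (27 / 25) ^ 2 * (2 / Real.pi * (L ^ 4 * (3 - L + s))) * α := by ring
      _ ≤ (27 / 25) ^ 2 * (100 / 157 * (16 * (1 + 6 * w ^ 2))) * α := by gcongr
      _ = _ := by ring
  have h6 : α * α ^ 3 * (1 + 6 * w ^ 2) ≤ Y ^ 2 := by
    rw [hw2]
    have : 0 ≤ 9 * α ^ 4 * w ^ 4 := by positivity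
    linarith
  have h7 : α * (1 + 6 * w ^ 2) * 12 ≤ α * (1 + 6 * w ^ 2) * α ^ 3 :=
    mul_le_mul_of_nonneg_left hα12 (by positivity)
  have h8 : 0 < α * (1 + 6 * w ^ 2) := by positivity
  linarith

/-- Since `Ψ'(f) < α²`, the derivative can be inverted: `f = α - √(α² - y)` almost everywhere, with
`y` a multiple of `K ∗ f`. The right side is the continuous representative. -/
lemma exists_isMaximizer (hα : 0 < α) (hα12 : 12 ≤ α ^ 3) : ∃ f, IsMaximizer α f ∧ f 0 < α := by
  obtain ⟨f, hb, hf, hM, hE⟩ := exists_bell_maximizer hα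
  obtain ⟨Y, hYα, hY⟩ := exists_avg_bound hα hα12 hb hf hM hE
  have hEL := euler_lagrange hα hf hM hE
  have hL1 := one_le_lagr hα hf hM
  have hJ : 0 < J α ^ 2 := pow_pos (J_pos hα) 2
  set L := lagr α f
  have hL0 : 0 < L := by linarith
  set y : ℝ → ℝ := fun x => L / J α ^ 2 * avg (kap (1 / 2)) f x with hy
  have hy0 : ∀ x, 0 ≤ y x := fun x =>
    mul_nonneg (by positivity) (integral_nonneg fun t => hb.1 _)
  have hfy : ∀ᵐ x, f x = α - √(α ^ 2 - y x) := by
    filter_upwards [hEL] with x hx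
    refine eq_of_dyoung_lt hα (hb.1 x) ?_ ((hY x).trans_lt hYα)
    simp only [hy]
    rw [hx]
    have := (J_pos hα).ne'
    field_simp
  -- A version of `f` bounded everywhere, as the continuity and monotonicity of averages require.
  set g : ℝ → ℝ := fun x => min (f x) α with hg
  have hgb : Bell g := ⟨fun x => le_min (hb.1 x) hα.le, fun x z hz hxz =>
    min_le_min_right α (hb.2 x z hz hxz)⟩
  have hgm : Measurable g := hf.measurable.min measurable_const
  have hfg : f =ᵐ[volume] g := by
    filter_upwards [hfy] with x hx
    rw [hg]
    simp only
    rw [min_eq_left]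
    rw [hx]
    linarith [Real.sqrt_nonneg (α ^ 2 - y x)]
  have hgα : ∀ x, g x ≤ α := fun x => min_le_right _ _
  have hyc : Continuous y := by
    rw [hy, avg_congr_ae _ hfg]
    exact (continuous_avg (by norm_num) hgm hgb hgα).const_mul _
  have hya : ∀ x z, |z| ≤ |x| → y x ≤ y z := fun x z h => by
    simp only [hy]
    rw [avg_congr_ae _ hfg]
    exact mul_le_mul_of_nonneg_left (hgb.avg (by norm_num) hgm hgα h) (by positivity)
  set F : ℝ → ℝ := fun x => α - √(α ^ 2 - y x) with hF
  have hFc : Continuous F := by rw [hF]; fun_prop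
  have hFf : f =ᵐ[volume] F := hfy
  have hFo : Orl F := by
    refine orl_of_integrable_young hα hFc.measurable ((hf.integrable_young hα).congr ?_)
    exact hFf.mono fun x hx => by simp only [hx]
  have hFM : modular α F = 1 := by
    rw [← hM]
    exact integral_congr_ae (hFf.mono fun x hx => by simp only [hx])
  refine ⟨F, ⟨hFc, ⟨fun x => ?_, fun x => ?_, fun x hx z hz hxz => ?_⟩,
    (admissible_iff hα hFc.measurable).2 ⟨hFo, hFM⟩, ?_⟩, ?_⟩
  · simp only [hF]
    rw [le_antisymm (hya (-x) x (abs_neg x).ge) (hya x (-x) (abs_neg x).le)]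
  · have : √(α ^ 2 - y x) ≤ α := Real.sqrt_le_iff.2 ⟨hα.le, by linarith [hy0 x]⟩
    simp only [hF]
    linarith
  · have h1 := hya z x (by rwa [abs_of_pos hx, abs_of_pos hz])
    have := Real.sqrt_le_sqrt (show α ^ 2 - y x ≤ α ^ 2 - y z by linarith)
    simp only [hF]
    linarith
  · rw [← energy_congr_ae hFf, energy_eq hf.1, hE, Real.sqrt_sq (J_nonneg α)]
  · have : 0 < √(α ^ 2 - y 0) := Real.sqrt_pos.2 (by linarith [hY 0])
    simp only [hF]
    linarith

end

/-! ### The threshold and the solitary waves -/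

section

lemma pos_of_rpow_lt {α : ℝ} (hα : (12 : ℝ) ^ (1 / 3 : ℝ) < α) : 0 < α ∧ 12 ≤ α ^ 3 := by
  have h0 : (0 : ℝ) ≤ (12 : ℝ) ^ (1 / 3 : ℝ) := by positivity
  refine ⟨h0.trans_lt hα, ?_⟩
  have h1 := pow_le_pow_left₀ h0 hα.le 3
  rw [← Real.rpow_natCast, ← Real.rpow_mul (by norm_num)] at h1
  norm_num at h1
  exact h1

lemma twelve_rpow_mem : (12 : ℝ) ^ (1 / 3 : ℝ) ∈
    {ξ : ℝ | 0 < ξ ∧ ∀ α : ℝ, ξ < α → ∃ f : ℝ → ℝ, IsMaximizer α f ∧ f 0 < α} :=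
  ⟨by positivity, fun _ hα =>
    exists_isMaximizer (pos_of_rpow_lt hα).1 (pos_of_rpow_lt hα).2⟩

/-- For small `α` the bounds `α J² > 3/2` and `α J² ≤ 3/2` exclude a maximizer below `α`. -/
lemma threshold_pos : 0 < threshold := by
  obtain ⟨β, hβ, h⟩ := three_halves_lt_mul_J_sq
  refine hβ.trans_le (le_csInf ⟨_, twelve_rpow_mem⟩ ?_)
  rintro ξ ⟨hξ, hmax⟩
  by_contra! hlt
  obtain ⟨α, h1, h2⟩ := exists_between hlt
  have hα := hξ.trans h1
  obtain ⟨f, hf, hf0⟩ := hmax α h1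
  exact absurd (hf.mul_J_sq_le hα hf0) (not_le.2 (h α hα h2.le))

lemma threshold_lt :
    threshold < (3 / 2 : ℝ) ^ (4 / 3 : ℝ) * (2 / Real.pi + 1) ^ (2 / 3 : ℝ) := by
  refine (csInf_le ⟨0, fun ξ hξ => hξ.1.le⟩ twelve_rpow_mem).trans_lt ?_
  have hπ : (0 : ℝ) < 2 / Real.pi := by positivity
  have e : (3 / 2 : ℝ) ^ (4 / 3 : ℝ) * (2 / Real.pi + 1) ^ (2 / 3 : ℝ) =
      ((3 / 2) ^ 4 * (2 / Real.pi + 1) ^ 2) ^ (1 / 3 : ℝ) := by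
    rw [Real.mul_rpow (by positivity) (by positivity), ← Real.rpow_natCast, ← Real.rpow_natCast,
      ← Real.rpow_mul (by norm_num), ← Real.rpow_mul (by positivity)]
    norm_num
  rw [e]
  refine Real.rpow_lt_rpow (by norm_num) ?_ (by norm_num)
  -- What is needed is `12 < (3/2)⁴ (2/π + 1)² ≈ 13.56`.
  have h1 : 0.63 ≤ 2 / Real.pi := by
    rw [le_div_iff₀ Real.pi_pos]
    linarith [Real.pi_lt_d2]
  nlinarith

lemma exists_isMaximizer_of_threshold_lt {α : ℝ} (hα : threshold < α) :
    ∃ f : ℝ → ℝ, IsMaximizer α f ∧ f 0 < α := by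
  obtain ⟨ξ, hξ, hlt⟩ := exists_lt_of_csInf_lt ⟨_, twelve_rpow_mem⟩ hα
  exact hξ.2 α hlt

variable {α : ℝ} {f : ℝ → ℝ}

lemma BellShaped.bell (hf : BellShaped f) : Bell f := by
  refine ⟨hf.2.1, fun x y hy hxy => ?_⟩
  have h : ∀ x, f |x| = f x := fun x => by
    rcases abs_choice x with h | h <;> rw [h]
    exact hf.1 x
  rw [← h x, ← h y]
  exact hf.2.2 (abs_pos.2 hy) ((abs_pos.2 hy).trans_le hxy) hxy

lemma IsMaximizer.dyoung_eq (hα : 0 < α) (hf : IsMaximizer α f) (h0 : f 0 < α) (x : ℝ) :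
    dyoung α (f x) = 2 * α * f x - f x ^ 2 := by
  rw [dyoung_of_le hα (hf.2.1.2.1 x) ((hf.2.1.le_zero hf.1 x).trans h0.le)]
  ring

lemma IsMaximizer.young_eq (hf : IsMaximizer α f) (h0 : f 0 < α) (x : ℝ) :
    young α (f x) = α * f x ^ 2 - f x ^ 3 / 3 := by
  rw [young_of_nonneg (hf.2.1.2.1 x), max_eq_right
    (sub_nonpos.2 ((hf.2.1.le_zero hf.1 x).trans h0.le))]
  ring

lemma IsMaximizer.integrable_cube (hα : 0 < α) (hf : IsMaximizer α f) :
    Integrable fun x => f x ^ 3 :=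
  (hf.spec hα).1.2.congr (Eventually.of_forall fun x => by
    simp only
    rw [abs_of_nonneg (hf.2.1.2.1 x)])

/-- Below `α` one has `t Ψ'(t) = 2 Ψ(t) - t³/3`, which identifies the denominator in the solitary
wave. -/
lemma IsMaximizer.lagr_eq (hα : 0 < α) (hf : IsMaximizer α f) (h0 : f 0 < α) :
    lagr α f = 2 - 1 / 3 * ∫ x, f x ^ 3 := by
  obtain ⟨h1, h2, -⟩ := hf.spec hα
  rw [show 2 - 1 / 3 * ∫ x, f x ^ 3 = 2 * modular α f - 1 / 3 * ∫ x, f x ^ 3 by rw [h2, mul_one],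
    modular, lagr, ← integral_const_mul, ← integral_const_mul,
    ← integral_sub ((h1.integrable_young hα).const_mul 2) ((hf.integrable_cube hα).const_mul _)]
  refine integral_congr_ae (Eventually.of_forall fun x => ?_)
  simp only
  rw [hf.dyoung_eq hα h0, hf.young_eq h0]
  ring

lemma IsMaximizer.mul_nsq_eq (hα : 0 < α) (hf : IsMaximizer α f) (h0 : f 0 < α) :
    α * nsq f = 3 - lagr α f := by
  obtain ⟨h1, h2, -⟩ := hf.spec hα
  rw [Whitham.mul_nsq_eq hα h1 hf.2.1.2.1 h2]
  have : ∀ x, max (f x - α) 0 = 0 := fun x =>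
    max_eq_right (sub_nonpos.2 ((hf.2.1.le_zero hf.1 x).trans h0.le))
  simp [this]

/-- Multiply `K ∗ f = (J²/L)(2αf - f²)` by `J²/L`. -/
lemma IsMaximizer.isSolitaryWave (hα : 0 < α) (hf : IsMaximizer α f) (h0 : f 0 < α) :
    IsSolitaryWave (2 * α * J α ^ 2 / (2 - (1 / 3) * ∫ x : ℝ, f x ^ 3))
      (fun x => J α ^ 2 * f x / (2 - (1 / 3) * ∫ x : ℝ, f x ^ 3)) := by
  obtain ⟨h1, h2, h3⟩ := hf.spec hα
  rw [← hf.lagr_eq hα h0]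
  have hL := one_le_lagr hα h1 h2
  have hL0 : lagr α f ≠ 0 := by linarith
  have e : (fun x => J α ^ 2 * f x / lagr α f) = fun x => J α ^ 2 / lagr α f * f x :=
    funext fun x => by ring
  rw [e]
  refine ⟨⟨2, by norm_num, by norm_num, (memLp_two_iff_integrable_sq
    (h1.1.const_mul _).1.aestronglyMeasurable).2 (h1.1.const_mul _).2⟩, ?_⟩
  rw [conv_eq_avg (by norm_num)]
  filter_upwards [euler_lagrange hα h1 h2 h3] with x hx
  have e2 : avg (kap (1 / 2)) (fun x => J α ^ 2 / lagr α f * f x) x =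
      J α ^ 2 / lagr α f * avg (kap (1 / 2)) f x := integral_const_mul _ _
  rw [e2, hx, hf.dyoung_eq hα h0]
  field_simp
  ring

lemma IsMaximizer.euler_lagrange_zero (hα : 0 < α) (hf : IsMaximizer α f) (h0 : f 0 < α) :
    avg (kap (1 / 2)) f 0 = J α ^ 2 / lagr α f * (2 * α * f 0 - f 0 ^ 2) := by
  obtain ⟨h1, h2, h3⟩ := hf.spec hα
  have hb := hf.2.1.bell
  have hc : Continuous (avg (kap (1 / 2)) f) :=
    continuous_avg (by norm_num) hf.1.measurable hb (hf.2.1.le_zero hf.1)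
  have hc' : Continuous fun x => J α ^ 2 / lagr α f * dyoung α (f x) :=
    (continuous_dyoung.comp hf.1).const_mul _
  have := congr_fun ((hc.ae_eq_iff_eq volume hc').1 (euler_lagrange hα h1 h2 h3)) 0
  rw [this, hf.dyoung_eq hα h0]

/-- On `t > r` the averaged values are at most `f r`, elsewhere at most `f 0`. -/
lemma avg_zero_le (κ : Measure ℝ) [IsProbabilityMeasure κ] (hc : Continuous f)
    (hb : BellShaped f) {r : ℝ} (hr : 0 < r) :
    avg κ f 0 ≤ f 0 - (f 0 - f r) * κ.real (Ioi r) := by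
  have hm : Measurable fun t => f (0 - t) := by fun_prop
  have hi : Integrable (fun t => f (0 - t)) κ := by
    refine (integrable_const (f 0)).mono' hm.aestronglyMeasurable (Eventually.of_forall fun t => ?_)
    rw [Real.norm_of_nonneg (hb.2.1 _)]
    exact hb.le_zero hc _
  have hi2 : Integrable ((Ioi r).indicator fun _ => f 0 - f r) κ :=
    (integrable_const _).indicator measurableSet_Ioi
  have h1 : avg κ f 0 ≤ ∫ t, (f 0 - (Ioi r).indicator (fun _ => f 0 - f r) t) ∂κ := by
    refine integral_mono hi ((integrable_const _).sub hi2) fun t => ?_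
    simp only
    rw [zero_sub, hb.1]
    by_cases ht : t ∈ Ioi r
    · rw [indicator_of_mem ht, sub_sub_cancel]
      exact hb.2.2 hr (hr.trans ht) (le_of_lt ht)
    · rw [indicator_of_notMem ht, sub_zero]
      exact hb.le_zero hc _
  rw [integral_sub (integrable_const _) hi2, integral_const, probReal_univ, one_smul,
    integral_indicator measurableSet_Ioi, setIntegral_const, smul_eq_mul, mul_comm] at h1
  exact h1

/-- With `a = f 0`, `q = J²` and `k` the mass of `κ` beyond `r`, the equation at the origin reads
`q(2α - a)a/L ≤ a(1 - k/2)` once `f r ≤ a/2`. Then `a < α` and `L ≤ 3 - αq` give the claim. -/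
lemma IsMaximizer.mul_J_sq_le_of_tail (hα : 0 < α) (hf : IsMaximizer α f) (h0 : f 0 < α)
    {β r : ℝ} (hβ : 0 < β) (hβα : β ≤ α) (hr : r = 3 / (2 * (3 / 7 * β) ^ 3))
    (hj : 7 / 5 < α * J α ^ 2) :
    α * J α ^ 2 * (2 - (kap (1 / 2)).real (Ioi r) / 2) ≤
      3 * (1 - (kap (1 / 2)).real (Ioi r) / 2) := by
  obtain ⟨h1, h2, h3⟩ := hf.spec hα
  have hb := hf.2.1.bell
  have hr0 : 0 < r := by rw [hr]; positivity
  have hL := one_le_lagr hα h1 h2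
  have hn := hf.mul_nsq_eq hα h0
  have hE := quad_le_nsq h1.1
  have hEL := hf.euler_lagrange_zero hα h0
  have hup := avg_zero_le (kap (1 / 2)) hf.1 hf.2.1 hr0
  have hk0 : 0 ≤ (kap (1 / 2)).real (Ioi r) := measureReal_nonneg
  have hk1 : (kap (1 / 2)).real (Ioi r) ≤ 1 := measureReal_le_one
  set k := (kap (1 / 2)).real (Ioi r)
  set L := lagr α f
  set a := f 0
  rw [h3] at hE
  have hJ : 0 < J α ^ 2 := pow_pos (J_pos hα) 2
  set q := J α ^ 2
  have hL3 : L ≤ 3 - α * q := by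
    have := mul_le_mul_of_nonneg_left hE hα.le
    linarith
  have hL0 : 0 < L := by linarith
  have ha : 0 < a := by
    refine lt_of_le_of_ne (hf.2.1.2.1 0) fun h => ?_
    have hz : ∀ x, f x = 0 := fun x =>
      le_antisymm ((hf.2.1.le_zero hf.1 x).trans h.symm.le) (hf.2.1.2.1 x)
    have : modular α f = 0 := by
      rw [modular]
      simp [hz, young_zero hα]
    rw [h2] at this
    exact one_ne_zero this
  rw [hEL] at hup
  have hfr0 := hf.2.1.2.1 r
  have hfra : f r ≤ a := hf.2.1.le_zero hf.1 r
  have h4 : q * (2 * α - a) ≤ L := by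
    have h5 : q / L * (2 * α * a - a ^ 2) ≤ a := by
      have := mul_nonneg (sub_nonneg.2 hfra) hk0
      linarith
    rw [div_mul_eq_mul_div, div_le_iff₀ hL0] at h5
    have h6 : (q * (2 * α - a)) * a ≤ L * a := by linarith
    exact le_of_mul_le_mul_right h6 ha
  -- Otherwise `q(2α - a) > (8/7) αq > 8/5`, while `L ≤ 3 - αq < 8/5`.
  have h5 : 6 / 7 * α ≤ a := by
    by_contra! h6
    have : α * q * (8 / 7) ≤ q * (2 * α - a) := by nlinarith
    linarith
  -- The radius `r` is chosen so that the cubic decay gives `f r ≤ 3β/7`, which is at most `a/2` by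
  -- the previous bound on `a`.
  have h6 : f r ≤ a / 2 := by
    have h7 := hb.cube_tail hα h1 (x := r)
    rw [h2, abs_of_pos hr0, hr] at h7
    have h8 : f r ^ 3 ≤ (3 / 7 * β) ^ 3 := by
      rw [← hr] at h7
      have h9 : r * (2 * (3 / 7 * β) ^ 3) = 3 := by
        rw [hr]
        field_simp
      have h10 : (2 * r) * f r ^ 3 ≤ (2 * r) * (3 / 7 * β) ^ 3 := by linarith
      exact le_of_mul_le_mul_left h10 (by positivity)
    have h9 : f r ≤ 3 / 7 * β := le_of_pow_le_pow_left₀ three_ne_zero (by positivity) h8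
    linarith
  have h7 : q / L * (2 * α * a - a ^ 2) ≤ a * (1 - k / 2) := by
    have := mul_le_mul_of_nonneg_right h6 hk0
    linarith
  rw [div_mul_eq_mul_div, div_le_iff₀ hL0] at h7
  have h8 : q * (2 * α - a) ≤ L * (1 - k / 2) := by
    have h9 : (q * (2 * α - a)) * a ≤ (L * (1 - k / 2)) * a := by linarith
    exact le_of_mul_le_mul_right h9 ha
  have h9 : q * α ≤ q * (2 * α - a) := mul_le_mul_of_nonneg_left (by linarith) hJ.le
  have h10 := mul_le_mul_of_nonneg_right hL3 (by linarith : 0 ≤ 1 - k / 2)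
  linarith

/-- The radius depends on the threshold alone, so the mass `k > 0` beyond it gives an improvement
uniform in `α`. -/
lemma exists_mul_J_sq_le : ∃ q < 3 / 2, ∀ α, threshold < α → α * J α ^ 2 ≤ q := by
  set r := 3 / (2 * (3 / 7 * threshold) ^ 3) with hr
  have hr0 : 0 < r := by
    have := threshold_pos
    rw [hr]
    positivity
  set k := (kap (1 / 2)).real (Ioi r) with hk
  have hk0 : 0 < k := ENNReal.toReal_pos (kap_Ioi_pos (by norm_num) r hr0.le).ne'
    (measure_ne_top _ _)
  have hk1 : k ≤ 1 := measureReal_le_one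
  refine ⟨max (7 / 5) (3 * (1 - k / 2) / (2 - k / 2)), max_lt (by norm_num) ?_, fun α hα => ?_⟩
  · rw [div_lt_iff₀ (by linarith)]
    linarith
  · by_cases hj : 7 / 5 < α * J α ^ 2
    · obtain ⟨f, hf, h0⟩ := exists_isMaximizer_of_threshold_lt hα
      refine le_max_of_le_right ?_
      rw [le_div_iff₀ (by linarith)]
      exact hf.mul_J_sq_le_of_tail (threshold_pos.trans hα) h0 threshold_pos hα.le hr hj
    · exact le_max_of_le_left (not_lt.1 hj)

/-- A maximizer at the threshold itself need not lie below it, so the uniform bound from above is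
carried down by `J_sq_le_of_le` with `α = α₀ (1 + ε)`. -/
lemma threshold_mul_J_sq_lt : threshold * J threshold ^ 2 < 3 / 2 := by
  obtain ⟨q, hq, h⟩ := exists_mul_J_sq_le
  have h0 := threshold_pos
  have key : ∀ n : ℕ, threshold * J threshold ^ 2 ≤ (1 + 2 * (1 / ((n : ℝ) + 1))) ^ 2 * q := by
    intro n
    set ε := 1 / ((n : ℝ) + 1)
    have hε : 0 < ε := by positivity
    have hlt : threshold < threshold * (1 + ε) := by nlinarith
    have h1 := J_sq_le_of_le h0 hlt.le
    have e : 2 * (threshold * (1 + ε) / threshold) - 1 = 1 + 2 * ε := by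
      field_simp
      ring
    rw [e] at h1
    have h2 : threshold * J (threshold * (1 + ε)) ^ 2 ≤ q :=
      (mul_le_mul_of_nonneg_right hlt.le (sq_nonneg _)).trans (h _ hlt)
    calc threshold * J threshold ^ 2
        ≤ threshold * ((1 + 2 * ε) ^ 2 * J (threshold * (1 + ε)) ^ 2) :=
          mul_le_mul_of_nonneg_left h1 h0.le
      _ = (1 + 2 * ε) ^ 2 * (threshold * J (threshold * (1 + ε)) ^ 2) := by ring
      _ ≤ _ := mul_le_mul_of_nonneg_left h2 (sq_nonneg _)
  have hlim : Tendsto (fun n : ℕ => (1 + 2 * (1 / ((n : ℝ) + 1))) ^ 2 * q) atTop (𝓝 q) := by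
    simpa using (((tendsto_one_div_add_atTop_nhds_zero_nat (𝕜 := ℝ)).const_mul 2).const_add 1).pow 2
      |>.mul_const q
  exact (ge_of_tendsto' hlim key).trans_lt hq

end

end Whitham

end

theorem mainTheorem6 :
    0 < Whitham.threshold ∧
    1 < Whitham.threshold * Whitham.J Whitham.threshold ^ 2 ∧
    Whitham.threshold * Whitham.J Whitham.threshold ^ 2 < 3 / 2 ∧
    Whitham.threshold < (3 / 2 : ℝ) ^ (4 / 3 : ℝ) * (2 / Real.pi + 1) ^ (2 / 3 : ℝ) ∧
    ∀ α : ℝ, Whitham.threshold < α →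
      ∃ f : ℝ → ℝ, Whitham.IsMaximizer α f ∧ f 0 < α ∧
        Whitham.IsSolitaryWave
          (2 * α * Whitham.J α ^ 2 / (2 - (1 / 3) * ∫ x : ℝ, f x ^ 3))
          (fun x => Whitham.J α ^ 2 * f x / (2 - (1 / 3) * ∫ x : ℝ, f x ^ 3)) := by
  refine ⟨Whitham.threshold_pos, Whitham.one_lt_mul_J_sq Whitham.threshold_pos,
    Whitham.threshold_mul_J_sq_lt, Whitham.threshold_lt, fun α hα => ?_⟩
  obtain ⟨f, hf, h0⟩ := Whitham.exists_isMaximizer_of_threshold_lt hα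
  exact ⟨f, hf, h0, hf.isSolitaryWave (Whitham.threshold_pos.trans hα) h0⟩
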